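/- Throughout, $V=\mathbb{R}^{d+1}$, and $\Omega\subset \mathrm{P}(V)$ is a properly convex open set, i.e. a non-empty open set which is convex and bounded in some affine chart; $\mathrm{Aut}(\Omega)\subset\mathrm{PGL}(V)$ is the group of projective transformations preserving $\Omega$. **Definitions.** A point $\xi\in\partial\Omega$ is *smooth* if there is exactly one hyperplane containing $\xi$ and disjoint from $\Omega$; it is *strongly extremal* if it is contained in no non-trivial segment contained in $\partial\Omega$. Let $\mathrm{Geod}(\Omega)$ be the set of pairs $(\xi,\eta)\in\partial\Omega^2$ with $\xi\neq\eta$ such that the projective line through $\xi$ and $\eta$ meets $\Omega$. An element of $\mathrm{PGL}(V)$ is *proximal* if its lifts to $\mathrm{GL}(V)$ have exactly one complex eigenvalue of maximal modulus and this eigenvalue has multiplicity $1$; the corresponding eigenline is its attracting fixed point. An element $g$ is *biproximal* if $g$ and $g^{-1}$ are proximal, and then $x_g^+$ and $x_g^-$ denote the attracting fixed points of $g$ and $g^{-1}$. Let $T^1\Omega$ be the unit tangent bundle for the Hilbert metric $d_\Omega(x,y)=\frac12\log[a,x,y,b]$, with $a,b$ the points of $\partial\Omega$ such that $a,x,y,b$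 are aligned in this order, and the cross-ratio is normalised by $[0,1,t,\infty]=t$. Let $(\phi_t)_{t\in\mathbb{R}}$ be the geodesic flow following at unit speed the geodesics contained in projective lines, $\pi:T^1\Omega\to\Omega$ the projection, and $\phi_{\pm\infty}v=\lim_{t\to\pm\infty}\pi\phi_tv\in\partial\Omega$. For a discrete subgroup $\Gamma\subset\mathrm{Aut}(\Omega)$, let $M=\Omega/\Gamma$ and $T^1M=T^1\Omega/\Gamma$. The *proximal limit set* $\Lambda_\Gamma$ is the closure of the set of attracting fixed points of proximal elements of $\Gamma$, and $T^1M_{bip}=\{v\in T^1\Omega:\phi_{\pm\infty}v\in\Lambda_\Gamma\}/\Gamma\subset T^1M$. A vector $v\in T^1M$ that is periodic for the geodesic flow is *rank-one* if, for any lift $\tilde v\in T^1\Omega$, both points $\phi_{\pm\infty}\tilde v$ are smooth and strongly extremal; an infinite-order element of $\Gamma$ preserving the $(\phi_t)$-orbit of such a $\tilde v$ is then called *rank-one*. An automorphism $g\in\mathrm{Aut}(\Omega)$ is *rank-one* if it is a rank-one element of the group $\Gamma=\langle g\rangle$. The quotient $M$ is *rank-one* if $T^1M$ contains a rank-one periodic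 vector. Finally, $\Gamma$ is *strongly irreducible* if it preserves no non-empty finite union of proper projective subspaces of $\mathrm{P}(V)$. **Proposition 3.3.** 1. For any $(\xi,\eta)\in\mathrm{Geod}(\Omega)$ such that $\xi$ is strongly extremal, there exist neighbourhoods $U$ of $\xi$ and $W$ of $\eta$ in $\mathrm{P}(V)$ such that every biproximal $g\in\mathrm{Aut}(\Omega)$ with $(x_g^+,x_g^-)\in U\times W$ is rank-one. 2. If $\Gamma\subset\mathrm{Aut}(\Omega)$ is a strongly irreducible discrete subgroup such that $M=\Omega/\Gamma$ is rank-one, then the set of rank-one periodic vectors of $T^1M$ (the vectors tangent to rank-one periodic geodesics) is contained and dense in $T^1M_{bip}$. In particular $T^1M_{bip}$ is not empty. -/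

import Mathlib

open Filter Topology Set
open scoped LinearAlgebra.Projectivization MatrixGroups Matrix Pointwise

namespace ConvexProjective

/-- The vector space `V = ℝ^{d+1}`. -/
abbrev E (d : ℕ) : Type := Fin (d + 1) → ℝ

/-- The real projective space `P(V)`. -/
abbrev P (d : ℕ) : Type := ℙ ℝ (E d)

/-- The quotient topology on `P(V)`, as a quotient of `V ∖ {0}`. -/
noncomputable instance instTopologicalSpaceP (d : ℕ) : TopologicalSpace (P d) :=
  TopologicalSpace.coinduced
    (fun v : {v : E d // v ≠ 0} => Projectivization.mk ℝ v.1 v.2) inferInstance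

/-- The projective linear group `PGL(V)`, the quotient of `GL(V)` by its centre. -/
abbrev PGLV (d : ℕ) : Type := PGL(Fin (d + 1), ℝ)

/-- The quotient topology on `PGL(V)`. -/
instance instTopologicalSpacePGLV (d : ℕ) : TopologicalSpace (PGLV d) :=
  TopologicalSpace.coinduced
    (fun g : GL (Fin (d + 1)) ℝ => Matrix.ProjGenLinGroup.mk g) inferInstance

variable {d : ℕ}

/-- The vector `v` is non-zero and spans the line `x`, i.e. `x = [v]`. -/
def Represents (v : E d) (x : P d) : Prop :=
  ∃ h : v ≠ 0, Projectivization.mk ℝ v h = x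

/-! ### Properly convex open sets and the regularity of their boundary -/

/-- `Ω` is a non-empty open subset of `P(V)` that is contained, convex and bounded in some affine
chart. The chart given by the linear form `f` is `{[v] : f v ≠ 0}`, identified with the affine
hyperplane `{v : f v = 1}`. -/
structure IsProperlyConvexOpen (Ω : Set (P d)) : Prop where
  nonempty : Ω.Nonempty
  isOpen : IsOpen Ω
  exists_chart : ∃ f : E d →ₗ[ℝ] ℝ,
    (∀ x ∈ Ω, ∀ v, Represents v x → f v ≠ 0) ∧
    Convex ℝ {v : E d | f v = 1 ∧ ∃ x ∈ Ω, Represents v x} ∧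
    Bornology.IsBounded {v : E d | f v = 1 ∧ ∃ x ∈ Ω, Represents v x}

/-- The group `Aut(Ω)` of elements of `PGL(V)` preserving `Ω`. -/
noncomputable def Aut (Ω : Set (P d)) : Subgroup (PGLV d) := MulAction.stabilizer (PGLV d) Ω

/-- The (projective) hyperplane `H` is a supporting hyperplane of `Ω` at `ξ`: it contains `ξ` and
does not intersect `Ω`. -/
def IsSupportingHyperplane (Ω : Set (P d)) (ξ : P d) (H : Submodule ℝ (E d)) : Prop :=
  IsCoatom H ∧ ξ.submodule ≤ H ∧ ∀ x ∈ Ω, ¬ x.submodule ≤ H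

/-- `ξ ∈ ∂Ω` is smooth: there is only one supporting hyperplane of `Ω` at `ξ`. -/
def IsSmoothPoint (Ω : Set (P d)) (ξ : P d) : Prop :=
  ξ ∈ frontier Ω ∧ ∃! H : Submodule ℝ (E d), IsSupportingHyperplane Ω ξ H

/-- The projective segment `{[(1 - s) u + s w] : 0 ≤ s ≤ 1}`. For `u`, `w` linearly independent it
is one of the two segments joining `[u]` and `[w]`, the other one being obtained from `u`, `-w`. -/
def projSegment (u w : E d) : Set (P d) :=
  {x | ∃ v ∈ segment ℝ u w, Represents v x}

/-- `ξ ∈ ∂Ω` is strongly extremal: it is contained in no non-trivial segment of `∂Ω`. -/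
def IsStronglyExtremal (Ω : Set (P d)) (ξ : P d) : Prop :=
  ξ ∈ frontier Ω ∧ ∀ u w : E d, LinearIndependent ℝ ![u, w] →
    projSegment u w ⊆ frontier Ω → ξ ∉ projSegment u w

/-- The set of straight geodesics of `Ω`, seen as pairs `(ξ, η)` of distinct points of `∂Ω` such
that the projective line through `ξ` and `η` meets `Ω`. -/
def Geod (Ω : Set (P d)) : Set (P d × P d) :=
  {p | p.1 ∈ frontier Ω ∧ p.2 ∈ frontier Ω ∧ p.1 ≠ p.2 ∧
    ∃ x ∈ Ω, x.submodule ≤ p.1.submodule ⊔ p.2.submodule}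

/-! ### Hilbert metric, unit tangent bundle and geodesic flow -/

/-- The Hilbert metric `d_Ω(x, y) = (1/2) log [a, x, y, b]`, for `a, b ∈ ∂Ω` such that
`a, x, y, b` are aligned in this order. In the projective coordinate of the line `(a b)` for which
`a = [u]`, `x = [u + w]`, `b = [w]` are `0`, `1`, `∞`, the point `y = [u + τ w]` is `τ`; so the
cross-ratio is `τ`, and the order is `a, x, y, b` when `1 ≤ τ`. For `x, y ∈ Ω` the set below has
exactly one element (when `d ≥ 1`). -/
noncomputable def hilbertDist (Ω : Set (P d)) (x y : P d) : ℝ :=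
  sSup {r : ℝ | ∃ u w : E d, ∃ τ : ℝ, LinearIndependent ℝ ![u, w] ∧ 1 ≤ τ ∧
    (∃ a ∈ frontier Ω, Represents u a) ∧ (∃ b ∈ frontier Ω, Represents w b) ∧
    Represents (u + w) x ∧ Represents (u + τ • w) y ∧ r = (1 / 2) * Real.log τ}

/-- The unit tangent bundle `T¹Ω` for the Hilbert metric. A unit tangent vector `v` is recorded by
the straight geodesic `t ↦ π φ_t v` it generates, i.e. by the parametrisation `c` of its projective
line which is an isometric embedding of `ℝ` into `(Ω, d_Ω)` and satisfies `c'(0) = v`. -/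
structure T1 (Ω : Set (P d)) where
  /-- The straight geodesic generated by the vector. -/
  curve : ℝ → P d
  mem : ∀ t, curve t ∈ Ω
  isometric : ∀ s t, hilbertDist Ω (curve s) (curve t) = |s - t|
  straight : ∃ L : Submodule ℝ (E d), Module.finrank ℝ L = 2 ∧ ∀ t, (curve t).submodule ≤ L

variable {Ω : Set (P d)}

/-- The geodesic flow `φ_t` on `T¹Ω`. -/
def T1.flow (t : ℝ) (v : T1 Ω) : T1 Ω where
  curve s := v.curve (s + t)
  mem s := v.mem _
  isometric s s' := by rw [v.isometric]; congr 1; ring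
  straight := by
    obtain ⟨L, hL, h⟩ := v.straight
    exact ⟨L, hL, fun s => h _⟩

/-- The metric `d_{T¹Ω}(v, w) = max_{0 ≤ t ≤ 1} d_Ω(π φ_t v, π φ_t w)`. -/
noncomputable def T1.dist (v w : T1 Ω) : ℝ :=
  sSup ((fun t => hilbertDist Ω (v.curve t) (w.curve t)) '' Icc 0 1)

/-- The topology of `T¹Ω` defined by the metric `d_{T¹Ω}`. -/
instance instTopologicalSpaceT1 : TopologicalSpace (T1 Ω) where
  IsOpen U := ∀ v ∈ U, ∃ r > 0, ∀ w, T1.dist v w < r → w ∈ U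
  isOpen_univ := fun _ _ => ⟨1, one_pos, fun _ _ => trivial⟩
  isOpen_inter := by
    intro U W hU hW v hv
    obtain ⟨r, hr, h⟩ := hU v hv.1
    obtain ⟨r', hr', h'⟩ := hW v hv.2
    exact ⟨min r r', lt_min hr hr', fun w hw =>
      ⟨h w (hw.trans_le (min_le_left _ _)), h' w (hw.trans_le (min_le_right _ _))⟩⟩
  isOpen_sUnion := by
    intro S hS v hv
    obtain ⟨U, hU, hvU⟩ := hv
    obtain ⟨r, hr, h⟩ := hS U hU v hvU
    exact ⟨r, hr, fun w hw => ⟨U, hU, h w hw⟩⟩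

/-- `ξ = φ_{∞} v = lim_{t → ∞} π φ_t v`. -/
def T1.HasForwardEndpoint (v : T1 Ω) (ξ : P d) : Prop := Tendsto v.curve atTop (𝓝 ξ)

/-- `ξ = φ_{-∞} v = lim_{t → -∞} π φ_t v`. -/
def T1.HasBackwardEndpoint (v : T1 Ω) (ξ : P d) : Prop := Tendsto v.curve atBot (𝓝 ξ)

/-! ### The quotient `M = Ω / Γ` -/

/-- Two vectors of `T¹Ω` are identified when an element of `Γ` sends the one to the other. -/
def t1Setoid (Ω : Set (P d)) (Γ : Subgroup (PGLV d)) : Setoid (T1 Ω) where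
  r v w := ∃ γ ∈ Γ, ∀ t, γ • v.curve t = w.curve t
  iseqv :=
    { refl := fun v => ⟨1, Γ.one_mem, fun t => one_smul _ _⟩
      symm := by
        rintro v w ⟨γ, hγ, h⟩
        exact ⟨γ⁻¹, Γ.inv_mem hγ, fun t => by rw [← h t, inv_smul_smul]⟩
      trans := by
        rintro u v w ⟨γ, hγ, h⟩ ⟨γ', hγ', h'⟩
        exact ⟨γ' * γ, Γ.mul_mem hγ' hγ, fun t => by rw [mul_smul, h t, h' t]⟩ }

/-- The unit tangent bundle `T¹M = T¹Ω / Γ` of `M = Ω / Γ`, with the quotient topology. -/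
def T1M (Ω : Set (P d)) (Γ : Subgroup (PGLV d)) : Type := Quotient (t1Setoid Ω Γ)

instance instTopologicalSpaceT1M (Γ : Subgroup (PGLV d)) : TopologicalSpace (T1M Ω Γ) :=
  inferInstanceAs (TopologicalSpace (Quotient (t1Setoid Ω Γ)))

/-- The projection `T¹Ω → T¹M`. -/
def T1.proj (Γ : Subgroup (PGLV d)) (v : T1 Ω) : T1M Ω Γ := Quotient.mk (t1Setoid Ω Γ) v

/-- The geodesic flow on `T¹M`. -/
def T1M.flow {Γ : Subgroup (PGLV d)} (t : ℝ) : T1M Ω Γ → T1M Ω Γ :=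
  Quotient.map (T1.flow t) (by
    rintro v w ⟨γ, hγ, h⟩
    exact ⟨γ, hγ, fun s => h (s + t)⟩)

/-- The vector `v ∈ T¹M` is periodic for the geodesic flow. -/
def T1M.IsPeriodic {Γ : Subgroup (PGLV d)} (v : T1M Ω Γ) : Prop := ∃ t > 0, T1M.flow t v = v

/-- The vector `v ∈ T¹M` is periodic and rank-one: for any lift of `v` to `T¹Ω`, both endpoints are
smooth and strongly extremal points of `∂Ω`. -/
def T1M.IsRankOnePeriodic {Γ : Subgroup (PGLV d)} (v : T1M Ω Γ) : Prop :=
  v.IsPeriodic ∧ ∀ v' : T1 Ω, T1.proj Γ v' = v →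
    (∃ ξ, v'.HasForwardEndpoint ξ ∧ IsSmoothPoint Ω ξ ∧ IsStronglyExtremal Ω ξ) ∧
    (∃ η, v'.HasBackwardEndpoint η ∧ IsSmoothPoint Ω η ∧ IsStronglyExtremal Ω η)

/-- `M = Ω / Γ` is rank-one: `T¹M` contains a rank-one periodic vector. -/
def IsRankOneQuotient (Ω : Set (P d)) (Γ : Subgroup (PGLV d)) : Prop :=
  ∃ v : T1M Ω Γ, v.IsRankOnePeriodic

/-- `γ` is a rank-one element of `Γ`: it has infinite order and preserves the orbit under the
geodesic flow of a lift of a rank-one periodic vector of `T¹M`. -/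
def IsRankOneElement (Ω : Set (P d)) (Γ : Subgroup (PGLV d)) (γ : PGLV d) : Prop :=
  γ ∈ Γ ∧ ¬ IsOfFinOrder γ ∧ ∃ v : T1 Ω, (v.proj Γ).IsRankOnePeriodic ∧
    ∃ s : ℝ, ∀ t, γ • v.curve t = (v.flow s).curve t

/-- An automorphism `g` of `Ω` is rank-one if it is a rank-one element of the group it generates.
(For `g` in a discrete group `Γ` of automorphisms this amounts to being a rank-one element of
`Γ`.) -/
def IsRankOneAut (Ω : Set (P d)) (g : PGLV d) : Prop :=
  IsRankOneElement Ω (Subgroup.zpowers g) g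

/-! ### Proximality -/

/-- The linear transformation `g` is proximal with attracting fixed point `x`: it has exactly one
complex eigenvalue of maximal modulus, this eigenvalue has (algebraic) multiplicity one, and `x` is
the associated eigenline. Since non-real eigenvalues come in conjugate pairs, the dominant
eigenvalue `μ` is real. -/
def IsAttractingFixedPointGL (g : GL (Fin (d + 1)) ℝ) (x : P d) : Prop :=
  ∃ μ : ℝ,
    ((g.1.charpoly.map (algebraMap ℝ ℂ)).roots.count (μ : ℂ) = 1) ∧
    (∀ ν ∈ (g.1.charpoly.map (algebraMap ℝ ℂ)).roots, ν ≠ (μ : ℂ) → ‖ν‖ < ‖(μ : ℂ)‖) ∧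
    ∀ v ∈ x.submodule, g.1 *ᵥ v = μ • v

/-- `g ∈ PGL(V)` is proximal with attracting fixed point `x = x_g⁺`; this does not depend on the
lift of `g` to `GL(V)`. -/
def IsAttractingFixedPoint (g : PGLV d) (x : P d) : Prop :=
  ∃ g' : GL (Fin (d + 1)) ℝ, Matrix.ProjGenLinGroup.mk g' = g ∧ IsAttractingFixedPointGL g' x

/-- `g ∈ PGL(V)` is proximal. -/
def IsProximal (g : PGLV d) : Prop := ∃ x, IsAttractingFixedPoint g x

/-- `g ∈ PGL(V)` is biproximal. -/
def IsBiproximal (g : PGLV d) : Prop := IsProximal g ∧ IsProximal g⁻¹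

/-- `y = x_g⁻` is the repelling fixed point of `g`, i.e. the attracting fixed point of `g⁻¹`. -/
def IsRepellingFixedPoint (g : PGLV d) (y : P d) : Prop := IsAttractingFixedPoint g⁻¹ y

/-- The proximal limit set `Λ_Γ`. -/
def proximalLimitSet (Γ : Subgroup (PGLV d)) : Set (P d) :=
  closure {x | ∃ γ ∈ Γ, IsAttractingFixedPoint γ x}

/-- `Γ` is strongly irreducible: it preserves no non-empty finite union of proper projective
subspaces of `P(V)`. -/
def IsStronglyIrreducible (Γ : Subgroup (PGLV d)) : Prop :=
  ∀ S : Set (Submodule ℝ (E d)), S.Finite → (∀ W ∈ S, W ≠ ⊤) →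
    (∀ γ ∈ Γ, γ • {x : P d | ∃ W ∈ S, x.submodule ≤ W} = {x : P d | ∃ W ∈ S, x.submodule ≤ W}) →
    {x : P d | ∃ W ∈ S, x.submodule ≤ W} = ∅

/-- The biproximal unit tangent bundle `T¹M_bip`: the image in `T¹M` of the set of vectors of `T¹Ω`
both of whose endpoints lie in the proximal limit set. -/
def T1Mbip (Ω : Set (P d)) (Γ : Subgroup (PGLV d)) : Set (T1M Ω Γ) :=
  T1.proj Γ '' {v : T1 Ω |
    (∃ ξ ∈ proximalLimitSet Γ, v.HasForwardEndpoint ξ) ∧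
    (∃ η ∈ proximalLimitSet Γ, v.HasBackwardEndpoint η)}

end ConvexProjective

open ConvexProjective

namespace ConvexProjective

variable {d : ℕ}

/-! ### Proximal matrices -/

/-! Everything is done in an open convex cone C over Ω. Automorphisms of Ω lift to matrices
preserving C, and proximality becomes dynamical: the normalised powers of the lift converge to a
rank-one projection v φᵀ (`isAttractingFixedPoint_mk_iff`). With boundary points lifted to vectors
of the closed cone, smoothness of [a] says that one linear form, up to scaling, is positive on C and
zero at a. Strong extremality says that a + z lies in C for every z of the closed cone not
proportional to a.

Let A be biproximal with attracting vectors a for A and b for its inverse, a + b in C, and dual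
forms φ and ψ. Both are positive on C, with φ(b) = 0 and ψ(a) = 0. Blowing up by powers of A shows
that ψ is the only supporting form at a, so the endpoints of such an axis are always smooth
(`IsBiproximalWith.isUniqueSupport`). If a is not extremal, pulling a bad boundary segment back by
A⁻ⁿ and taking a limit gives a boundary vector z with φ(z) = ψ(z) = 0
(`IsBiproximalWith.exists_common_zero`). Then neither a + z nor b + z is in C. When a is extremal
and a + b is in C no such z exists, and by compactness this persists for nearby pairs
(`IsConeOver.eventually_forall_mem`). So every biproximal element with fixed points near such a pair
has smooth and extremal endpoints, hence is rank-one. This is the first assertion.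

For the second, an element translating a rank-one periodic geodesic has eigenvectors a and b. The
unique supporting forms are dual eigenvectors, and extremality forces the orbits in C to converge to
[a]; so the element is biproximal (`IsConeOver.exists_isBiproximalWith`) and the endpoints lie in
the limit set. For density, irreducibility puts the limit set in the closure of every orbit, so two
conjugates A₁, A₂ of one rank-one element have attracting points p₁, p₂ near the two prescribed
endpoints. For a suitable K in the group, the products A₁ⁿ K A₂⁻ⁿ and their inverses are, after
rescaling, close to rank-one projections onto the lines of p₁ and p₂. They are therefore biproximal
with fixed points near p₁ and p₂ (`eventually_isAttracting_mul`). Since p₁ is extremal, the local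
argument of the first assertion makes them rank-one, and their axes approximate the given vector
(`IsConeOver.exists_biproximal_near`). -/

theorem tendsto_zero_of_recurrence {W : Type*} [NormedAddCommGroup W] [NormedSpace ℂ W]
    {x e : ℕ → W} {ν : ℂ} (hν : ‖ν‖ < 1) (he : Tendsto e atTop (𝓝 0))
    (h : ∀ n, x (n + 1) = ν • x n + e n) : Tendsto x atTop (𝓝 0) := by
  rw [Metric.tendsto_atTop]
  intro ε hε
  have h1 : 0 < 1 - ‖ν‖ := by linarith
  obtain ⟨N, hN⟩ := (Metric.tendsto_atTop.1 he) (ε / 2 * (1 - ‖ν‖)) (by positivity)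
  have key : ∀ k, ‖x (N + k)‖ ≤ ‖ν‖ ^ k * ‖x N‖ + ε / 2 := by
    intro k
    induction k with
    | zero => simp; linarith
    | succ k ih =>
      have h2 := hN (N + k) (by omega)
      rw [dist_zero_right] at h2
      calc ‖x (N + (k + 1))‖ = ‖ν • x (N + k) + e (N + k)‖ := by rw [← add_assoc, h]
        _ ≤ ‖ν‖ * ‖x (N + k)‖ + ‖e (N + k)‖ := by
          refine (norm_add_le _ _).trans ?_
          rw [norm_smul]
        _ ≤ ‖ν‖ * (‖ν‖ ^ k * ‖x N‖ + ε / 2) + ε / 2 * (1 - ‖ν‖) := by gcongr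
        _ = ‖ν‖ ^ (k + 1) * ‖x N‖ + ε / 2 := by ring
  have h3 : Tendsto (fun k => ‖ν‖ ^ k * ‖x N‖) atTop (𝓝 0) := by
    simpa using (tendsto_pow_atTop_nhds_zero_of_lt_one (norm_nonneg ν) hν).mul_const ‖x N‖
  obtain ⟨K, hK⟩ := (Metric.tendsto_atTop.1 h3) (ε / 2) (by positivity)
  refine ⟨N + K, fun n hn => ?_⟩
  obtain ⟨k, rfl⟩ := Nat.exists_eq_add_of_le (show N ≤ n by omega)
  have h4 := hK k (by omega)
  rw [Real.dist_eq, sub_zero] at h4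
  have h5 := (abs_lt.1 h4).2
  rw [dist_zero_right]
  linarith [key k]

open Polynomial in
-- One root ν is peeled off at a time: the normalised orbit of z satisfies a recurrence of ratio ν/μ
-- whose error is, up to a factor, the normalised orbit of Tz − νz, which decays by induction. No
-- Jordan form is needed.
theorem tendsto_pow_apply_of_aeval_eq_zero {W : Type*} [NormedAddCommGroup W] [NormedSpace ℂ W]
    (T : W →ₗ[ℂ] W) {μ : ℂ} (hμ : μ ≠ 0) (s : Multiset ℂ) (hs : ∀ ν ∈ s, ‖ν‖ < ‖μ‖) (z : W)
    (hz : aeval T (s.map fun ν => X - C ν).prod z = 0) :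
    Tendsto (fun n : ℕ => (μ ^ n)⁻¹ • (T ^ n) z) atTop (𝓝 0) := by
  induction s using Multiset.induction_on generalizing z with
  | empty =>
    have : z = 0 := by simpa using hz
    simp [this]
  | cons ν s ih =>
    have h1 := ih (fun ν' h => hs ν' (Multiset.mem_cons_of_mem h)) (T z - ν • z) (by
      rw [Multiset.map_cons, Multiset.prod_cons, mul_comm, map_mul] at hz
      simpa [Algebra.algebraMap_eq_smul_one] using hz)
    refine tendsto_zero_of_recurrence (ν := ν / μ)
      (e := fun n => μ⁻¹ • (μ ^ n)⁻¹ • (T ^ n) (T z - ν • z)) ?_ ?_ ?_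
    · rw [norm_div, div_lt_one (norm_pos_iff.2 hμ)]
      exact hs ν (Multiset.mem_cons_self _ _)
    · simpa using h1.const_smul μ⁻¹
    · intro n
      have h2 : (T ^ (n + 1)) z = (T ^ n) (T z) := by rw [pow_succ]; rfl
      rw [h2, map_sub, map_smul, smul_sub, smul_sub, pow_succ]
      simp only [smul_smul]
      rw [show μ⁻¹ * ((μ ^ n)⁻¹ * ν) = ν / μ * (μ ^ n)⁻¹ by field_simp,
        show (μ ^ n * μ)⁻¹ = μ⁻¹ * (μ ^ n)⁻¹ by rw [mul_inv, mul_comm]]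
      abel

/-- The square matrices acting on `V`. -/
abbrev Mat (d : ℕ) : Type := Matrix (Fin (d + 1)) (Fin (d + 1)) ℝ

theorem pow_mulVec_of_eigen {A : Mat d} {μ : ℝ} {w : E d} (hw : A *ᵥ w = μ • w) (n : ℕ) :
    A ^ n *ᵥ w = μ ^ n • w := by
  induction n with
  | zero => simp
  | succ n ih => rw [pow_succ, ← Matrix.mulVec_mulVec, hw, Matrix.mulVec_smul, ih, smul_smul,
      pow_succ, mul_comm]

/-- The normalised powers `μ⁻ⁿ Aⁿ` converge to the projection onto the line spanned by `v` along the
kernel of the linear form `φ`. -/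
def IsAttracting (A : Mat d) (μ : ℝ) (v φ : E d) : Prop :=
  μ ≠ 0 ∧ φ ⬝ᵥ v = 1 ∧
    Tendsto (fun n : ℕ => (μ ^ n)⁻¹ • A ^ n) atTop (𝓝 (Matrix.vecMulVec v φ))

theorem vecMulVec_mulVec' (v φ z : E d) : Matrix.vecMulVec v φ *ᵥ z = (φ ⬝ᵥ z) • v := by
  rw [Matrix.vecMulVec_mulVec]; simp

theorem tendsto_matrix_iff {ι : Type*} {l : Filter ι} {F : ι → Mat d} {M : Mat d} :
    Tendsto F l (𝓝 M) ↔ ∀ z : E d, Tendsto (fun i => F i *ᵥ z) l (𝓝 (M *ᵥ z)) := by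
  constructor
  · intro h z
    exact ((continuous_id.matrix_mulVec continuous_const).tendsto M).comp h
  · intro h
    refine tendsto_pi_nhds.2 fun i => tendsto_pi_nhds.2 fun j => ?_
    simpa using (tendsto_pi_nhds.1 (h (Pi.single j 1))) i

theorem IsAttracting.tendsto {A : Mat d} {μ : ℝ} {v φ : E d} (h : IsAttracting A μ v φ) (z : E d) :
    Tendsto (fun n : ℕ => (μ ^ n)⁻¹ • (A ^ n *ᵥ z)) atTop (𝓝 ((φ ⬝ᵥ z) • v)) := by
  simpa [Matrix.smul_mulVec, vecMulVec_mulVec'] using tendsto_matrix_iff.1 h.2.2 z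

theorem IsAttracting.mulVec {A : Mat d} {μ : ℝ} {v φ : E d} (h : IsAttracting A μ v φ) :
    A *ᵥ v = μ • v := by
  have h1 := h.tendsto v
  rw [h.2.1, one_smul] at h1
  have h2 : Tendsto (fun n : ℕ => A *ᵥ ((μ ^ n)⁻¹ • (A ^ n *ᵥ v))) atTop (𝓝 (A *ᵥ v)) :=
    ((continuous_const.matrix_mulVec continuous_id).tendsto v).comp h1
  have h3 := ((tendsto_add_atTop_iff_nat 1).2 h1).const_smul μ
  refine tendsto_nhds_unique h2 (h3.congr fun n => ?_)
  rw [Matrix.mulVec_smul, Matrix.mulVec_mulVec, ← pow_succ', smul_smul, pow_succ μ, mul_inv,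
    mul_comm (μ ^ n)⁻¹, ← mul_assoc, mul_inv_cancel₀ h.1, one_mul]

/-- The normalised orbit of Az is μ times the shifted normalised orbit of z; comparing limits shows
that φ is a left eigenvector. -/
theorem IsAttracting.vecMul {A : Mat d} {μ : ℝ} {v φ : E d} (h : IsAttracting A μ v φ) (z : E d) :
    φ ⬝ᵥ (A *ᵥ z) = μ * (φ ⬝ᵥ z) := by
  have h1 := h.tendsto (A *ᵥ z)
  have h3 := ((tendsto_add_atTop_iff_nat 1).2 (h.tendsto z)).const_smul μ
  have h4 : (φ ⬝ᵥ (A *ᵥ z)) • v = μ • (φ ⬝ᵥ z) • v := by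
    refine tendsto_nhds_unique h1 (h3.congr fun n => ?_)
    rw [Matrix.mulVec_mulVec, ← pow_succ, smul_smul, pow_succ μ, mul_inv,
      mul_comm (μ ^ n)⁻¹, ← mul_assoc, mul_inv_cancel₀ h.1, one_mul]
  have h5 := congrArg (fun w => φ ⬝ᵥ w) h4
  simpa [dotProduct_smul, h.2.1] using h5

theorem IsAttracting.ne_zero {A : Mat d} {μ : ℝ} {v φ : E d} (h : IsAttracting A μ v φ) :
    v ≠ 0 := by
  rintro rfl
  simpa using h.2.1

theorem IsAttracting.smul {A : Mat d} {μ : ℝ} {v φ : E d} (h : IsAttracting A μ v φ) {c : ℝ}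
    (hc : c ≠ 0) : IsAttracting (c • A) (c * μ) v φ := by
  refine ⟨mul_ne_zero hc h.1, h.2.1, h.2.2.congr fun n => ?_⟩
  rw [smul_pow, smul_smul, mul_pow, mul_inv, mul_comm (c ^ n)⁻¹, mul_assoc,
    inv_mul_cancel₀ (pow_ne_zero n hc), mul_one]

theorem IsAttracting.smul_vec {A : Mat d} {μ : ℝ} {v φ : E d} (h : IsAttracting A μ v φ) {c : ℝ}
    (hc : c ≠ 0) : IsAttracting A μ (c • v) (c⁻¹ • φ) := by
  refine ⟨h.1, ?_, ?_⟩
  · simp [dotProduct_smul, smul_dotProduct, h.2.1, hc]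
  · have : Matrix.vecMulVec (c • v) (c⁻¹ • φ) = Matrix.vecMulVec v φ := by
      rw [Matrix.smul_vecMulVec, Matrix.vecMulVec_smul, smul_smul, mul_inv_cancel₀ hc, one_smul]
    rw [this]
    exact h.2.2

theorem map_ofReal_mulVec (A : Mat d) (z : E d) :
    A.map (algebraMap ℝ ℂ) *ᵥ (fun i => (z i : ℂ)) = fun i => ((A *ᵥ z) i : ℂ) := by
  ext i
  simp [Matrix.mulVec, dotProduct]

open Polynomial in
/-- A matrix with a dominant simple eigenvalue `μ` is attracting. -/
theorem isAttracting_of_roots {A : Mat d} {μ : ℝ} (hμ : μ ≠ 0)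
    (h1 : (A.charpoly.map (algebraMap ℝ ℂ)).roots.count (μ : ℂ) = 1)
    (h2 : ∀ ν ∈ (A.charpoly.map (algebraMap ℝ ℂ)).roots, ν ≠ (μ : ℂ) → ‖ν‖ < ‖(μ : ℂ)‖)
    {v : E d} (hv : v ≠ 0) (hAv : A *ᵥ v = μ • v) : ∃ φ, IsAttracting A μ v φ := by
  have hinj : Function.Injective (algebraMap ℝ ℂ) := (algebraMap ℝ ℂ).injective
  have hrm : A.charpoly.rootMultiplicity μ = 1 := by
    rw [eq_rootMultiplicity_map hinj, ← count_roots]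
    exact h1
  have hp0 : A.charpoly ≠ 0 := A.charpoly_monic.ne_zero
  obtain ⟨q, hq⟩ : ∃ q, A.charpoly = (X - C μ) * q := by
    have : IsRoot A.charpoly μ := by
      rw [← rootMultiplicity_pos hp0, hrm]; exact one_pos
    exact dvd_iff_isRoot.2 this
  have hq0 : q ≠ 0 := by rintro rfl; simp [hq] at hp0
  have hqμ : q.eval μ ≠ 0 := by
    intro h
    obtain ⟨q', hq'⟩ := dvd_iff_isRoot.2 (show IsRoot q μ from h)
    have : (X - C μ) ^ 2 ∣ A.charpoly := ⟨q', by rw [hq, hq']; ring⟩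
    have := (le_rootMultiplicity_iff hp0).2 this
    omega
  have hroots : ∀ ν ∈ (q.map (algebraMap ℝ ℂ)).roots, ‖ν‖ < ‖(μ : ℂ)‖ := by
    intro ν hν
    have hν' : (q.map (algebraMap ℝ ℂ)).eval ν = 0 := (mem_roots'.1 hν).2
    refine h2 ν ?_ ?_
    · rw [mem_roots (by rwa [Polynomial.map_ne_zero_iff hinj]), hq, Polynomial.map_mul]
      simp [IsRoot, hν']
    · rintro rfl
      rw [show (μ : ℂ) = algebraMap ℝ ℂ μ from rfl, eval_map_algebraMap, aeval_algebraMap_apply]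
        at hν'
      exact hqμ (hinj (by simpa using hν'))
  -- By Cayley–Hamilton (A − μ) q(A) = 0, so q(A) takes values in the μ-eigenspace; as q(μ) ≠ 0,
  -- dividing by it gives the spectral projection.
  set Q : Mat d := aeval A q with hQ
  have hAQ : A * Q = μ • Q := by
    have h := Matrix.aeval_self_charpoly A
    rw [hq, map_mul, map_sub, aeval_X, aeval_C, sub_mul, sub_eq_zero, ← hQ] at h
    rw [h, Algebra.algebraMap_eq_smul_one, smul_mul_assoc, one_mul]
  have heig : ∀ w : E d, A *ᵥ w = μ • w → Q *ᵥ w = q.eval μ • w := by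
    intro w hw
    have key := Module.End.aeval_apply_of_hasEigenvector (f := Matrix.toLin' A) (μ := μ) (x := w) (p := q)
    by_cases hw0 : w = 0
    · simp [hw0]
    have h3 := key ⟨Module.End.mem_eigenspace_iff.2 (by simpa using hw), hw0⟩
    have h4 : aeval (Matrix.toLin' A) q = Matrix.toLin' Q := by
      rw [hQ]
      exact (aeval_algHom_apply (Matrix.toLinAlgEquiv' (R := ℝ) (n := Fin (d + 1))).toAlgHom A q)
    rw [h4] at h3
    simpa using h3
  have heig1 : ∀ w : E d, A *ᵥ w = μ • w → ∃ c : ℝ, c • v = w := by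
    intro w hw
    have hle := LinearMap.finrank_eigenspace_le (Matrix.toLin' A) μ
    rw [Matrix.charpoly_toLin', hrm] at hle
    have hmem : v ∈ Module.End.eigenspace (Matrix.toLin' A) μ :=
      Module.End.mem_eigenspace_iff.2 (by simpa using hAv)
    have hmem' : w ∈ Module.End.eigenspace (Matrix.toLin' A) μ :=
      Module.End.mem_eigenspace_iff.2 (by simpa using hw)
    have hone : Module.finrank ℝ (Module.End.eigenspace (Matrix.toLin' A) μ) = 1 := by
      refine le_antisymm hle (Nat.one_le_iff_ne_zero.2 fun h => hv ?_)
      rw [Submodule.finrank_eq_zero] at h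
      rw [h] at hmem
      simpa using hmem
    obtain ⟨c, hc⟩ := (finrank_eq_one_iff_of_nonzero' (⟨v, hmem⟩ :
      Module.End.eigenspace (Matrix.toLin' A) μ) (by simpa using hv)).1 hone ⟨w, hmem'⟩
    exact ⟨c, congrArg Subtype.val hc⟩
  set Pr : Mat d := (q.eval μ)⁻¹ • Q with hPi
  have hlim : Tendsto (fun n : ℕ => (μ ^ n)⁻¹ • A ^ n) atTop (𝓝 Pr) := by
    rw [tendsto_matrix_iff]
    intro z
    have hz1 : A *ᵥ (Pr *ᵥ z) = μ • (Pr *ᵥ z) := by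
      rw [Matrix.mulVec_mulVec, hPi, mul_smul_comm, hAQ, smul_comm, Matrix.smul_mulVec]
    -- The complementary component is killed by q(A), and all complex roots of q are smaller than μ
    -- in modulus, so its normalised orbit tends to zero.
    have hz2 : Q *ᵥ (z - Pr *ᵥ z) = 0 := by
      rw [Matrix.mulVec_sub, heig _ hz1, hPi, Matrix.smul_mulVec, smul_smul,
        mul_inv_cancel₀ hqμ, one_smul, sub_self]
    have hpow : ∀ n : ℕ, A ^ n *ᵥ (Pr *ᵥ z) = μ ^ n • (Pr *ᵥ z) :=
      pow_mulVec_of_eigen hz1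
    set Ac := A.map (algebraMap ℝ ℂ) with hAc
    have hc := tendsto_pow_apply_of_aeval_eq_zero (Matrix.toLin' Ac) (μ := (μ : ℂ))
      (by exact_mod_cast hμ) (q.map (algebraMap ℝ ℂ)).roots hroots
      (fun i => ((z - Pr *ᵥ z) i : ℂ)) (by
        have h5 : C (q.map (algebraMap ℝ ℂ)).leadingCoeff *
            (((q.map (algebraMap ℝ ℂ)).roots.map fun a => X - C a).prod) =
              q.map (algebraMap ℝ ℂ) :=
          (IsAlgClosed.splits (q.map (algebraMap ℝ ℂ))).eq_prod_roots.symm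
        have h6 : (q.map (algebraMap ℝ ℂ)).leadingCoeff ≠ 0 := by
          rw [leadingCoeff_ne_zero, Polynomial.map_ne_zero_iff hinj]; exact hq0
        have h7 : aeval (Matrix.toLin' Ac) (q.map (algebraMap ℝ ℂ))
            (fun i => ((z - Pr *ᵥ z) i : ℂ)) = 0 := by
          have h8 : aeval (Matrix.toLin' Ac) (q.map (algebraMap ℝ ℂ)) =
              Matrix.toLin' (Q.map (algebraMap ℝ ℂ)) := by
            have h9 : aeval Ac (q.map (algebraMap ℝ ℂ)) = Q.map (algebraMap ℝ ℂ) := by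
              rw [aeval_map_algebraMap, hQ]
              exact aeval_algHom_apply (Algebra.ofId ℝ ℂ).mapMatrix A q
            rw [← h9]
            exact (aeval_algHom_apply (Matrix.toLinAlgEquiv' (R := ℂ) (n := Fin (d + 1))).toAlgHom
              Ac _)
          rw [h8, Matrix.toLin'_apply, map_ofReal_mulVec, hz2]
          ext i; simp
        rw [← h5, map_mul, aeval_C] at h7
        simpa [Algebra.algebraMap_eq_smul_one, hq0] using h7)
    have hre : Tendsto (fun n : ℕ => (μ ^ n)⁻¹ • (A ^ n *ᵥ (z - Pr *ᵥ z))) atTop (𝓝 0) := by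
      rw [tendsto_pi_nhds]
      intro i
      have h10 := (Complex.continuous_re.tendsto _).comp ((tendsto_pi_nhds.1 hc) i)
      refine Tendsto.congr (fun n => ?_) h10
      have h11 : (Matrix.toLin' Ac ^ n) (fun i => ((z - Pr *ᵥ z) i : ℂ)) =
          fun i => (((A ^ n) *ᵥ (z - Pr *ᵥ z)) i : ℂ) := by
        rw [← Matrix.toLin'_pow, Matrix.toLin'_apply, ← map_ofReal_mulVec, hAc, ← Matrix.map_pow]
      rw [Function.comp_apply, Pi.smul_apply, h11, Pi.smul_apply, smul_eq_mul, smul_eq_mul]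
      rw [← Complex.ofReal_pow, ← Complex.ofReal_inv, ← Complex.ofReal_mul, Complex.ofReal_re]
    have := hre.add_const (Pr *ᵥ z)
    rw [zero_add] at this
    refine this.congr fun n => ?_
    rw [Matrix.mulVec_sub, hpow, smul_sub, smul_smul, inv_mul_cancel₀ (pow_ne_zero n hμ), one_smul,
      sub_add_cancel, Matrix.smul_mulVec]
  have hvv : v ⬝ᵥ v ≠ 0 := by simpa using hv
  -- The image of `Pr` is the line of v, and pairing with v/(v·v) reads off the coefficient; this
  -- gives the dual form.
  have hPi1 : ∀ z, Pr *ᵥ z = ((((v ⬝ᵥ v)⁻¹ • v) ᵥ* Pr) ⬝ᵥ z) • v := by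
    intro z
    obtain ⟨c, hc⟩ := heig1 (Pr *ᵥ z) (by
      rw [Matrix.mulVec_mulVec, hPi, mul_smul_comm, hAQ, smul_comm, Matrix.smul_mulVec])
    rw [← Matrix.dotProduct_mulVec, ← hc, dotProduct_smul, smul_dotProduct, smul_eq_mul,
      smul_eq_mul, inv_mul_cancel₀ hvv, mul_one]
  have hPiv : Pr *ᵥ v = v := by
    rw [hPi, Matrix.smul_mulVec, heig v hAv, smul_smul, inv_mul_cancel₀ hqμ, one_smul]
  refine ⟨((v ⬝ᵥ v)⁻¹ • v) ᵥ* Pr, hμ, ?_, ?_⟩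
  · rw [← Matrix.dotProduct_mulVec, hPiv, smul_dotProduct, smul_eq_mul, inv_mul_cancel₀ hvv]
  · convert hlim
    refine Matrix.ext_of_mulVec_single fun i => ?_
    rw [vecMulVec_mulVec', hPi1]

open Polynomial in
-- Bridge between the spectral definition and the dynamical one used everywhere else. Conversely to
-- the previous lemma, convergence of the normalised powers rules out both a Jordan block at μ and
-- another eigenvalue of modulus at least |μ|.
theorem isAttractingFixedPointGL_iff {g : GL (Fin (d + 1)) ℝ} {x : P d} :
    IsAttractingFixedPointGL g x ↔ ∃ μ v φ, IsAttracting g.1 μ v φ ∧ Represents v x := by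
  constructor
  · rintro ⟨μ, h1, h2, h3⟩
    have hμ : μ ≠ 0 := by
      rintro rfl
      have h4 : ((0 : ℝ) : ℂ) ∈ (g.1.charpoly.map (algebraMap ℝ ℂ)).roots := by
        rw [← Multiset.count_pos, h1]; exact one_pos
      have h5 := (mem_roots'.1 h4).2
      have h6 : g.1.charpoly.eval 0 = 0 := by
        rw [IsRoot, show ((0 : ℝ) : ℂ) = algebraMap ℝ ℂ 0 from rfl, eval_map_algebraMap,
          aeval_algebraMap_apply] at h5
        exact (algebraMap ℝ ℂ).injective (by simpa using h5)
      have h7 := Matrix.det_eq_sign_charpoly_coeff g.1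
      rw [coeff_zero_eq_eval_zero, h6, mul_zero] at h7
      exact (g.isUnit.map Matrix.detMonoidHom).ne_zero h7
    obtain ⟨φ, hφ⟩ := isAttracting_of_roots hμ h1 h2 x.rep_nonzero
      (h3 x.rep (by rw [Projectivization.submodule_eq]; exact Submodule.mem_span_singleton_self _))
    exact ⟨μ, x.rep, φ, hφ, x.rep_nonzero, x.mk_rep⟩
  · rintro ⟨μ, v, φ, h, hv, rfl⟩
    set A : Mat d := g.1 with hA
    have hinj : Function.Injective (algebraMap ℝ ℂ) := (algebraMap ℝ ℂ).injective
    have hp0 : A.charpoly ≠ 0 := A.charpoly_monic.ne_zero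
    refine ⟨μ, ?_, ?_, ?_⟩
    · rw [count_roots, show (μ : ℂ) = algebraMap ℝ ℂ μ from rfl, ← eq_rootMultiplicity_map hinj,
        ← Matrix.charpoly_toLin', ← LinearMap.finrank_maxGenEigenspace_eq]
      -- A Jordan block would make the normalised orbit of z grow linearly, like z + nμ⁻¹w.
      have hpow : ∀ (z w : E d), A *ᵥ z = μ • z + w → A *ᵥ w = μ • w → w = 0 := by
        intro z w hz hw
        have hw' : ∀ n : ℕ, A ^ n *ᵥ w = μ ^ n • w :=
      pow_mulVec_of_eigen hw
        have hz' : ∀ n : ℕ, (μ ^ n)⁻¹ • (A ^ n *ᵥ z) = z + (n : ℝ) • μ⁻¹ • w := by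
          intro n
          induction n with
          | zero => simp
          | succ n ih =>
            rw [pow_succ A, ← Matrix.mulVec_mulVec, hz, Matrix.mulVec_add, Matrix.mulVec_smul, hw',
              smul_add, smul_smul, smul_smul, pow_succ, mul_inv, mul_assoc, inv_mul_cancel₀ h.1,
              mul_one, ih, mul_comm, ← mul_assoc, mul_inv_cancel₀ (pow_ne_zero n h.1), one_mul]
            push_cast
            rw [add_smul, one_smul, add_assoc]
        have h1 := h.tendsto z
        have h2 := ((tendsto_add_atTop_iff_nat 1).2 h1).sub h1
        rw [sub_self] at h2
        have h3 : μ⁻¹ • w = 0 := by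
          refine tendsto_nhds_unique (tendsto_const_nhds (x := μ⁻¹ • w) (f := atTop (α := ℕ)))
            (h2.congr fun n => ?_)
          rw [hz', hz']
          push_cast
          rw [add_smul, one_smul]
          abel
        simpa [h.1] using h3
      have hgen : ∀ k : ℕ, ∀ z : E d, ((Matrix.toLin' A - μ • 1) ^ k) z = 0 → A *ᵥ z = μ • z := by
        intro k
        induction k with
        | zero => intro z hz; simp at hz; simp [hz]
        | succ k ih =>
          intro z hz
          rw [pow_succ, Module.End.mul_apply] at hz
          have h1 := ih _ hz
          have h2 := hpow z ((Matrix.toLin' A - μ • 1) z) (by simp) h1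
          simpa [sub_eq_zero] using h2
      have hmem : ∀ z ∈ Module.End.maxGenEigenspace (Matrix.toLin' A) μ, ∃ c : ℝ, c • v = z := by
        intro z hz
        obtain ⟨k, hk⟩ := Module.End.mem_maxGenEigenspace _ _ _ |>.1 hz
        have h1 := hgen k z hk
        have hz' : ∀ n : ℕ, A ^ n *ᵥ z = μ ^ n • z :=
      pow_mulVec_of_eigen h1
        refine ⟨φ ⬝ᵥ z, tendsto_nhds_unique (h.tendsto z) (tendsto_const_nhds.congr fun n => ?_)⟩
        rw [hz', smul_smul, inv_mul_cancel₀ (pow_ne_zero n h.1), one_smul]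
      have hvm : v ∈ Module.End.maxGenEigenspace (Matrix.toLin' A) μ := by
        refine (Module.End.mem_maxGenEigenspace _ _ _).2 ⟨1, ?_⟩
        simp [h.mulVec]
      refine (finrank_eq_one_iff_of_nonzero' (⟨v, hvm⟩ :
        Module.End.maxGenEigenspace (Matrix.toLin' A) μ) (by simpa using hv)).2 fun ⟨w, hw⟩ => ?_
      obtain ⟨c, hc⟩ := hmem w hw
      exact ⟨c, Subtype.ext hc⟩
    · intro ν hν hne
      set Ac := A.map (algebraMap ℝ ℂ) with hAc
      have h1 : Ac.charpoly.IsRoot ν := by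
        rw [hAc, Matrix.charpoly_map]
        exact (mem_roots'.1 hν).2
      rw [← Matrix.charpoly_toLin', ← Module.End.hasEigenvalue_iff_isRoot_charpoly] at h1
      obtain ⟨z, hz⟩ := h1.exists_hasEigenvector
      have hz1 : ∀ n : ℕ, Ac ^ n *ᵥ z = ν ^ n • z := by
        intro n
        rw [← Matrix.toLin'_apply, Matrix.toLin'_pow]
        exact hz.pow_apply n
      obtain ⟨i, hi⟩ := Function.ne_iff.1 hz.2
      have h2 : Tendsto (fun n : ℕ => (((μ ^ n)⁻¹ • A ^ n).map (algebraMap ℝ ℂ)) *ᵥ z) atTop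
          (𝓝 ((Matrix.vecMulVec v φ).map (algebraMap ℝ ℂ) *ᵥ z)) := by
        have hcont : Continuous fun M : Mat d => (M.map (algebraMap ℝ ℂ)) *ᵥ z :=
          (continuous_id.matrix_map Complex.continuous_ofReal).matrix_mulVec continuous_const
        exact (hcont.tendsto _).comp h.2.2
      -- A nonzero coordinate of the eigenvector shows that (ν/μ)ⁿ converges. If |ν| ≥ |μ| the limit
      -- is nonzero and fixed by multiplication by ν/μ, so ν = μ.
      have h3 : Tendsto (fun n : ℕ => (ν / μ) ^ n) atTop
          (𝓝 (((Matrix.vecMulVec v φ).map (algebraMap ℝ ℂ) *ᵥ z) i / z i)) := by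
        refine (((tendsto_pi_nhds.1 h2) i).div_const (z i)).congr fun n => ?_
        have h4 : ((μ ^ n)⁻¹ • A ^ n).map (algebraMap ℝ ℂ) = ((μ : ℂ) ^ n)⁻¹ • Ac ^ n := by
          rw [hAc, ← Matrix.map_pow]
          ext i j
          simp
        rw [h4, Matrix.smul_mulVec, hz1, smul_smul, Pi.smul_apply, smul_eq_mul,
          mul_div_cancel_right₀ _ hi, div_pow, div_eq_inv_mul]
      have hμ : (μ : ℂ) ≠ 0 := by exact_mod_cast h.1
      by_contra hcon
      rw [not_lt] at hcon
      have h5 : 1 ≤ ‖ν / (μ : ℂ)‖ := by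
        rw [norm_div, one_le_div (norm_pos_iff.2 hμ)]; exact hcon
      set l := ((Matrix.vecMulVec v φ).map (algebraMap ℝ ℂ) *ᵥ z) i / z i
      have h6 : 1 ≤ ‖l‖ := by
        refine ge_of_tendsto' h3.norm fun n => ?_
        rw [norm_pow]
        exact one_le_pow₀ h5
      have h7 : l = ν / μ * l := by
        refine tendsto_nhds_unique ((tendsto_add_atTop_iff_nat 1).2 h3)
          ((h3.const_mul (ν / μ)).congr fun n => ?_)
        rw [pow_succ']
      have h8 : l ≠ 0 := by rintro h0; rw [h0] at h6; simp at h6; linarith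
      have h9 : ν / μ = 1 := by
        have := mul_right_cancel₀ h8 ((one_mul l).trans h7)
        exact this.symm
      exact hne ((div_eq_one_iff_eq hμ).1 h9)
    · intro w hw
      rw [Projectivization.submodule_mk, Submodule.mem_span_singleton] at hw
      obtain ⟨c, rfl⟩ := hw
      rw [Matrix.mulVec_smul, h.mulVec, smul_comm]

theorem isAttractingFixedPoint_mk_iff {g : GL (Fin (d + 1)) ℝ} {x : P d} :
    IsAttractingFixedPoint (Matrix.ProjGenLinGroup.mk g) x ↔
      ∃ μ v φ, IsAttracting g.1 μ v φ ∧ Represents v x := by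
  constructor
  · rintro ⟨g', hg', h⟩
    obtain ⟨μ, v, φ, h1, h2⟩ := isAttractingFixedPointGL_iff.1 h
    obtain ⟨u, hu⟩ := Matrix.ProjGenLinGroup.mk_eq_mk_iff.1 hg'
    refine ⟨u * μ, v, φ, ?_, h2⟩
    have : g.1 = (u : ℝ) • g'.1 := by
      rw [← hu]
      ext i j
      simp [Matrix.mul_apply, Matrix.diagonal_apply, mul_comm]
    rw [this]
    exact h1.smul u.ne_zero
  · intro h
    exact ⟨g, rfl, isAttractingFixedPointGL_iff.2 h⟩

/-! ### Perturbation of rank-one projections -/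

theorem abs_dotProduct_le (x y : E d) : |x ⬝ᵥ y| ≤ (d + 1) * (‖x‖ * ‖y‖) := by
  calc |x ⬝ᵥ y| ≤ ∑ i, |x i * y i| := Finset.abs_sum_le_sum_abs _ _
    _ ≤ ∑ _i : Fin (d + 1), ‖x‖ * ‖y‖ := by
        refine Finset.sum_le_sum fun i _ => ?_
        rw [abs_mul]
        exact mul_le_mul (norm_le_pi_norm x i) (norm_le_pi_norm y i) (abs_nonneg _) (norm_nonneg _)
    _ = (d + 1) * (‖x‖ * ‖y‖) := by simp

theorem norm_mulVec_le {N : Mat d} {η : ℝ} (hη : 0 ≤ η) (hN : ∀ i j, |N i j| ≤ η) (z : E d) :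
    ‖N *ᵥ z‖ ≤ (d + 1) * η * ‖z‖ := by
  refine (pi_norm_le_iff_of_nonneg (by positivity)).2 fun i => ?_
  refine (abs_dotProduct_le (fun j => N i j) z).trans ?_
  rw [mul_assoc]
  gcongr
  exact (pi_norm_le_iff_of_nonneg hη).2 fun j => hN i j

theorem isAttracting_of_tendsto_zero {M : Mat d} {μ : ℝ} {v φ : E d} (hμ : μ ≠ 0)
    (h1 : φ ⬝ᵥ v = 1) (hv : M *ᵥ v = μ • v)
    (h : ∀ z, φ ⬝ᵥ z = 0 → Tendsto (fun n : ℕ => (μ ^ n)⁻¹ • (M ^ n *ᵥ z)) atTop (𝓝 0)) :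
    IsAttracting M μ v φ := by
  refine ⟨hμ, h1, tendsto_matrix_iff.2 fun z => ?_⟩
  rw [vecMulVec_mulVec']
  have h2 := (h (z - (φ ⬝ᵥ z) • v) (by simp [dotProduct_sub, h1])).add_const ((φ ⬝ᵥ z) • v)
  rw [zero_add] at h2
  refine h2.congr fun n => ?_
  rw [Matrix.mulVec_sub, Matrix.mulVec_smul, pow_mulVec_of_eigen hv, smul_sub, smul_comm _ (μ ^ n),
    smul_smul, inv_mul_cancel₀ (pow_ne_zero n hμ), one_smul, sub_add_cancel, Matrix.smul_mulVec]

/-- An eigenvector, for an eigenvalue close to `1`, of a matrix close to `v φᵀ` is close to `v`. -/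
theorem exists_eigenvector_near {v φ : E d} {N : Mat d} {l δ : ℝ}
    (hδ : δ ≤ 1 / 8) (hl : |1 - l| ≤ δ / 2) (hN : ∀ z, ‖N *ᵥ z‖ ≤ δ / 2 * ‖z‖)
    (hroot : (Matrix.vecMulVec v φ + N).charpoly.IsRoot l) :
    ∃ x, (Matrix.vecMulVec v φ + N) *ᵥ x = l • x ∧ ‖x‖ ≤ 4 * ‖v‖ ∧ ‖x - v‖ ≤ 4 * δ * ‖v‖ := by
  have hl' := abs_le.1 hl
  rw [← Matrix.charpoly_toLin', ← Module.End.hasEigenvalue_iff_isRoot_charpoly] at hroot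
  obtain ⟨x, hx⟩ := hroot.exists_hasEigenvector
  have hx0 : 0 < ‖x‖ := norm_pos_iff.2 hx.2
  have hx1 : (φ ⬝ᵥ x) • v + N *ᵥ x = l • x := by
    simpa [Matrix.add_mulVec, vecMulVec_mulVec'] using hx.apply_eq_smul
  -- Otherwise lx = Nx, impossible since l is near 1 and N is small. Normalising to φ·y = 1 then
  -- turns the eigenvalue equation into v + Ny = ly.
  have hne : φ ⬝ᵥ x ≠ 0 := by
    intro h
    rw [h, zero_smul, zero_add] at hx1
    have h1 := hN x
    rw [hx1, norm_smul, Real.norm_eq_abs] at h1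
    have h2 := le_abs_self l
    nlinarith
  set y := (φ ⬝ᵥ x)⁻¹ • x with hy
  have hy1 : v + N *ᵥ y = l • y := by
    rw [hy, Matrix.mulVec_smul, smul_comm l, ← hx1, smul_add, smul_smul, inv_mul_cancel₀ hne,
      one_smul]
  have hyn := hN y
  have hy2 : ‖y‖ ≤ 4 * ‖v‖ := by
    have h1 : l * ‖y‖ ≤ ‖v‖ + ‖N *ᵥ y‖ := by
      have := norm_add_le v (N *ᵥ y)
      rw [hy1, norm_smul, Real.norm_eq_abs] at this
      exact (mul_le_mul_of_nonneg_right (le_abs_self l) (norm_nonneg y)).trans this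
    nlinarith [norm_nonneg y, norm_nonneg v]
  refine ⟨y, ?_, hy2, ?_⟩
  · rw [Matrix.add_mulVec, vecMulVec_mulVec', hy, dotProduct_smul, smul_eq_mul,
      inv_mul_cancel₀ hne, one_smul, ← hy]
    exact hy1
  · have h1 : y - v = (1 - l) • y + N *ᵥ y := by
      rw [sub_smul, one_smul, ← hy1]; abel
    rw [h1]
    refine (norm_add_le _ _).trans ?_
    rw [norm_smul, Real.norm_eq_abs]
    nlinarith [norm_nonneg y, norm_nonneg v]

/-- Matrices close to a projection of rank one are proximal, with an attracting line close to that
of the projection. -/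
theorem eventually_isAttracting {v φ : E d} (hφ : φ ⬝ᵥ v = 1) {ε : ℝ} (hε : 0 < ε) :
    ∀ᶠ M in 𝓝 (Matrix.vecMulVec v φ), ∃ μ w θ, IsAttracting M μ w θ ∧ ‖w - v‖ < ε := by
  -- The third condition puts the eigenvector within ε of v. The last one keeps the right and left
  -- eigenvectors non-orthogonal and makes M contract the kernel of the left one.
  obtain ⟨δ, hδ0, hδ1, hδ2, hδ3⟩ : ∃ δ : ℝ, 0 < δ ∧ δ ≤ 1 / 8 ∧ 4 * δ * ‖v‖ < ε ∧
      20 * ((d + 1) * (‖v‖ * ‖φ‖)) * δ < 1 / 8 := by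
    have h1 : Tendsto (fun δ : ℝ => 4 * δ * ‖v‖) (𝓝[>] 0) (𝓝 (4 * 0 * ‖v‖)) :=
      ((continuous_const.mul continuous_id).mul continuous_const).continuousWithinAt.tendsto
    have h2 : Tendsto (fun δ : ℝ => 20 * ((d + 1) * (‖v‖ * ‖φ‖)) * δ) (𝓝[>] 0)
        (𝓝 (20 * ((d + 1) * (‖v‖ * ‖φ‖)) * 0)) :=
      (continuous_const.mul continuous_id).continuousWithinAt.tendsto
    rw [mul_zero, zero_mul] at h1
    rw [mul_zero] at h2
    obtain ⟨δ, h⟩ := ((h1.eventually_lt_const hε).and ((h2.eventually_lt_const (u := 1 / 8)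
      (by norm_num)).and (Ioo_mem_nhdsGT (show (0 : ℝ) < 1 / 8 by norm_num)))).exists
    exact ⟨δ, h.2.2.1, h.2.2.2.le, h.1, h.2.1⟩
  set M₀ := Matrix.vecMulVec v φ with hM₀
  -- This polynomial changes sign at 1, which survives perturbation: the intermediate value theorem
  -- yields a real eigenvalue l near 1.
  have hev : ∀ x : ℝ, M₀.charpoly.eval x = x ^ d * (x - 1) := by
    intro x
    rw [hM₀, Matrix.charpoly_vecMulVec, dotProduct_comm, hφ]
    simp [pow_succ]
    ring
  have hcont : ∀ x : ℝ, Continuous fun M : Mat d => M.charpoly.eval x := by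
    intro x
    simp_rw [Matrix.eval_charpoly]
    exact (continuous_const.sub continuous_id).matrix_det
  have hlow : ∀ᶠ M in 𝓝 M₀, M.charpoly.eval (1 - δ / 2) < 0 := by
    refine (hcont _).tendsto M₀ |>.eventually_lt_const ?_
    rw [hev]
    have : 0 < (1 - δ / 2) ^ d := pow_pos (by linarith) d
    nlinarith
  have hhigh : ∀ᶠ M in 𝓝 M₀, 0 < M.charpoly.eval (1 + δ / 2) := by
    refine (hcont _).tendsto M₀ |>.eventually_const_lt ?_
    rw [hev]
    have : 0 < (1 + δ / 2) ^ d := pow_pos (by linarith) d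
    nlinarith
  have hη0 : 0 < δ / 2 / (d + 1) := by positivity
  have hclose : ∀ᶠ M in 𝓝 M₀, ∀ i j, |(M - M₀) i j| < δ / 2 / (d + 1) := by
    refine eventually_all.2 fun i => eventually_all.2 fun j => ?_
    have hc : Continuous fun M : Mat d => |(M - M₀) i j| :=
      ((continuous_id.sub continuous_const).matrix_elem i j).abs
    exact (hc.tendsto M₀).eventually_lt_const (by simpa using hη0)
  filter_upwards [hlow, hhigh, hclose] with M h1 h2 h3
  obtain ⟨l, hl, hroot⟩ : ∃ l ∈ Icc (1 - δ / 2) (1 + δ / 2), M.charpoly.eval l = 0 :=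
    intermediate_value_Icc (by linarith) M.charpoly.continuous.continuousOn ⟨h1.le, h2.le⟩
  have hl' : |1 - l| ≤ δ / 2 := abs_le.2 ⟨by linarith [hl.2], by linarith [hl.1]⟩
  set N := M - M₀ with hN
  have hM : M = Matrix.vecMulVec v φ + N := by rw [hN, hM₀]; abel
  have hMt : Mᵀ = Matrix.vecMulVec φ v + Nᵀ := by
    rw [hM, Matrix.transpose_add, Matrix.transpose_vecMulVec]
  have hη : (d + 1 : ℝ) * (δ / 2 / (d + 1)) = δ / 2 := by field_simp
  have hNz : ∀ z, ‖N *ᵥ z‖ ≤ δ / 2 * ‖z‖ := fun z => by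
    rw [← hη]; exact norm_mulVec_le hη0.le (fun i j => (h3 i j).le) z
  have hNtz : ∀ z, ‖Nᵀ *ᵥ z‖ ≤ δ / 2 * ‖z‖ := fun z => by
    rw [← hη]; exact norm_mulVec_le hη0.le (fun i j => (h3 j i).le) z
  obtain ⟨x, hx1, hx2, hx3⟩ := exists_eigenvector_near hδ1 hl' hNz (by rw [← hM]; exact hroot)
  obtain ⟨θ, hθ1, hθ2, hθ3⟩ := exists_eigenvector_near hδ1 hl' hNtz
    (by rw [← hMt, Matrix.charpoly_transpose]; exact hroot)
  rw [← hM] at hx1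
  rw [← hMt] at hθ1
  set K := (d + 1) * (‖v‖ * ‖φ‖) with hK
  have hK0 : 0 ≤ K := by positivity
  have hd : (0 : ℝ) ≤ d + 1 := by positivity
  have hθx : θ ⬝ᵥ x ≠ 0 := by
    have e1 : θ ⬝ᵥ x - 1 = θ ⬝ᵥ (x - v) + (θ - φ) ⬝ᵥ v := by
      rw [dotProduct_sub, sub_dotProduct, hφ]; ring
    have e2 : |θ ⬝ᵥ x - 1| ≤ 20 * K * δ := by
      rw [e1]
      refine (abs_add_le _ _).trans ?_
      refine (add_le_add (abs_dotProduct_le _ _) (abs_dotProduct_le _ _)).trans ?_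
      calc (d + 1 : ℝ) * (‖θ‖ * ‖x - v‖) + (d + 1) * (‖θ - φ‖ * ‖v‖)
          ≤ (d + 1 : ℝ) * (4 * ‖φ‖ * (4 * δ * ‖v‖)) + (d + 1) * (4 * δ * ‖φ‖ * ‖v‖) := by gcongr
        _ = 20 * K * δ := by rw [hK]; ring
    intro h0
    rw [h0] at e2
    norm_num at e2
    linarith
  have hθM : ∀ z, θ ⬝ᵥ (M *ᵥ z) = l * (θ ⬝ᵥ z) := fun z => by
    rw [Matrix.dotProduct_mulVec, ← Matrix.mulVec_transpose, hθ1, smul_dotProduct, smul_eq_mul]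
  -- On the invariant hyperplane ker θ, φ equals φ − θ, so the rank-one part contributes at most 1/8
  -- and N at most 1/16. As l ≥ 1/2, the normalised powers decay there at rate 1/2.
  have hcontr : ∀ z, θ ⬝ᵥ z = 0 → ‖M *ᵥ z‖ ≤ 1 / 4 * ‖z‖ := by
    intro z hz
    have e1 : M *ᵥ z = ((φ - θ) ⬝ᵥ z) • v + N *ᵥ z := by
      rw [sub_dotProduct, hz, sub_zero, hM, Matrix.add_mulVec, vecMulVec_mulVec']
    rw [e1]
    refine (norm_add_le _ _).trans ?_
    rw [norm_smul, Real.norm_eq_abs]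
    have e2 : |(φ - θ) ⬝ᵥ z| * ‖v‖ ≤ 4 * K * δ * ‖z‖ := by
      calc |(φ - θ) ⬝ᵥ z| * ‖v‖ ≤ (d + 1) * (‖φ - θ‖ * ‖z‖) * ‖v‖ := by
            gcongr; exact abs_dotProduct_le _ _
        _ ≤ (d + 1) * (4 * δ * ‖φ‖ * ‖z‖) * ‖v‖ := by
            rw [norm_sub_rev]; gcongr
        _ = 4 * K * δ * ‖z‖ := by rw [hK]; ring
    have e3 : 4 * K * δ * ‖z‖ ≤ 1 / 8 * ‖z‖ := by
      gcongr
      nlinarith [mul_nonneg hK0 hδ0.le]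
    have e4 : δ / 2 * ‖z‖ ≤ 1 / 16 * ‖z‖ :=
      mul_le_mul_of_nonneg_right (by linarith) (norm_nonneg z)
    linarith [hNz z, norm_nonneg z]
  have hpow : ∀ z, θ ⬝ᵥ z = 0 → ∀ n : ℕ, θ ⬝ᵥ (M ^ n *ᵥ z) = 0 ∧
      ‖M ^ n *ᵥ z‖ ≤ (1 / 4) ^ n * ‖z‖ := by
    intro z hz n
    induction n with
    | zero => simpa using hz
    | succ n ih =>
      rw [pow_succ', ← Matrix.mulVec_mulVec, hθM, ih.1, mul_zero]
      refine ⟨rfl, (hcontr _ ih.1).trans ?_⟩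
      rw [pow_succ']
      linarith [ih.2]
  have hl0 : (1 / 2 : ℝ) ≤ l := by linarith [hl.1]
  refine ⟨l, x, (θ ⬝ᵥ x)⁻¹ • θ, ?_, hx3.trans_lt hδ2⟩
  refine isAttracting_of_tendsto_zero (by linarith) ?_ hx1 fun z hz => ?_
  · rw [smul_dotProduct, smul_eq_mul, inv_mul_cancel₀ hθx]
  · rw [smul_dotProduct, smul_eq_mul, mul_eq_zero, or_iff_right (inv_ne_zero hθx)] at hz
    refine squeeze_zero_norm (a := fun n : ℕ => (1 / 2) ^ n * ‖z‖) (fun n => ?_) ?_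
    · rw [norm_smul, norm_inv, norm_pow, Real.norm_eq_abs, abs_of_pos (by linarith)]
      have e1 : (l ^ n)⁻¹ ≤ 2 ^ n := by
        rw [← inv_pow]
        exact pow_le_pow_left₀ (by positivity) (by
          rw [inv_le_comm₀ (by linarith) (by norm_num)]; linarith) n
      calc (l ^ n)⁻¹ * ‖M ^ n *ᵥ z‖ ≤ 2 ^ n * ((1 / 4) ^ n * ‖z‖) := by
            gcongr; exact (hpow z hz n).2
        _ = (1 / 2) ^ n * ‖z‖ := by rw [← mul_assoc, ← mul_pow]; norm_num
    · simpa using (tendsto_pow_atTop_nhds_zero_of_lt_one (r := (1 / 2 : ℝ)) (by norm_num)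
        (by norm_num)).mul_const ‖z‖

/-! ### Lifts and the topology of the projective space -/

theorem Represents.ne_zero {v : E d} {x : P d} (h : Represents v x) : v ≠ 0 := h.1

theorem represents_rep (x : P d) : Represents x.rep x := ⟨x.rep_nonzero, x.mk_rep⟩

theorem represents_mk {v : E d} (hv : v ≠ 0) : Represents v (Projectivization.mk ℝ v hv) :=
  ⟨hv, rfl⟩

theorem Represents.smul {v : E d} {x : P d} (h : Represents v x) {c : ℝ} (hc : c ≠ 0) :
    Represents (c • v) x := by
  obtain ⟨hv, rfl⟩ := h
  exact ⟨smul_ne_zero hc hv, (Projectivization.mk_eq_mk_iff' ℝ _ _ _ _).2 ⟨c, rfl⟩⟩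

theorem Represents.neg {v : E d} {x : P d} (h : Represents v x) : Represents (-v) x := by
  simpa using h.smul (c := -1) (by norm_num)

theorem Represents.exists_smul {v w : E d} {x : P d} (h : Represents v x) (h' : Represents w x) :
    ∃ c : ℝ, c ≠ 0 ∧ w = c • v := by
  obtain ⟨hv, rfl⟩ := h
  obtain ⟨hw, h'⟩ := h'
  obtain ⟨c, rfl⟩ := (Projectivization.mk_eq_mk_iff' ℝ _ _ _ _).1 h'
  exact ⟨c, fun hc => hw (by simp [hc]), rfl⟩

theorem Represents.unique {v : E d} {x y : P d} (h : Represents v x) (h' : Represents v y) :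
    x = y := by
  obtain ⟨hv, rfl⟩ := h
  obtain ⟨hw, rfl⟩ := h'
  rfl

theorem Represents.submodule_eq {v : E d} {x : P d} (h : Represents v x) :
    x.submodule = Submodule.span ℝ {v} := by
  obtain ⟨hv, rfl⟩ := h
  exact Projectivization.submodule_mk v hv

theorem Represents.submodule_le {v : E d} {x : P d} (h : Represents v x)
    {W : Submodule ℝ (E d)} : x.submodule ≤ W ↔ v ∈ W := by
  rw [h.submodule_eq, Submodule.span_singleton_le_iff_mem]

theorem Represents.mk_smul {v : E d} {x : P d} (h : Represents v x)
    (A : GL (Fin (d + 1)) ℝ) : Represents (A.1 *ᵥ v) (Matrix.ProjGenLinGroup.mk A • x) := by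
  obtain ⟨hv, rfl⟩ := h
  exact ⟨(smul_ne_zero_iff_ne A).2 hv, rfl⟩

theorem exists_represents_near {U : Set (P d)} {v : E d} {x : P d} (hv : Represents v x)
    (hU : U ∈ 𝓝 x) : ∃ ε > 0, ∀ w, ‖w - v‖ < ε → ∃ y ∈ U, Represents w y := by
  obtain ⟨hv, rfl⟩ := hv
  have hcont : Continuous (fun v : {v : E d // v ≠ 0} => Projectivization.mk ℝ v.1 v.2) :=
    continuous_coinduced_rng
  have h1 := hcont.tendsto ⟨v, hv⟩ hU
  obtain ⟨V, hV, hVU⟩ := (mem_nhds_induced _ _ _).1 h1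
  obtain ⟨ε, hε, hball⟩ := Metric.mem_nhds_iff.1 (Filter.inter_mem hV (isOpen_ne.mem_nhds hv))
  refine ⟨ε, hε, fun w hw => ?_⟩
  have h2 := hball (show w ∈ Metric.ball v ε by rwa [mem_ball_iff_norm])
  exact ⟨_, hVU (show (⟨w, h2.2⟩ : {v : E d // v ≠ 0}) ∈ _ from h2.1), h2.2, rfl⟩

theorem Represents.tendsto {ι : Type*} {l : Filter ι} {F : ι → P d} {u : ι → E d} {v : E d}
    {x : P d} (hv : Represents v x) (hF : ∀ i, Represents (u i) (F i))
    (hu : Tendsto u l (𝓝 v)) : Tendsto F l (𝓝 x) := by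
  intro U hU
  obtain ⟨ε, hε, h⟩ := exists_represents_near hv hU
  have h1 := (Metric.tendsto_nhds.1 hu) ε hε
  rw [mem_map]
  filter_upwards [h1] with i hi
  rw [dist_eq_norm] at hi
  obtain ⟨y, hy, hy'⟩ := h _ hi
  rwa [mem_preimage, (hF i).unique hy']

theorem isOpen_iff_lift {U : Set (P d)} :
    IsOpen U ↔ IsOpen {v : E d | ∃ x ∈ U, Represents v x} := by
  have h1 : IsOpen U ↔
      IsOpen ((fun v : {v : E d // v ≠ 0} => Projectivization.mk ℝ v.1 v.2) ⁻¹' U) :=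
    isOpen_coinduced
  have h2 : {v : E d | ∃ x ∈ U, Represents v x} = Subtype.val ''
      ((fun v : {v : E d // v ≠ 0} => Projectivization.mk ℝ v.1 v.2) ⁻¹' U) := by
    ext v
    constructor
    · rintro ⟨x, hx, hv, rfl⟩
      exact ⟨⟨v, hv⟩, hx, rfl⟩
    · rintro ⟨⟨v, hv⟩, hx, rfl⟩
      exact ⟨_, hx, hv, rfl⟩
  rw [h1, h2]
  exact (isOpen_ne (x := (0 : E d))).isOpenEmbedding_subtypeVal.isOpen_iff_image_isOpen

/-- The quotient map is open: the saturation of a ball is the union of its preimages under nonzero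
scalings, minus the origin. -/
theorem represents_near_mem_nhds {v : E d} {x : P d} (hv : Represents v x) {ε : ℝ} (hε : 0 < ε) :
    {y : P d | ∃ w, Represents w y ∧ ‖w - v‖ < ε} ∈ 𝓝 x := by
  refine IsOpen.mem_nhds ?_ ⟨v, hv, by simpa using hε⟩
  rw [isOpen_iff_lift]
  have : {w : E d | ∃ x ∈ {y : P d | ∃ w, Represents w y ∧ ‖w - v‖ < ε}, Represents w x} =
      ({0}ᶜ : Set (E d)) ∩ ⋃ t : {t : ℝ // t ≠ 0}, {w | ‖t.1 • w - v‖ < ε} := by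
    ext w
    simp only [mem_ofPred_eq, mem_inter_iff, mem_compl_iff, mem_singleton_iff, mem_iUnion,
      Subtype.exists, exists_prop]
    constructor
    · rintro ⟨y, ⟨w', hw', hlt⟩, hw⟩
      obtain ⟨c, hc, rfl⟩ := hw.exists_smul hw'
      exact ⟨hw.ne_zero, c, hc, hlt⟩
    · rintro ⟨hw, c, hc, hlt⟩
      exact ⟨_, ⟨c • w, (represents_mk hw).smul hc, hlt⟩, represents_mk hw⟩
  rw [this]
  refine isOpen_compl_singleton.inter (isOpen_iUnion fun t => ?_)
  exact isOpen_lt (by fun_prop) continuous_const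

/-- Sending a line to the orthogonal projection onto it is a continuous injection into matrices.
Uniqueness of limits gives well-defined endpoints. -/
instance instT2SpaceP : T2Space (P d) := by
  let Φ : P d → Mat d := fun x => (x.rep ⬝ᵥ x.rep)⁻¹ • Matrix.vecMulVec x.rep x.rep
  have hΦ : ∀ v x, Represents v x → Φ x = (v ⬝ᵥ v)⁻¹ • Matrix.vecMulVec v v := by
    intro v x h
    obtain ⟨c, hc, hv⟩ := h.exists_smul (represents_rep x)
    simp only [Φ, hv]
    rw [Matrix.smul_vecMulVec, Matrix.vecMulVec_smul, smul_smul, smul_smul, dotProduct_smul,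
      smul_dotProduct]
    congr 1
    simp only [smul_eq_mul]
    field_simp
  refine T2Space.of_injective_continuous (f := Φ) ?_ ?_
  · intro x y hxy
    have h1 : Φ x *ᵥ x.rep = x.rep := by
      have h0 : x.rep ⬝ᵥ x.rep ≠ 0 := by simpa using x.rep_nonzero
      simp only [Φ]
      rw [Matrix.smul_mulVec, vecMulVec_mulVec', smul_smul, inv_mul_cancel₀ h0, one_smul]
    rw [hxy] at h1
    simp only [Φ] at h1
    rw [Matrix.smul_mulVec, vecMulVec_mulVec', smul_smul] at h1
    have hc : (y.rep ⬝ᵥ y.rep)⁻¹ * (y.rep ⬝ᵥ x.rep) ≠ 0 := fun h0 => by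
      rw [h0, zero_smul] at h1
      exact x.rep_nonzero h1.symm
    have h2 := (represents_rep y).smul hc
    rw [h1] at h2
    exact (represents_rep x).unique h2
  · refine continuous_coinduced_dom.2 ?_
    have : Φ ∘ (fun v : {v : E d // v ≠ 0} => Projectivization.mk ℝ v.1 v.2) =
        fun v => (v.1 ⬝ᵥ v.1)⁻¹ • Matrix.vecMulVec v.1 v.1 := by
      ext1 v
      exact hΦ _ _ (represents_mk v.2)
    rw [this]
    have h1 : Continuous fun v : {v : E d // v ≠ 0} => v.1 ⬝ᵥ v.1 :=
      continuous_subtype_val.dotProduct continuous_subtype_val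
    have h2 : Continuous fun v : {v : E d // v ≠ 0} => Matrix.vecMulVec v.1 v.1 :=
      continuous_subtype_val.matrix_vecMulVec continuous_subtype_val
    exact (h1.inv₀ fun v => by simpa using v.2).smul h2

/-! ### The cone over a properly convex open set -/

/-- `C` is one of the two open convex cones over the properly convex open set `Ω`, and the linear
form `f` is positive on the closure of `C` minus the origin. -/
structure IsConeOver (Ω : Set (P d)) (C : Set (E d)) (f : E d) : Prop where
  isOpen : IsOpen C
  nonempty : C.Nonempty
  add_mem : ∀ v ∈ C, ∀ w ∈ C, v + w ∈ C
  smul_mem : ∀ v ∈ C, ∀ t : ℝ, 0 < t → t • v ∈ C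
  pos : ∀ v ∈ C, 0 < f ⬝ᵥ v
  bound : ∃ R > 0, ∀ v ∈ C, ‖v‖ ≤ R * (f ⬝ᵥ v)
  mem_iff : ∀ v x, Represents v x → (x ∈ Ω ↔ v ∈ C ∨ -v ∈ C)

/-- C is the half of the lift of Ω where the form of the chart is positive. Convexity of the slice f
= 1 gives stability under sums, and its boundedness gives the norm estimate. -/
theorem exists_isConeOver {Ω : Set (P d)} (hΩ : IsProperlyConvexOpen Ω) :
    ∃ C f, IsConeOver Ω C f := by
  obtain ⟨f₀, hf1, hf2, hf3⟩ := hΩ.exists_chart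
  obtain ⟨f, rfl⟩ := (dotProductEquiv ℝ (Fin (d + 1))).surjective f₀
  simp only [dotProductEquiv_apply_apply] at hf1 hf2 hf3
  have hnorm : ∀ v x, Represents v x → x ∈ Ω → 0 < f ⬝ᵥ v →
      (f ⬝ᵥ v)⁻¹ • v ∈ {v : E d | f ⬝ᵥ v = 1 ∧ ∃ x ∈ Ω, Represents v x} := by
    intro v x hv hx h0
    refine ⟨?_, x, hx, hv.smul (inv_ne_zero h0.ne')⟩
    rw [dotProduct_smul, smul_eq_mul, inv_mul_cancel₀ h0.ne']
  refine ⟨{v | ∃ x ∈ Ω, Represents v x} ∩ {v | 0 < f ⬝ᵥ v}, f, ?_, ?_, ?_, ?_, ?_, ?_, ?_⟩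
  · exact (isOpen_iff_lift.1 hΩ.isOpen).inter
      (isOpen_lt continuous_const (continuous_const.dotProduct continuous_id))
  · obtain ⟨x, hx⟩ := hΩ.nonempty
    have h1 := hf1 x hx _ (represents_rep x)
    rcases lt_or_gt_of_ne h1 with h2 | h2
    · exact ⟨-x.rep, ⟨x, hx, (represents_rep x).neg⟩, by simpa using h2⟩
    · exact ⟨x.rep, ⟨x, hx, represents_rep x⟩, h2⟩
  · rintro v ⟨⟨x, hx, hv⟩, hfv : 0 < f ⬝ᵥ v⟩ w ⟨⟨y, hy, hw⟩, hfw : 0 < f ⬝ᵥ w⟩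
    have h1 := hf2 (hnorm v x hv hx hfv) (hnorm w y hw hy hfw)
      (a := f ⬝ᵥ v / (f ⬝ᵥ v + f ⬝ᵥ w)) (b := f ⬝ᵥ w / (f ⬝ᵥ v + f ⬝ᵥ w))
      (by positivity) (by positivity) (by field_simp)
    obtain ⟨-, z, hz, hz'⟩ := h1
    have h2 := hz'.smul (c := f ⬝ᵥ v + f ⬝ᵥ w) (by positivity)
    refine ⟨⟨z, hz, ?_⟩, ?_⟩
    · convert h2 using 1
      rw [smul_add, smul_smul, smul_smul, smul_smul, smul_smul]
      congr 1
      · rw [show (f ⬝ᵥ v + f ⬝ᵥ w) * (f ⬝ᵥ v / (f ⬝ᵥ v + f ⬝ᵥ w)) * (f ⬝ᵥ v)⁻¹ = 1 by field_simp,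
          one_smul]
      · rw [show (f ⬝ᵥ v + f ⬝ᵥ w) * (f ⬝ᵥ w / (f ⬝ᵥ v + f ⬝ᵥ w)) * (f ⬝ᵥ w)⁻¹ = 1 by field_simp,
          one_smul]
    · simp only [mem_ofPred_eq, dotProduct_add]
      positivity
  · rintro v ⟨⟨x, hx, hv⟩, hfv : 0 < f ⬝ᵥ v⟩ t ht
    refine ⟨⟨x, hx, hv.smul ht.ne'⟩, ?_⟩
    simp only [mem_ofPred_eq, dotProduct_smul, smul_eq_mul]
    positivity
  · exact fun v hv => hv.2
  · obtain ⟨R, hR⟩ := isBounded_iff_forall_norm_le.1 hf3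
    refine ⟨max R 1, by positivity, ?_⟩
    rintro v ⟨⟨x, hx, hv⟩, hfv : 0 < f ⬝ᵥ v⟩
    have h1 := hR _ (hnorm v x hv hx hfv)
    rw [norm_smul, norm_inv, Real.norm_eq_abs, abs_of_pos hfv, inv_mul_le_iff₀ hfv] at h1
    rw [mul_comm]
    exact h1.trans (by gcongr; exact le_max_left _ _)
  · intro v x hv
    constructor
    · intro hx
      rcases lt_or_gt_of_ne (hf1 x hx v hv) with h2 | h2
      · exact Or.inr ⟨⟨x, hx, hv.neg⟩, by simpa using h2⟩
      · exact Or.inl ⟨⟨x, hx, hv⟩, h2⟩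
    · rintro (⟨⟨y, hy, hv'⟩, -⟩ | ⟨⟨y, hy, hv'⟩, -⟩)
      · rwa [hv.unique hv']
      · rwa [hv.neg.unique hv']

namespace IsConeOver

variable {Ω : Set (P d)} {C : Set (E d)} {f : E d} (h : IsConeOver Ω C f)
include h

theorem closure_bound : ∃ R > 0, ∀ v ∈ closure C, ‖v‖ ≤ R * (f ⬝ᵥ v) := by
  obtain ⟨R, hR, hb⟩ := h.bound
  refine ⟨R, hR, fun v hv => ?_⟩
  have hcl : IsClosed {v : E d | ‖v‖ ≤ R * (f ⬝ᵥ v)} :=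
    isClosed_le continuous_norm
      (continuous_const.mul (continuous_const.dotProduct continuous_id))
  exact closure_minimal hb hcl hv

theorem closure_nonneg {v : E d} (hv : v ∈ closure C) : 0 ≤ f ⬝ᵥ v := by
  obtain ⟨R, hR, hb⟩ := h.closure_bound
  by_contra hcon
  rw [not_le] at hcon
  nlinarith [hb v hv, norm_nonneg v]

theorem closure_pos {v : E d} (hv : v ∈ closure C) (h0 : v ≠ 0) : 0 < f ⬝ᵥ v := by
  obtain ⟨R, hR, hb⟩ := h.closure_bound
  have := hb v hv
  have h1 := norm_pos_iff.2 h0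
  by_contra hcon
  rw [not_lt] at hcon
  nlinarith

theorem neg_notMem_closure {v : E d} (hv : v ∈ closure C) (h0 : v ≠ 0) : -v ∉ closure C := by
  intro hv'
  have h1 := h.closure_pos hv h0
  have h2 := h.closure_nonneg hv'
  rw [dotProduct_neg] at h2
  linarith

theorem ne_zero {v : E d} (hv : v ∈ C) : v ≠ 0 := by
  rintro rfl
  simpa using h.pos 0 hv

/-- Openness lets y be replaced by some w in C close enough that x + y − w is still in C. -/
theorem add_closure_mem {x y : E d} (hx : x ∈ C) (hy : y ∈ closure C) : x + y ∈ C := by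
  have h1 : {w : E d | x + y - w ∈ C} ∈ 𝓝 y := by
    refine (h.isOpen.preimage (f := fun w => x + y - w) (by fun_prop)).mem_nhds ?_
    simpa using hx
  obtain ⟨w, hw1, hw2⟩ := mem_closure_iff_nhds.1 hy _ h1
  simpa using h.add_mem _ hw1 _ hw2

theorem closure_smul {x : E d} (hx : x ∈ closure C) {t : ℝ} (ht : 0 < t) : t • x ∈ closure C :=
  map_mem_closure (continuous_const_smul t) hx fun v hv => h.smul_mem v hv t ht

theorem closure_add {x y : E d} (hx : x ∈ closure C) (hy : y ∈ closure C) :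
    x + y ∈ closure C :=
  closure_mono (fun _ hz => by obtain ⟨v, hv, rfl⟩ := hz; exact h.add_closure_mem hv hy)
    (mem_closure_image (f := fun z => z + y) (by fun_prop : Continuous _).continuousAt hx)

theorem smul_mem_iff {x : E d} {t : ℝ} (ht : 0 < t) : t • x ∈ C ↔ x ∈ C := by
  refine ⟨fun hx => ?_, fun hx => h.smul_mem x hx t ht⟩
  simpa [smul_smul, inv_mul_cancel₀ ht.ne'] using h.smul_mem _ hx t⁻¹ (inv_pos.2 ht)

/-- A positive combination of two vectors of the closed cone belongs to the open cone as soon as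
another one does. -/
theorem comb_mem {x y : E d} (hx : x ∈ closure C) (hy : y ∈ closure C) {s t s' t' : ℝ}
    (hs : 0 < s) (ht : 0 < t) (hs' : 0 < s') (ht' : 0 < t') (hxy : s • x + t • y ∈ C) :
    s' • x + t' • y ∈ C := by
  -- A small multiple of the known combination is subtracted; the remainder has positive
  -- coefficients and lies in the closed cone.
  obtain ⟨r, hr, h1, h2⟩ : ∃ r : ℝ, 0 < r ∧ r * s < s' ∧ r * t < t' := by
    refine ⟨min (s' / s) (t' / t) / 2, by positivity, ?_, ?_⟩
    · have := min_le_left (s' / s) (t' / t)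
      rw [le_div_iff₀ hs] at this
      nlinarith
    · have := min_le_right (s' / s) (t' / t)
      rw [le_div_iff₀ ht] at this
      nlinarith
  have h3 := h.add_closure_mem (h.smul_mem _ hxy r hr)
    (h.closure_add (h.closure_smul hx (sub_pos.2 h1)) (h.closure_smul hy (sub_pos.2 h2)))
  convert h3 using 1
  module

theorem mem_closure_iff {v : E d} {x : P d} (hv : Represents v x) :
    x ∈ closure Ω ↔ v ∈ closure C ∨ -v ∈ closure C := by
  constructor
  · intro hx
    by_contra hcon
    rw [not_or] at hcon
    have h1 : (closure C)ᶜ ∩ {w | -w ∈ (closure C)ᶜ} ∈ 𝓝 v :=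
      (isClosed_closure.isOpen_compl.inter
        (isClosed_closure.isOpen_compl.preimage continuous_neg)).mem_nhds hcon
    obtain ⟨ε, hε, hball⟩ := Metric.mem_nhds_iff.1 h1
    obtain ⟨y, ⟨w, hw, hlt⟩, hy⟩ := mem_closure_iff_nhds.1 hx _ (represents_near_mem_nhds hv hε)
    have h2 := hball (mem_ball_iff_norm.2 hlt)
    rcases (h.mem_iff w y hw).1 hy with h3 | h3
    · exact h2.1 (subset_closure h3)
    · exact h2.2 (subset_closure h3)
  · have key : ∀ v, Represents v x → v ∈ closure C → x ∈ closure Ω := by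
      intro v hv hvC
      refine mem_closure_iff_nhds.2 fun U hU => ?_
      obtain ⟨ε, hε, hball⟩ := exists_represents_near hv hU
      obtain ⟨w, hw, hlt⟩ := Metric.mem_closure_iff.1 hvC ε hε
      rw [dist_comm, dist_eq_norm] at hlt
      obtain ⟨y, hy, hwy⟩ := hball w hlt
      exact ⟨y, hy, (h.mem_iff w y hwy).2 (Or.inl hw)⟩
    rintro (h1 | h1)
    · exact key v hv h1
    · exact key _ hv.neg h1

theorem isOpen_base : IsOpen Ω := by
  rw [isOpen_iff_lift]
  have : {v : E d | ∃ x ∈ Ω, Represents v x} = C ∪ -C := by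
    ext v
    constructor
    · rintro ⟨x, hx, hv⟩
      exact (h.mem_iff v x hv).1 hx
    · intro hv
      have hv0 : v ≠ 0 := by
        rintro rfl
        rcases hv with hv | hv
        · exact h.ne_zero hv rfl
        · exact h.ne_zero (v := -0) hv (by simp)
      exact ⟨_, (h.mem_iff v _ (represents_mk hv0)).2 hv, represents_mk hv0⟩
  rw [this]
  exact h.isOpen.union h.isOpen.neg

theorem mem_frontier_iff {v : E d} {x : P d} (hv : Represents v x) :
    x ∈ frontier Ω ↔ (v ∈ closure C \ C) ∨ (-v ∈ closure C \ C) := by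
  rw [h.isOpen_base.frontier_eq, Set.mem_sdiff, h.mem_closure_iff hv, h.mem_iff v x hv, not_or]
  constructor
  · rintro ⟨h1 | h1, h2, h3⟩
    · exact Or.inl ⟨h1, h2⟩
    · exact Or.inr ⟨h1, h3⟩
  · rintro (h1 | h1)
    · exact ⟨Or.inl h1.1, h1.2, fun h2 => h.neg_notMem_closure h1.1 hv.ne_zero (subset_closure h2)⟩
    · exact ⟨Or.inr h1.1, fun h2 => h.neg_notMem_closure (subset_closure h2) hv.ne_zero h1.1, h1.2⟩

theorem exists_represents_of_mem {x : P d} (hx : x ∈ Ω) : ∃ v ∈ C, Represents v x := by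
  rcases (h.mem_iff _ _ (represents_rep x)).1 hx with h1 | h1
  · exact ⟨_, h1, represents_rep x⟩
  · exact ⟨_, h1, (represents_rep x).neg⟩

theorem exists_represents_of_mem_frontier {x : P d} (hx : x ∈ frontier Ω) :
    ∃ v ∈ closure C \ C, Represents v x := by
  rcases (h.mem_frontier_iff (represents_rep x)).1 hx with h1 | h1
  · exact ⟨_, h1, represents_rep x⟩
  · exact ⟨_, h1, (represents_rep x).neg⟩

end IsConeOver

/-! ### Linear automorphisms of the cone -/

/-- The invertible matrices preserving `C`. -/
def coneStabilizer (C : Set (E d)) : Subgroup (GL (Fin (d + 1)) ℝ) where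
  carrier := {A | ∀ v, A.1 *ᵥ v ∈ C ↔ v ∈ C}
  mul_mem' := by
    intro A B hA hB v
    rw [Units.val_mul, ← Matrix.mulVec_mulVec, hA, hB]
  one_mem' := by intro v; simp
  inv_mem' := by
    intro A hA v
    rw [← hA, Matrix.mulVec_mulVec, ← Units.val_mul, mul_inv_cancel, Units.val_one,
      Matrix.one_mulVec]

theorem inv_mulVec_mulVec (A : GL (Fin (d + 1)) ℝ) (v : E d) : A⁻¹.1 *ᵥ (A.1 *ᵥ v) = v := by
  rw [Matrix.mulVec_mulVec, ← Units.val_mul, inv_mul_cancel, Units.val_one, Matrix.one_mulVec]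

theorem mulVec_inv_mulVec (A : GL (Fin (d + 1)) ℝ) (v : E d) : A.1 *ᵥ (A⁻¹.1 *ᵥ v) = v := by
  rw [Matrix.mulVec_mulVec, ← Units.val_mul, mul_inv_cancel, Units.val_one, Matrix.one_mulVec]

theorem mulVec_ne_zero_iff (A : GL (Fin (d + 1)) ℝ) {v : E d} : A.1 *ᵥ v ≠ 0 ↔ v ≠ 0 := by
  refine not_congr ⟨fun hv => ?_, fun hv => by rw [hv, Matrix.mulVec_zero]⟩
  rw [← inv_mulVec_mulVec A v, hv, Matrix.mulVec_zero]

theorem mulVec_mem_closure_iff {C : Set (E d)} {A : GL (Fin (d + 1)) ℝ}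
    (hA : A ∈ coneStabilizer C) {v : E d} : A.1 *ᵥ v ∈ closure C ↔ v ∈ closure C := by
  have key : ∀ B ∈ coneStabilizer C, ∀ v ∈ closure C, B.1 *ᵥ v ∈ closure C := fun B hB v hv =>
    map_mem_closure (f := fun v => B.1 *ᵥ v) (continuous_const.matrix_mulVec continuous_id) hv
      fun w hw => (hB w).2 hw
  refine ⟨fun hv => ?_, key A hA v⟩
  simpa only [inv_mulVec_mulVec] using key A⁻¹ (inv_mem hA) _ hv

variable {Ω : Set (P d)} {C : Set (E d)} {f : E d}

/-- Any lift maps C into C ∪ −C. It cannot reach both halves, since a positive combination of two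
vectors of C would then have its image in f = 0; hence one of ±A preserves C. -/
theorem IsConeOver.exists_lift (h : IsConeOver Ω C f) {g : PGLV d} (hg : g ∈ Aut Ω) :
    ∃ A ∈ coneStabilizer C, Matrix.ProjGenLinGroup.mk A = g := by
  obtain ⟨A, rfl⟩ := Matrix.ProjGenLinGroup.mk_surjective g
  have hmem : ∀ x, Matrix.ProjGenLinGroup.mk A • x ∈ Ω ↔ x ∈ Ω := by
    intro x
    have h1 : Matrix.ProjGenLinGroup.mk A • Ω = Ω := hg
    conv_lhs => rw [← h1]
    exact smul_mem_smul_set_iff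
  have hiff : ∀ v : E d, v ≠ 0 → ((A.1 *ᵥ v ∈ C ∨ -(A.1 *ᵥ v) ∈ C) ↔ (v ∈ C ∨ -v ∈ C)) := by
    intro v hv
    have h1 := represents_mk hv
    rw [← h.mem_iff _ _ (h1.mk_smul A), ← h.mem_iff _ _ h1, hmem]
  have key : ∀ B : GL (Fin (d + 1)) ℝ,
      (∀ v : E d, v ≠ 0 → ((B.1 *ᵥ v ∈ C ∨ -(B.1 *ᵥ v) ∈ C) ↔ (v ∈ C ∨ -v ∈ C))) →
      ∀ v₀ ∈ C, B.1 *ᵥ v₀ ∈ C → B ∈ coneStabilizer C := by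
    intro B hB v₀ hv₀ hBv₀
    have hfwd : ∀ v ∈ C, B.1 *ᵥ v ∈ C := by
      intro v hv
      refine ((hB v (h.ne_zero hv)).2 (Or.inl hv)).resolve_right fun hneg => ?_
      have h1 := h.pos _ hBv₀
      have h2 := h.pos _ hneg
      rw [dotProduct_neg] at h2
      set s := f ⬝ᵥ (B.1 *ᵥ v₀) / -(f ⬝ᵥ (B.1 *ᵥ v)) with hs
      have hs0 : 0 < s := by positivity
      have h3 : v₀ + s • v ∈ C := h.add_mem _ hv₀ _ (h.smul_mem _ hv s hs0)
      have h4 : f ⬝ᵥ (B.1 *ᵥ (v₀ + s • v)) = 0 := by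
        rw [Matrix.mulVec_add, Matrix.mulVec_smul, dotProduct_add, dotProduct_smul, smul_eq_mul, hs]
        have : -(f ⬝ᵥ (B.1 *ᵥ v)) ≠ 0 := h2.ne'
        have h6 : f ⬝ᵥ (B.1 *ᵥ v) ≠ 0 := by simpa using this
        field_simp
        ring
      rcases (hB _ (h.ne_zero h3)).2 (Or.inl h3) with h5 | h5
      · exact (h.pos _ h5).ne' h4
      · have := h.pos _ h5
        rw [dotProduct_neg, h4] at this
        simp at this
    intro v
    refine ⟨fun hv => ?_, hfwd v⟩
    have hv0 : v ≠ 0 := by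
      rintro rfl
      rw [Matrix.mulVec_zero] at hv
      exact h.ne_zero hv rfl
    refine ((hB v hv0).1 (Or.inl hv)).resolve_right fun hneg => ?_
    have h1 := h.pos _ (hfwd _ hneg)
    have h2 := h.pos _ hv
    rw [Matrix.mulVec_neg, dotProduct_neg] at h1
    linarith
  obtain ⟨v₀, hv₀⟩ := h.nonempty
  rcases (hiff v₀ (h.ne_zero hv₀)).2 (Or.inl hv₀) with h1 | h1
  · exact ⟨A, key A hiff v₀ hv₀ h1, rfl⟩
  · refine ⟨-A, key (-A) (fun v hv => ?_) v₀ hv₀ ?_, ?_⟩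
    · rw [← hiff v hv, Units.val_neg, Matrix.neg_mulVec, neg_neg, or_comm]
    · rwa [Units.val_neg, Matrix.neg_mulVec]
    · refine Matrix.ProjGenLinGroup.mk_eq_mk_iff.2 ⟨-1, ?_⟩
      ext i j
      simp

/-! ### Smooth and strongly extremal points -/

/-- The point `[a]` of the boundary is the only point `[z]` for which the segment from `[a]` to
`[z]` lies in the boundary. -/
def ConeExtremal (C : Set (E d)) (a : E d) : Prop :=
  ∀ z ∈ closure C, a + z ∉ C → ∃ t : ℝ, z = t • a

/-- Up to scaling, `ψ` is the only linear form positive on `C` and vanishing at `a`. -/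
def IsUniqueSupport (C : Set (E d)) (a ψ : E d) : Prop :=
  (∀ v ∈ C, 0 < ψ ⬝ᵥ v) ∧ ψ ⬝ᵥ a = 0 ∧
    ∀ χ : E d, (∀ v ∈ C, 0 < χ ⬝ᵥ v) → χ ⬝ᵥ a = 0 → ∃ c : ℝ, χ = c • ψ

namespace IsConeOver

variable (h : IsConeOver Ω C f)
include h

/-- A boundary segment through [a] lifts, up to a global sign, to two vectors u, w of the closed
cone with a a nonnegative combination of them. Were a extremal in the cone, both u and w would be
multiples of a, against independence. -/
theorem isStronglyExtremal_iff {a : E d} {x : P d} (ha : Represents a x)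
    (haC : a ∈ closure C \ C) : IsStronglyExtremal Ω x ↔ ConeExtremal C a := by
  constructor
  · rintro ⟨-, hx⟩ z hz haz
    by_contra hcon
    have hz0 : z ≠ 0 := by rintro rfl; exact hcon ⟨0, by simp⟩
    have hli : LinearIndependent ℝ ![a, z] := by
      rw [LinearIndependent.pair_iff' ha.ne_zero]
      intro t ht
      exact hcon ⟨t, ht.symm⟩
    refine hx a z hli ?_ ⟨a, left_mem_segment ℝ a z, ha⟩
    rintro y ⟨v, ⟨s, t, hs, ht, hst, rfl⟩, hv⟩
    refine (h.mem_frontier_iff hv).2 (Or.inl ?_)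
    rcases hs.eq_or_lt with rfl | hs
    · obtain rfl : t = 1 := by linarith
      simp only [zero_smul, one_smul, zero_add]
      exact ⟨hz, fun h1 => haz (add_comm a z ▸ h.add_closure_mem h1 haC.1)⟩
    rcases ht.eq_or_lt with rfl | ht
    · obtain rfl : s = 1 := by linarith
      simpa using haC
    · refine ⟨h.closure_add (h.closure_smul haC.1 hs) (h.closure_smul hz ht), fun h1 => haz ?_⟩
      simpa using h.comb_mem haC.1 hz hs ht one_pos one_pos h1
  · intro ha'
    refine ⟨(h.mem_frontier_iff ha).2 (Or.inl haC), ?_⟩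
    have main : ∀ u w : E d, LinearIndependent ℝ ![u, w] → projSegment u w ⊆ frontier Ω →
        0 < f ⬝ᵥ u → x ∉ projSegment u w := by
      rintro u w hli hsub hu ⟨v, ⟨s, t, hs, ht, hst, rfl⟩, hv⟩
      have hrep : ∀ s t : ℝ, s + t = 1 → s • u + t • w ≠ 0 := by
        intro s t hst h0
        have := LinearIndependent.pair_iff.1 hli s t h0
        linarith [this.1, this.2]
      have hfr : ∀ s t : ℝ, 0 ≤ s → 0 ≤ t → s + t = 1 →
          (s • u + t • w ∈ closure C \ C) ∨ -(s • u + t • w) ∈ closure C \ C :=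
        fun s t hs ht hst => (h.mem_frontier_iff (represents_mk (hrep s t hst))).1
          (hsub ⟨_, ⟨s, t, hs, ht, hst, rfl⟩, represents_mk _⟩)
      have hne : ∀ s t : ℝ, 0 ≤ s → 0 ≤ t → s + t = 1 → f ⬝ᵥ (s • u + t • w) ≠ 0 := by
        intro s t hs ht hst
        rcases hfr s t hs ht hst with h1 | h1
        · exact (h.closure_pos h1.1 (hrep s t hst)).ne'
        · have := h.closure_pos h1.1 (neg_ne_zero.2 (hrep s t hst))
          rw [dotProduct_neg] at this
          linarith
      -- Otherwise f would vanish somewhere on the segment, whereas it has no zero on boundary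
      -- lifts.
      have hw : 0 < f ⬝ᵥ w := by
        by_contra hcon
        rw [not_lt] at hcon
        have h1 : 0 < f ⬝ᵥ u - f ⬝ᵥ w := by linarith
        refine hne (-(f ⬝ᵥ w) / (f ⬝ᵥ u - f ⬝ᵥ w)) (f ⬝ᵥ u / (f ⬝ᵥ u - f ⬝ᵥ w))
          (div_nonneg (by linarith) h1.le) (by positivity) ?_ ?_
        · field_simp; ring
        · simp only [dotProduct_add, dotProduct_smul, smul_eq_mul]
          field_simp; ring
      have hin : ∀ s t : ℝ, 0 ≤ s → 0 ≤ t → s + t = 1 → s • u + t • w ∈ closure C \ C := by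
        intro s t hs ht hst
        refine (hfr s t hs ht hst).resolve_right fun h1 => ?_
        have h2 := h.closure_nonneg h1.1
        have h3 := hne s t hs ht hst
        rw [dotProduct_neg] at h2
        simp only [dotProduct_add, dotProduct_smul, smul_eq_mul] at h2 h3
        have : 0 ≤ s * f ⬝ᵥ u + t * f ⬝ᵥ w := by positivity
        exact h3 (by linarith)
      have huC : u ∈ closure C := by simpa using (hin 1 0 zero_le_one le_rfl (by norm_num)).1
      have hwC : w ∈ closure C := by simpa using (hin 0 1 le_rfl zero_le_one (by norm_num)).1
      have huw : (1 / 2 : ℝ) • u + (1 / 2 : ℝ) • w ∉ C :=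
        (hin (1 / 2) (1 / 2) (by norm_num) (by norm_num) (by norm_num)).2
      obtain ⟨c, hc, hcv⟩ := ha.exists_smul hv
      have hcpos : 0 < c := by
        have h1 := h.closure_pos (hin s t hs ht hst).1 (hrep s t hst)
        have h2 := h.closure_pos haC.1 ha.ne_zero
        rw [hcv, dotProduct_smul, smul_eq_mul] at h1
        exact pos_of_mul_pos_left h1 h2.le
      have haeq : a = (c⁻¹ * s) • u + (c⁻¹ * t) • w := by
        have h1 : c⁻¹ • (c • a) = c⁻¹ • (s • u + t • w) := by rw [hcv]
        rwa [smul_smul, inv_mul_cancel₀ hc, one_smul, smul_add, smul_smul, smul_smul] at h1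
      have hcs : 0 ≤ c⁻¹ * s := by positivity
      have hct : 0 ≤ c⁻¹ * t := by positivity
      have haw : a + w ∉ C := by
        intro h1
        rw [haeq, show (c⁻¹ * s) • u + (c⁻¹ * t) • w + w = (c⁻¹ * s) • u + (c⁻¹ * t + 1) • w by module]
          at h1
        rcases hs.eq_or_lt with rfl | hs'
        · rw [mul_zero, zero_smul, zero_add] at h1
          rw [h.smul_mem_iff (by positivity)] at h1
          exact huw (by
            rw [add_comm]
            exact h.add_closure_mem (h.smul_mem _ h1 _ (by norm_num))
              (h.closure_smul huC (by norm_num)))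
        · exact huw (h.comb_mem huC hwC (by positivity) (by positivity) (by norm_num)
            (by norm_num) h1)
      have hau : a + u ∉ C := by
        intro h1
        rw [haeq, show (c⁻¹ * s) • u + (c⁻¹ * t) • w + u = (c⁻¹ * s + 1) • u + (c⁻¹ * t) • w by module]
          at h1
        rcases ht.eq_or_lt with rfl | ht'
        · rw [mul_zero, zero_smul, add_zero] at h1
          rw [h.smul_mem_iff (by positivity)] at h1
          exact huw (h.add_closure_mem (h.smul_mem _ h1 _ (by norm_num))
              (h.closure_smul hwC (by norm_num)))
        · exact huw (h.comb_mem huC hwC (by positivity) (by positivity) (by norm_num)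
            (by norm_num) h1)
      obtain ⟨p, hp⟩ := ha' u huC hau
      obtain ⟨q, hq⟩ := ha' w hwC haw
      have h1 := LinearIndependent.pair_iff.1 hli q (-p) (by
        rw [hp, hq, smul_smul, smul_smul]; module)
      have : q = 0 := h1.1
      rw [this, zero_smul] at hq
      rw [hq] at hw
      simp at hw
    intro u w hli hsub hmem
    have hu0 : f ⬝ᵥ u ≠ 0 := by
      have hu : u ≠ 0 := by simpa using hli.ne_zero 0
      rcases (h.mem_frontier_iff (represents_mk hu)).1
        (hsub ⟨u, left_mem_segment ℝ u w, represents_mk hu⟩) with h1 | h1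
      · exact (h.closure_pos h1.1 hu).ne'
      · have := h.closure_pos h1.1 (neg_ne_zero.2 hu)
        rw [dotProduct_neg] at this
        linarith
    have hneg : projSegment (-u) (-w) = projSegment u w := by
      have key : ∀ u w : E d, projSegment u w ⊆ projSegment (-u) (-w) := by
        rintro u w y ⟨v, ⟨s, t, hs, ht, hst, rfl⟩, hv⟩
        exact ⟨_, ⟨s, t, hs, ht, hst, rfl⟩, by convert hv.neg using 1; module⟩
      refine Subset.antisymm ?_ (key u w)
      simpa using key (-u) (-w)
    rcases lt_or_gt_of_ne hu0 with h1 | h1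
    · refine main (-u) (-w) ?_ (by rwa [hneg]) (by simpa using h1) (by rwa [hneg])
      rw [LinearIndependent.pair_iff] at hli ⊢
      intro s t hst
      have := hli (-s) (-t) (by rw [← hst]; module)
      simpa using this
    · exact main u w hli hsub h1 hmem

/-- A linear form without zeros in `C` has a constant sign on `C`. -/
theorem pos_or_neg {χ : E d} (hχ : ∀ v ∈ C, χ ⬝ᵥ v ≠ 0) :
    (∀ v ∈ C, 0 < χ ⬝ᵥ v) ∨ ∀ v ∈ C, 0 < (-χ) ⬝ᵥ v := by
  by_contra hcon
  push Not at hcon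
  obtain ⟨⟨v, hv, hv'⟩, w, hw, hw'⟩ := hcon
  rw [neg_dotProduct] at hw'
  have h1 := hχ v hv
  have h2 := hχ w hw
  have h3 : χ ⬝ᵥ v < 0 := lt_of_le_of_ne hv' h1
  have h4 : 0 < χ ⬝ᵥ w := lt_of_le_of_ne (by linarith) h2.symm
  refine hχ _ (h.add_mem _ (h.smul_mem v hv _ h4) _ (h.smul_mem w hw _ (neg_pos.2 h3))) ?_
  simp only [dotProduct_add, dotProduct_smul, smul_eq_mul]
  ring

theorem isSupportingHyperplane_ker {a χ : E d} {x : P d} (ha : Represents a x)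
    (h1 : ∀ v ∈ C, 0 < χ ⬝ᵥ v) (h2 : χ ⬝ᵥ a = 0) :
    IsSupportingHyperplane Ω x (LinearMap.ker (dotProductEquiv ℝ (Fin (d + 1)) χ)) := by
  refine ⟨?_, ?_, ?_⟩
  · have hne : dotProductEquiv ℝ (Fin (d + 1)) χ ≠ 0 := by
      intro h0
      obtain ⟨v, hv⟩ := h.nonempty
      have := congrArg (fun l => l v) h0
      simp at this
      linarith [h1 v hv]
    exact LinearMap.isCoatom_ker_of_surjective (LinearMap.surjective hne)
  · rw [ha.submodule_le]
    simpa using h2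
  · intro y hy
    obtain ⟨v, hv, hvy⟩ := h.exists_represents_of_mem hy
    rw [hvy.submodule_le]
    simpa using (h1 v hv).ne'

theorem exists_of_isSupportingHyperplane {a : E d} {x : P d} (ha : Represents a x)
    {H : Submodule ℝ (E d)} (hH : IsSupportingHyperplane Ω x H) :
    ∃ χ : E d, (∀ v ∈ C, 0 < χ ⬝ᵥ v) ∧ χ ⬝ᵥ a = 0 ∧
      H = LinearMap.ker (dotProductEquiv ℝ (Fin (d + 1)) χ) := by
  obtain ⟨hco, hx, hdisj⟩ := hH
  obtain ⟨l, hl0, hl⟩ := Submodule.exists_le_ker_of_lt_top H hco.lt_top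
  obtain ⟨χ, rfl⟩ := (dotProductEquiv ℝ (Fin (d + 1))).surjective l
  have hker : H = LinearMap.ker (dotProductEquiv ℝ (Fin (d + 1)) χ) := by
    rcases hco.le_iff.1 hl with h1 | h1
    · exact absurd (LinearMap.ker_eq_top.1 h1) hl0
    · exact h1.symm
  have hχa : χ ⬝ᵥ a = 0 := by
    have := hl (ha.submodule_le.1 hx)
    simpa using this
  have hχ : ∀ v ∈ C, χ ⬝ᵥ v ≠ 0 := by
    intro v hv h0
    have hr := represents_mk (h.ne_zero hv)
    refine hdisj _ ((h.mem_iff v _ hr).2 (Or.inl hv)) (hr.submodule_le.2 ?_)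
    rw [hker]
    simpa using h0
  rcases h.pos_or_neg hχ with h1 | h1
  · exact ⟨χ, h1, hχa, hker⟩
  · refine ⟨-χ, h1, by rw [neg_dotProduct, hχa, neg_zero], ?_⟩
    rw [hker, map_neg]
    ext v
    simp

/-- Supporting hyperplanes at [a] are exactly the kernels of the forms positive on C and zero at a,
and a kernel determines its form up to scaling. -/
theorem isSmoothPoint_iff {a : E d} {x : P d} (ha : Represents a x) (haC : a ∈ closure C \ C) :
    IsSmoothPoint Ω x ↔ ∃ ψ, IsUniqueSupport C a ψ := by
  constructor
  · rintro ⟨-, H, hH, huniq⟩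
    obtain ⟨ψ, h1, h2, hker⟩ := h.exists_of_isSupportingHyperplane ha hH
    refine ⟨ψ, h1, h2, fun χ h3 h4 => ?_⟩
    have h5 := huniq _ (h.isSupportingHyperplane_ker ha h3 h4)
    obtain ⟨v, hv⟩ := h.nonempty
    have hv1 := h1 v hv
    refine ⟨χ ⬝ᵥ v / ψ ⬝ᵥ v, ?_⟩
    refine (dotProductEquiv ℝ (Fin (d + 1))).injective (LinearMap.ext fun w => ?_)
    have h6 : w - (ψ ⬝ᵥ w / ψ ⬝ᵥ v) • v ∈ H := by
      rw [hker, LinearMap.mem_ker]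
      simp only [dotProductEquiv_apply_apply, dotProduct_sub, dotProduct_smul, smul_eq_mul]
      field_simp
      ring
    rw [← h5, LinearMap.mem_ker] at h6
    simp only [dotProductEquiv_apply_apply, dotProduct_sub, dotProduct_smul, smul_eq_mul,
      smul_dotProduct] at h6 ⊢
    rw [sub_eq_zero] at h6
    rw [h6]
    ring
  · rintro ⟨ψ, h1, h2, huniq⟩
    refine ⟨(h.mem_frontier_iff ha).2 (Or.inl haC), _, h.isSupportingHyperplane_ker ha h1 h2,
      fun H hH => ?_⟩
    obtain ⟨χ, h3, h4, rfl⟩ := h.exists_of_isSupportingHyperplane ha hH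
    obtain ⟨c, rfl⟩ := huniq χ h3 h4
    have hc : c ≠ 0 := by
      rintro rfl
      obtain ⟨v, hv⟩ := h.nonempty
      simpa using h3 v hv
    rw [map_smul, LinearMap.ker_smul _ _ hc]

end IsConeOver

/-! Both notions are invariant under the linear automorphisms of the cone. -/

theorem ConeExtremal.mulVec {a : E d} (ha : ConeExtremal C a) {A : GL (Fin (d + 1)) ℝ}
    (hA : A ∈ coneStabilizer C) : ConeExtremal C (A.1 *ᵥ a) := by
  intro z hz haz
  obtain ⟨t, ht⟩ := ha (A⁻¹.1 *ᵥ z) ((mulVec_mem_closure_iff (inv_mem hA)).2 hz) fun h1 => haz (by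
    rw [← hA, Matrix.mulVec_add, mulVec_inv_mulVec] at h1
    exact h1)
  refine ⟨t, ?_⟩
  rw [← mulVec_inv_mulVec A z, ht, Matrix.mulVec_smul]

theorem IsUniqueSupport.mulVec {a ψ : E d} (ha : IsUniqueSupport C a ψ)
    {A : GL (Fin (d + 1)) ℝ} (hA : A ∈ coneStabilizer C) :
    IsUniqueSupport C (A.1 *ᵥ a) (ψ ᵥ* A⁻¹.1) := by
  refine ⟨fun v hv => ?_, ?_, fun χ h1 h2 => ?_⟩
  · rw [← Matrix.dotProduct_mulVec]
    exact ha.1 _ ((inv_mem hA v).2 hv)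
  · rw [← Matrix.dotProduct_mulVec, inv_mulVec_mulVec, ha.2.1]
  · obtain ⟨c, hc⟩ := ha.2.2 (χ ᵥ* A.1)
      (fun v hv => by rw [← Matrix.dotProduct_mulVec]; exact h1 _ ((hA v).2 hv))
      (by rw [← Matrix.dotProduct_mulVec, h2])
    refine ⟨c, ?_⟩
    rw [← Matrix.smul_vecMul, ← hc, Matrix.vecMul_vecMul, ← Units.val_mul, mul_inv_cancel,
      Units.val_one, Matrix.vecMul_one]

/-! ### The Hilbert metric and the straight geodesics -/

namespace IsConeOver

variable (h : IsConeOver Ω C f)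
include h

/-- If p were negative, adding −p(u + w) would put a multiple of the boundary vector w in C. -/
theorem fst_coeff_nonneg {u w : E d} (hw : w ∈ closure C \ C) (huw : u + w ∈ C) {p q : ℝ}
    (hpq : p • u + q • w ∈ closure C) : 0 ≤ p := by
  by_contra hp
  rw [not_le] at hp
  have h1 : (q - p) • w ∈ C := by
    convert h.add_closure_mem (h.smul_mem _ huw (-p) (by linarith)) hpq using 1
    module
  have h2 := h.pos _ h1
  have h3 := h.closure_nonneg hw.1
  rw [dotProduct_smul, smul_eq_mul] at h2
  exact hw.2 ((h.smul_mem_iff (pos_of_mul_pos_left h2 h3)).1 h1)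

theorem snd_coeff_nonneg {u w : E d} (hu : u ∈ closure C \ C) (huw : u + w ∈ C) {p q : ℝ}
    (hpq : p • u + q • w ∈ closure C) : 0 ≤ q := by
  rw [add_comm] at huw
  exact h.fst_coeff_nonneg hu huw (by rwa [add_comm (q • w)])

/-- With X = c(u + w) and Y = c'(u + τw), nonnegativity of the w-coefficient of MX − Y and of the
u-coefficient of M'Y − X gives τ ≤ MM'. This bounds every member of the set defining `hilbertDist`.
-/
theorem log_le_of_aligned {x y : P d} {X Y : E d} (hX : X ∈ C) (hY : Y ∈ C)
    (hXx : Represents X x) (hYy : Represents Y y) {M M' : ℝ} (hM : 0 < M)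
    (h1 : M • X - Y ∈ closure C) (h2 : M' • Y - X ∈ closure C) {r : ℝ}
    (hr : ∃ u w : E d, ∃ τ : ℝ, LinearIndependent ℝ ![u, w] ∧ 1 ≤ τ ∧
      (∃ a ∈ frontier Ω, Represents u a) ∧ (∃ b ∈ frontier Ω, Represents w b) ∧
      Represents (u + w) x ∧ Represents (u + τ • w) y ∧ r = (1 / 2) * Real.log τ) :
    r ≤ (1 / 2) * Real.log (M * M') := by
  have key : ∀ (u w : E d) (τ : ℝ), 1 ≤ τ → (∃ a ∈ frontier Ω, Represents u a) →
      (∃ b ∈ frontier Ω, Represents w b) → Represents (u + w) x → Represents (u + τ • w) y →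
      u + w ∈ C → τ ≤ M * M' := by
    rintro u w τ hτ ⟨a, ha, hua⟩ ⟨b, hb, hwb⟩ hx hy hC
    have hu : u ∈ closure C \ C := by
      rcases (h.mem_frontier_iff hua).1 ha with h3 | h3
      · exact h3
      rcases (h.mem_frontier_iff hwb).1 hb with h4 | h4
      · exact absurd (by simpa using h.add_closure_mem hC h3.1) h4.2
      · refine absurd ?_ (h.neg_notMem_closure (subset_closure hC) (h.ne_zero hC))
        rw [neg_add]
        exact h.closure_add h3.1 h4.1
    have hw : w ∈ closure C \ C := by
      rcases (h.mem_frontier_iff hwb).1 hb with h4 | h4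
      · exact h4
      · exact absurd (by simpa using h.add_closure_mem hC h4.1) hu.2
    obtain ⟨c, -, rfl⟩ := hx.exists_smul hXx
    obtain ⟨c', -, rfl⟩ := hy.exists_smul hYy
    have hfu := h.closure_pos hu.1 hua.ne_zero
    have hfw := h.closure_pos hw.1 hwb.ne_zero
    have hc : 0 < c := by
      have h3 := h.pos _ hX
      rw [dotProduct_smul, smul_eq_mul] at h3
      exact pos_of_mul_pos_left h3 (h.pos _ hC).le
    have hc' : 0 < c' := by
      have h3 := h.pos _ hY
      rw [dotProduct_smul, smul_eq_mul, dotProduct_add, dotProduct_smul, smul_eq_mul] at h3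
      exact pos_of_mul_pos_left h3 (by positivity)
    have h3 : 0 ≤ M * c - c' * τ := h.snd_coeff_nonneg hu hC (p := M * c - c') (by
      convert h1 using 1; module)
    have h4 : 0 ≤ M' * c' - c := h.fst_coeff_nonneg hw hC (q := M' * c' * τ - c) (by
      convert h2 using 1; module)
    have h5 : c' * τ ≤ c' * (M * M') := by nlinarith
    exact le_of_mul_le_mul_left h5 hc'
  obtain ⟨u, w, τ, -, hτ, ⟨a, ha, hua⟩, ⟨b, hb, hwb⟩, hx, hy, rfl⟩ := hr
  have hle : τ ≤ M * M' := by
    have hxΩ : x ∈ Ω := (h.mem_iff _ _ hXx).2 (Or.inl hX)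
    rcases (h.mem_iff _ _ hx).1 hxΩ with h3 | h3
    · exact key u w τ hτ ⟨a, ha, hua⟩ ⟨b, hb, hwb⟩ hx hy h3
    · refine key (-u) (-w) τ hτ ⟨a, ha, hua.neg⟩ ⟨b, hb, hwb.neg⟩ ?_ ?_ ?_
      · convert hx.neg using 1; module
      · convert hy.neg using 1; module
      · convert h3 using 1; module
  gcongr

theorem hilbertDist_le {x y : P d} {X Y : E d} (hX : X ∈ C) (hY : Y ∈ C) (hXx : Represents X x)
    (hYy : Represents Y y) {M M' : ℝ} (hM : 0 < M) (hMM : 1 ≤ M * M')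
    (h1 : M • X - Y ∈ closure C) (h2 : M' • Y - X ∈ closure C) :
    hilbertDist Ω x y ≤ (1 / 2) * Real.log (M * M') :=
  Real.sSup_le (fun _ hr => h.log_le_of_aligned hX hY hXx hYy hM h1 h2 hr)
    (mul_nonneg (by norm_num) (Real.log_nonneg hMM))

theorem zero_mem_closure : (0 : E d) ∈ closure C := by
  obtain ⟨v, hv⟩ := h.nonempty
  rw [← zero_smul ℝ v]
  exact map_mem_closure (s := Ioi (0 : ℝ)) (f := fun t : ℝ => t • v) (by fun_prop)
    (by rw [closure_Ioi]; exact self_mem_Ici) fun t ht => h.smul_mem _ hv t ht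

omit h in
theorem boundary_ne_zero {a b : E d} (hb : b ∈ closure C \ C) (hab : a + b ∈ C) : a ≠ 0 := by
  rintro rfl
  exact hb.2 (by simpa using hab)

theorem linearIndependent {a b : E d} (ha : a ∈ closure C \ C) (hb : b ∈ closure C \ C)
    (hab : a + b ∈ C) : LinearIndependent ℝ ![a, b] := by
  rw [LinearIndependent.pair_iff]
  have key : ∀ s t : ℝ, s • a + t • b = 0 → s = 0 ∧ t = 0 := by
    intro s t hst
    have h0 := h.zero_mem_closure
    have h1 : (-s) • a + (-t) • b = 0 := by
      rw [neg_smul, neg_smul, ← neg_add, hst, neg_zero]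
    have h2 := h.fst_coeff_nonneg hb hab (hst ▸ h0)
    have h3 := h.snd_coeff_nonneg ha hab (hst ▸ h0)
    have h4 := h.fst_coeff_nonneg hb hab (h1 ▸ h0)
    have h5 := h.snd_coeff_nonneg ha hab (h1 ▸ h0)
    exact ⟨by linarith, by linarith⟩
  exact key

theorem geodesic_mem {a b : E d} (ha : a ∈ closure C \ C) (hb : b ∈ closure C \ C)
    (hab : a + b ∈ C) {s : ℝ} (hs : 0 < s) : b + s • a ∈ C := by
  have := h.comb_mem ha.1 hb.1 one_pos one_pos hs one_pos (by simpa using hab)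
  rwa [one_smul, add_comm] at this

/-- For s ≤ t the previous bound applies with M = e^{2(t−s)} and M' = 1, and the chord from [b] to
[a] attains it. The 2 in the exponent compensates the 1/2 in the metric; s > t follows by exchanging
a and b. -/
theorem hilbertDist_geodesic {a b : E d} (ha : a ∈ closure C \ C) (hb : b ∈ closure C \ C)
    (hab : a + b ∈ C) {x y : P d} {s t : ℝ} (hx : Represents (b + Real.exp (2 * s) • a) x)
    (hy : Represents (b + Real.exp (2 * t) • a) y) : hilbertDist Ω x y = |s - t| := by
  have main : ∀ a b : E d, a ∈ closure C \ C → b ∈ closure C \ C → a + b ∈ C →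
      ∀ (x y : P d) (s t : ℝ), s ≤ t → Represents (b + Real.exp (2 * s) • a) x →
      Represents (b + Real.exp (2 * t) • a) y → hilbertDist Ω x y = t - s := by
    clear ha hb hab hx hy
    intro a b ha hb hab x y s t hst hx hy
    have ha0 := boundary_ne_zero hb hab
    have hb0 := boundary_ne_zero ha (add_comm a b ▸ hab)
    have h1τ : 1 ≤ Real.exp (2 * (t - s)) := Real.one_le_exp (by linarith)
    have hts : Real.exp (2 * t) = Real.exp (2 * (t - s)) * Real.exp (2 * s) := by
      rw [← Real.exp_add]; ring_nf
    have hle1 : Real.exp (2 * (t - s)) • (b + Real.exp (2 * s) • a) - (b + Real.exp (2 * t) • a) ∈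
        closure C := by
      rcases h1τ.eq_or_lt with h2 | h2
      · rw [hts, ← h2, one_mul, one_smul, sub_self]
        exact h.zero_mem_closure
      · convert h.closure_smul hb.1 (sub_pos.2 h2) using 1
        rw [hts]
        module
    have hle2 : (1 : ℝ) • (b + Real.exp (2 * t) • a) - (b + Real.exp (2 * s) • a) ∈ closure C := by
      rcases hst.eq_or_lt with rfl | h2
      · rw [one_smul, sub_self]
        exact h.zero_mem_closure
      · have h3 : Real.exp (2 * s) < Real.exp (2 * t) := Real.exp_lt_exp.2 (by linarith)
        convert h.closure_smul ha.1 (sub_pos.2 h3) using 1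
        module
    have hset := fun r => h.log_le_of_aligned (r := r) (h.geodesic_mem ha hb hab (Real.exp_pos _))
      (h.geodesic_mem ha hb hab (Real.exp_pos _)) hx hy (Real.exp_pos (2 * (t - s))) hle1 hle2
    have hval : 1 / 2 * Real.log (Real.exp (2 * (t - s)) * 1) = t - s := by
      rw [mul_one, Real.log_exp]; ring
    rw [hval] at hset
    -- The base point is absorbed in the second endpoint: w = e^{2s}a makes x equal to [u + w] and
    -- the cross-ratio e^{2(t−s)}.
    refine le_antisymm (Real.sSup_le hset (by linarith)) (le_csSup ⟨_, hset⟩ ?_)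
    refine ⟨b, Real.exp (2 * s) • a, Real.exp (2 * (t - s)), ?_, h1τ, ?_, ?_, hx, ?_, ?_⟩
    · have := h.linearIndependent hb ha (add_comm a b ▸ hab)
      rw [LinearIndependent.pair_iff] at this ⊢
      intro p q hpq
      rw [smul_smul] at hpq
      have := this _ _ hpq
      exact ⟨this.1, (mul_eq_zero.1 this.2).resolve_right (Real.exp_pos _).ne'⟩
    · exact ⟨_, (h.mem_frontier_iff (represents_mk hb0)).2 (Or.inl hb), represents_mk hb0⟩
    · exact ⟨_, (h.mem_frontier_iff (represents_mk ha0)).2 (Or.inl ha),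
        (represents_mk ha0).smul (Real.exp_pos _).ne'⟩
    · rwa [smul_smul, ← hts]
    · rw [Real.log_exp]; ring
  rcases le_total s t with hst | hst
  · rw [main a b ha hb hab x y s t hst hx hy, abs_sub_comm, abs_of_nonneg (by linarith)]
  · have hinv : ∀ (r : ℝ) (z : P d), Represents (b + Real.exp (2 * r) • a) z →
        Represents (a + Real.exp (2 * (-r)) • b) z := by
      intro r z hz
      convert hz.smul (Real.exp_pos (2 * (-r))).ne' using 1
      rw [smul_add, smul_smul, ← Real.exp_add, add_comm]
      simp
    rw [main b a hb ha (add_comm a b ▸ hab) x y (-s) (-t) (by linarith) (hinv s x hx) (hinv t y hy),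
      abs_of_nonneg (by linarith)]
    ring

end IsConeOver

/-- The vector `v` generates the geodesic `t ↦ [b + e²ᵗ a]`, where `a` and `b` are vectors of the
boundary of the cone representing the endpoints of `v`. -/
structure T1.IsGeodesic (C : Set (E d)) (v : T1 Ω) (a b : E d) : Prop where
  fst_mem : a ∈ closure C \ C
  snd_mem : b ∈ closure C \ C
  add_mem : a + b ∈ C
  represents : ∀ t, Represents (b + Real.exp (2 * t) • a) (v.curve t)

theorem T1.IsGeodesic.fst_ne_zero {v : T1 Ω} {a b : E d} (hv : v.IsGeodesic C a b) : a ≠ 0 :=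
  IsConeOver.boundary_ne_zero hv.snd_mem hv.add_mem

theorem T1.IsGeodesic.snd_ne_zero {v : T1 Ω} {a b : E d} (hv : v.IsGeodesic C a b) : b ≠ 0 :=
  IsConeOver.boundary_ne_zero hv.fst_mem (add_comm a b ▸ hv.add_mem)

theorem T1.IsGeodesic.hasForwardEndpoint {v : T1 Ω} {a b : E d} (hv : v.IsGeodesic C a b)
    {ξ : P d} (ha : Represents a ξ) : v.HasForwardEndpoint ξ := by
  refine ha.tendsto (fun t => (hv.represents t).smul (Real.exp_pos (-(2 * t))).ne') ?_
  have h1 : Tendsto (fun t : ℝ => Real.exp (-(2 * t))) atTop (𝓝 0) :=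
    Real.tendsto_exp_neg_atTop_nhds_zero.comp (tendsto_id.const_mul_atTop two_pos)
  have h2 := (h1.smul_const b).add_const a
  rw [zero_smul, zero_add] at h2
  refine h2.congr fun t => ?_
  rw [smul_add, smul_smul, ← Real.exp_add]
  simp

theorem T1.IsGeodesic.hasBackwardEndpoint {v : T1 Ω} {a b : E d} (hv : v.IsGeodesic C a b)
    {η : P d} (hb : Represents b η) : v.HasBackwardEndpoint η := by
  refine hb.tendsto hv.represents ?_
  have h1 : Tendsto (fun t : ℝ => Real.exp (2 * t)) atBot (𝓝 0) :=
    Real.tendsto_exp_atBot.comp (tendsto_id.const_mul_atBot two_pos)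
  simpa using (h1.smul_const a).const_add b

/-- An isometric parametrisation of `ℝ` is `t ↦ t₀ ± t`. -/
theorem eq_add_or_eq_sub_of_abs_sub {φ : ℝ → ℝ} (h : ∀ s t, |φ s - φ t| = |s - t|) :
    (∀ t, φ t = φ 0 + t) ∨ ∀ t, φ t = φ 0 - t := by
  have key : ∀ t, φ t = φ 0 + t ∨ φ t = φ 0 - t := by
    intro t
    rcases abs_eq_abs.1 (h t 0) with h1 | h1
    · left; linarith
    · right; linarith
  rcases key 1 with h1 | h1
  · left
    intro t
    rcases key t with h2 | h2
    · exact h2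
    · have := abs_eq_abs.1 (h t 1)
      rcases this with h3 | h3 <;> linarith
  · right
    intro t
    rcases key t with h2 | h2
    · have := abs_eq_abs.1 (h t 1)
      rcases this with h3 | h3 <;> linarith
    · exact h2

namespace IsConeOver

variable (h : IsConeOver Ω C f)
include h

theorem exists_isGeodesic_of_boundary {a b : E d} (ha : a ∈ closure C \ C)
    (hb : b ∈ closure C \ C) (hab : a + b ∈ C) : ∃ v : T1 Ω, v.IsGeodesic C a b := by
  have hmem := fun t : ℝ => h.geodesic_mem ha hb hab (Real.exp_pos (2 * t))
  refine ⟨⟨fun t => Projectivization.mk ℝ _ (h.ne_zero (hmem t)), fun t => ?_, fun s t => ?_,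
    Submodule.span ℝ (Set.range ![a, b]), ?_, fun t => ?_⟩, ha, hb, hab, fun t => represents_mk _⟩
  · exact (h.mem_iff _ _ (represents_mk _)).2 (Or.inl (hmem t))
  · exact h.hilbertDist_geodesic ha hb hab (represents_mk _) (represents_mk _)
  · rw [finrank_span_eq_card (h.linearIndependent ha hb hab)]
    simp
  · rw [(represents_mk (h.ne_zero (hmem t))).submodule_le]
    have h0 : a ∈ Submodule.span ℝ (Set.range ![a, b]) := Submodule.subset_span ⟨0, rfl⟩
    have h1 : b ∈ Submodule.span ℝ (Set.range ![a, b]) := Submodule.subset_span ⟨1, rfl⟩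
    exact Submodule.add_mem _ h1 (Submodule.smul_mem _ _ h0)

/-- Two vectors of the cone at the same height lie on a segment with endpoints in the boundary. -/
theorem exists_chord {p q : E d} (hp : p ∈ C) (hq : q ≠ 0) (hfq : f ⬝ᵥ q = 0) :
    ∃ s₁ s₂ : ℝ, p + s₁ • q ∈ closure C \ C ∧ p + s₂ • q ∈ closure C \ C ∧
      ∀ s, p + s • q ∈ C → s₁ < s ∧ s < s₂ := by
  obtain ⟨R, hR, hb⟩ := h.closure_bound
  have hqn := norm_pos_iff.2 hq
  have main : ∀ q : E d, q ≠ 0 → f ⬝ᵥ q = 0 → ∃ s₂ : ℝ, p + s₂ • q ∈ closure C \ C ∧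
      ∀ s, p + s • q ∈ C → s < s₂ := by
    intro q hq hfq
    have hqn := norm_pos_iff.2 hq
    -- Since f is constant on this line, the norm bound on the closed cone makes S bounded; its
    -- supremum gives the exit point, which is in the closed cone but not in the open one.
    set S := {s : ℝ | p + s • q ∈ closure C} with hS
    have hScl : IsClosed S := isClosed_closure.preimage (by fun_prop)
    have hSne : S.Nonempty := ⟨0, by simpa [hS] using subset_closure hp⟩
    have hSbd : BddAbove S := by
      refine ⟨(R * (f ⬝ᵥ p) + ‖p‖) / ‖q‖, fun s hs => ?_⟩
      rw [le_div_iff₀ hqn]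
      have h1 := hb _ hs
      rw [dotProduct_add, dotProduct_smul, hfq, smul_zero, add_zero] at h1
      have h2 : ‖s • q‖ ≤ ‖p + s • q‖ + ‖p‖ := by
        simpa using norm_sub_le (p + s • q) p
      rw [norm_smul, Real.norm_eq_abs] at h2
      nlinarith [le_abs_self s]
    have hlt : ∀ s, p + s • q ∈ C → s < sSup S := by
      intro s hs
      have hev : ∀ᶠ r in 𝓝 s, p + r • q ∈ C :=
        (h.isOpen.preimage (f := fun r : ℝ => p + r • q) (by fun_prop)).mem_nhds hs
      obtain ⟨r, hr1, hr2⟩ := ((hev.filter_mono nhdsWithin_le_nhds).and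
        (self_mem_nhdsWithin (s := Ioi s))).exists
      exact lt_of_lt_of_le hr2 (le_csSup hSbd (subset_closure hr1))
    exact ⟨sSup S, ⟨hScl.csSup_mem hSne hSbd, fun h1 => lt_irrefl _ (hlt _ h1)⟩, hlt⟩
  obtain ⟨s₂, h1, h2⟩ := main q hq hfq
  obtain ⟨s₁, h3, h4⟩ := main (-q) (neg_ne_zero.2 hq) (by rw [dotProduct_neg, hfq, neg_zero])
  refine ⟨-s₁, s₂, by simpa using h3, h1, fun s hs => ⟨?_, h2 s hs⟩⟩
  have := h4 (-s) (by simpa using hs)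
  linarith

/-- The plane carrying v meets the level set of f through p in a line whose chord ends give the
boundary vectors. Half the logarithm of the projective coordinate on this chord is an isometric
parameter, so the given curve is t ↦ t₀ ± t in it; rescaling one endpoint absorbs t₀, and the minus
sign swaps the endpoints. -/
theorem exists_isGeodesic (v : T1 Ω) : ∃ a b, v.IsGeodesic C a b := by
  obtain ⟨L, hL, hLv⟩ := v.straight
  obtain ⟨p, hp, hpv⟩ := h.exists_represents_of_mem (v.mem 0)
  obtain ⟨p', hp', hpv'⟩ := h.exists_represents_of_mem (v.mem 1)
  have hpL : p ∈ L := hpv.submodule_le.1 (hLv 0)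
  have hpL' : p' ∈ L := hpv'.submodule_le.1 (hLv 1)
  have hfp := h.pos p hp
  have hfp' := h.pos p' hp'
  set q := (f ⬝ᵥ p) • p' - (f ⬝ᵥ p') • p with hq
  have hfq : f ⬝ᵥ q = 0 := by
    rw [hq, dotProduct_sub, dotProduct_smul, dotProduct_smul, smul_eq_mul, smul_eq_mul]; ring
  have hq0 : q ≠ 0 := by
    intro h0
    have h1 : (f ⬝ᵥ p) • p' = (f ⬝ᵥ p') • p := sub_eq_zero.1 h0
    have h2 : v.curve 0 = v.curve 1 :=
      (hpv.smul hfp'.ne').unique (h1 ▸ hpv'.smul hfp.ne')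
    have h3 := v.isometric 0 1
    have h4 := v.isometric 0 0
    rw [← h2, h4] at h3
    norm_num at h3
  have hqL : q ∈ L := L.sub_mem (L.smul_mem _ hpL') (L.smul_mem _ hpL)
  obtain ⟨s₁, s₂, hs₁, hs₂, hs⟩ := h.exists_chord hp hq0 hfq
  have hli : LinearIndependent ℝ ![p, q] := by
    rw [LinearIndependent.pair_iff]
    intro s t hst
    have h1 := congrArg (fun z => f ⬝ᵥ z) hst
    simp only [dotProduct_add, dotProduct_smul, hfq, smul_eq_mul, mul_zero, add_zero,
      dotProduct_zero] at h1
    have h2 : s = 0 := (mul_eq_zero.1 h1).resolve_right hfp.ne'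
    rw [h2, zero_smul, zero_add] at hst
    exact ⟨h2, (smul_eq_zero.1 hst).resolve_right hq0⟩
  have hLspan : L = Submodule.span ℝ {p, q} := by
    have : FiniteDimensional ℝ L := inferInstance
    refine (Submodule.eq_of_le_of_finrank_eq ?_ ?_).symm
    · rw [Submodule.span_le]
      rintro z (rfl | rfl)
      · exact hpL
      · exact hqL
    · have h1 := finrank_span_eq_card hli
      rw [Matrix.range_cons, Matrix.range_cons, Matrix.range_empty, union_empty,
        singleton_union] at h1
      rw [h1, hL]
      simp
  set a' := p + s₂ • q with ha'
  set b' := p + s₁ • q with hb'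
  have hcoord : ∀ t, ∃ r : ℝ, Represents (b' + Real.exp (2 * r) • a') (v.curve t) := by
    intro t
    obtain ⟨y, hy, hyv⟩ := h.exists_represents_of_mem (v.mem t)
    have hyL := hyv.submodule_le.1 (hLv t)
    rw [hLspan, Submodule.mem_span_pair] at hyL
    obtain ⟨α, β, rfl⟩ := hyL
    have hα : 0 < α := by
      have h1 := h.pos _ hy
      rw [dotProduct_add, dotProduct_smul, dotProduct_smul, hfq, smul_zero, add_zero,
        smul_eq_mul] at h1
      exact pos_of_mul_pos_left h1 hfp.le
    obtain ⟨h1, h2⟩ := hs (α⁻¹ * β) (by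
      have := h.smul_mem _ hy α⁻¹ (inv_pos.2 hα)
      rwa [smul_add, smul_smul, smul_smul, inv_mul_cancel₀ hα.ne', one_smul] at this)
    set s := α⁻¹ * β with hsdef
    have hβ : β = α * s := by rw [hsdef]; field_simp
    have h3 : 0 < s - s₁ := by linarith
    have h4 : 0 < s₂ - s := by linarith
    -- This comes from (s₂ − s)b' + (s − s₁)a' = (s₂ − s₁)(p + sq).
    refine ⟨Real.log ((s - s₁) / (s₂ - s)) / 2, ?_⟩
    rw [mul_div_cancel₀ _ two_ne_zero, Real.exp_log (by positivity)]
    convert hyv.smul (c := (s₂ - s₁) / (α * (s₂ - s)))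
      (div_pos (by linarith) (by positivity)).ne' using 1
    rw [ha', hb', hβ]
    match_scalars
    · field_simp; ring
    · field_simp; ring
  have hab : a' + b' ∈ C := by
    have h1 := h.comb_mem hs₁.1 hs₂.1 (s := s₂) (t := -s₁) (s' := 1) (t' := 1)
    have h2 := hs 0 (by simpa using hp)
    have h3 : s₂ • (p + s₁ • q) + (-s₁) • (p + s₂ • q) = (s₂ - s₁) • p := by module
    rw [h3] at h1
    have h4 := h1 h2.2 (by linarith) one_pos one_pos (h.smul_mem _ hp _ (by linarith))
    rw [one_smul, one_smul] at h4
    rw [add_comm]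
    exact h4
  clear_value a' b'
  choose φ hφ using hcoord
  have hiso : ∀ s t, |φ s - φ t| = |s - t| := by
    intro s t
    rw [← v.isometric s t]
    exact (h.hilbertDist_geodesic hs₂ hs₁ hab (hφ s) (hφ t)).symm
  have hscale : ∀ x ∈ closure C \ C, ∀ r : ℝ, 0 < r → r • x ∈ closure C \ C := fun x hx r hr =>
    ⟨h.closure_smul hx.1 hr, fun h1 => hx.2 ((h.smul_mem_iff hr).1 h1)⟩
  rcases eq_add_or_eq_sub_of_abs_sub hiso with h1 | h1
  · refine ⟨Real.exp (2 * φ 0) • a', b', hscale _ hs₂ _ (Real.exp_pos _), hs₁, ?_, fun t => ?_⟩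
    · rw [add_comm]
      exact h.geodesic_mem hs₂ hs₁ hab (Real.exp_pos _)
    · rw [smul_smul, ← Real.exp_add]
      convert hφ t using 3
      rw [h1 t]; ring_nf
  · refine ⟨b', Real.exp (2 * φ 0) • a', hs₁, hscale _ hs₂ _ (Real.exp_pos _), ?_, fun t => ?_⟩
    · exact h.geodesic_mem hs₂ hs₁ hab (Real.exp_pos _)
    · convert (hφ t).smul (Real.exp_pos (2 * t)).ne' using 1
      rw [smul_add, smul_smul, ← Real.exp_add, h1 t, add_comm]
      congr 3
      ring_nf

/-- Vectors whose endpoints are close, in suitable lifts, are close. -/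
theorem exists_near {v : T1 Ω} {a b : E d} (hv : v.IsGeodesic C a b) {r : ℝ} (hr : 0 < r) :
    ∃ ε > 0, ∀ a' b', ‖a' - a‖ < ε → ‖b' - b‖ < ε → ∀ w : T1 Ω, w.IsGeodesic C a' b' →
      T1.dist v w < r := by
  obtain ⟨ρ, hρ, hball⟩ := Metric.isOpen_iff.1 h.isOpen _ hv.add_mem
  set δ := r / 2 with hδ
  have hδ0 : 0 < δ := by positivity
  set K := (1 + δ) * (1 + Real.exp 2) with hK
  have hK0 : 0 < K := by positivity
  -- The radius is chosen so that (1 + δ)‖Y − X‖ < δρ for every t in [0, 1]; then (1 + δ)X − Y and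
  -- (1 + δ)Y − X lie in C and the distance is at most log(1 + δ) ≤ δ < r.
  refine ⟨δ * ρ / K, by positivity, fun a' b' ha hb w hw => ?_⟩
  refine lt_of_le_of_lt (Real.sSup_le (a := δ) ?_ hδ0.le) (by linarith)
  rintro _ ⟨t, ⟨ht0, ht1⟩, rfl⟩
  have hexp0 : 1 ≤ Real.exp (2 * t) := Real.one_le_exp (by linarith)
  have hexp1 : Real.exp (2 * t) ≤ Real.exp 2 := Real.exp_le_exp.2 (by linarith)
  set X := b + Real.exp (2 * t) • a with hX
  set Y := b' + Real.exp (2 * t) • a' with hY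
  have hXY : (1 + δ) * ‖Y - X‖ < δ * ρ := by
    have h1 : Y - X = (b' - b) + Real.exp (2 * t) • (a' - a) := by rw [hX, hY]; module
    have h2 : ‖Y - X‖ ≤ ‖b' - b‖ + Real.exp (2 * t) * ‖a' - a‖ := by
      rw [h1]
      refine (norm_add_le _ _).trans ?_
      rw [norm_smul, Real.norm_eq_abs, abs_of_pos (Real.exp_pos _)]
    have h3 : ‖Y - X‖ < (1 + Real.exp 2) * (δ * ρ / K) := by
      have h4 : Real.exp (2 * t) * ‖a' - a‖ ≤ Real.exp 2 * (δ * ρ / K) := by gcongr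
      linarith
    calc (1 + δ) * ‖Y - X‖ < (1 + δ) * ((1 + Real.exp 2) * (δ * ρ / K)) := by gcongr
      _ = K * (δ * ρ / K) := by rw [hK]; ring
      _ = δ * ρ := by field_simp
  -- As e^{2t} ≥ 1, δX is δ(a + b) plus a nonnegative multiple of a, so it inherits the room δρ
  -- around δ(a + b).
  have key : ∀ e : E d, ‖e‖ < δ * ρ → δ • X + e ∈ C := by
    intro e he
    have h1 : (a + b) + δ⁻¹ • e ∈ C := by
      refine hball ?_
      rw [mem_ball_iff_norm, add_sub_cancel_left, norm_smul, norm_inv, Real.norm_eq_abs,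
        abs_of_pos hδ0, inv_mul_lt_iff₀ hδ0]
      exact he
    have h2 := h.smul_mem _ h1 δ hδ0
    have h3 : δ • X + e = δ • ((a + b) + δ⁻¹ • e) + (δ * (Real.exp (2 * t) - 1)) • a := by
      rw [hX, smul_add δ (a + b), smul_smul, mul_inv_cancel₀ hδ0.ne', one_smul]
      module
    rw [h3]
    rcases hexp0.eq_or_lt with h4 | h4
    · rw [← h4, sub_self, mul_zero, zero_smul, add_zero]
      exact h2
    · exact h.add_closure_mem h2 (h.closure_smul hv.fst_mem.1 (mul_pos hδ0 (by linarith)))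
  have hXC : X ∈ C := h.geodesic_mem hv.fst_mem hv.snd_mem hv.add_mem (Real.exp_pos _)
  have hYC : Y ∈ C := h.geodesic_mem hw.fst_mem hw.snd_mem hw.add_mem (Real.exp_pos _)
  have h1 : (1 + δ) • X - Y ∈ closure C := by
    have : (1 + δ) • X - Y = δ • X + (X - Y) := by module
    rw [this]
    refine subset_closure (key _ ?_)
    rw [norm_sub_rev]
    nlinarith [norm_nonneg (Y - X)]
  have h2 : (1 + δ) • Y - X ∈ closure C := by
    have : (1 + δ) • Y - X = δ • X + (1 + δ) • (Y - X) := by module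
    rw [this]
    refine subset_closure (key _ ?_)
    rwa [norm_smul, Real.norm_eq_abs, abs_of_pos (by linarith)]
  have h3 := h.hilbertDist_le hXC hYC (hv.represents t) (hw.represents t) (M := 1 + δ)
    (M' := 1 + δ) (by linarith) (by nlinarith) h1 h2
  refine h3.trans ?_
  rw [Real.log_mul (by linarith) (by linarith)]
  have h4 := Real.log_le_sub_one_of_pos (show 0 < 1 + δ by linarith)
  linarith

end IsConeOver

/-! ### Biproximal automorphisms with an axis in the cone -/

theorem tendsto_mulVec {ι : Type*} {l : Filter ι} {F : ι → Mat d} {u : ι → E d} {M : Mat d}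
    {z : E d} (hF : Tendsto F l (𝓝 M)) (hu : Tendsto u l (𝓝 z)) :
    Tendsto (fun i => F i *ᵥ u i) l (𝓝 (M *ᵥ z)) := by
  have hcont : Continuous fun p : Mat d × E d => p.1 *ᵥ p.2 :=
    continuous_fst.matrix_mulVec continuous_snd
  exact (hcont.tendsto (M, z)).comp (hF.prodMk_nhds hu)

theorem pow_mem_coneStabilizer_iff {A : GL (Fin (d + 1)) ℝ} (hA : A ∈ coneStabilizer C) (n : ℕ)
    (v : E d) : A.1 ^ n *ᵥ v ∈ C ↔ v ∈ C := by
  rw [← Units.val_pow_eq_pow_val]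
  exact pow_mem hA n v

theorem pow_inv_mulVec (A : GL (Fin (d + 1)) ℝ) (n : ℕ) (v : E d) :
    A.1 ^ n *ᵥ (A⁻¹.1 ^ n *ᵥ v) = v := by
  rw [← Units.val_pow_eq_pow_val, ← Units.val_pow_eq_pow_val, inv_pow, mulVec_inv_mulVec]

/-- `A` is an automorphism of the cone, it is proximal with attracting line `[a]`, its inverse is
proximal with attracting line `[b]`, and the line from `[a]` to `[b]` meets the cone. -/
structure IsBiproximalWith (C : Set (E d)) (A : GL (Fin (d + 1)) ℝ) (a b φ ψ : E d) (α β : ℝ) :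
    Prop where
  mem : A ∈ coneStabilizer C
  fst : IsAttracting A.1 α a φ
  snd : IsAttracting A⁻¹.1 β⁻¹ b ψ
  add_mem : a + b ∈ C
  li : LinearIndependent ℝ ![a, b]

theorem inv_mulVec_of_eigen {A : GL (Fin (d + 1)) ℝ} {μ : ℝ} {v : E d} (hμ : μ ≠ 0)
    (h : A.1 *ᵥ v = μ • v) : A⁻¹.1 *ᵥ v = μ⁻¹ • v := by
  have h1 := inv_mulVec_mulVec A v
  rw [h, Matrix.mulVec_smul] at h1
  nth_rewrite 2 [← h1]
  rw [smul_smul, inv_mul_cancel₀ hμ, one_smul]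

namespace IsBiproximalWith

variable {A : GL (Fin (d + 1)) ℝ} {a b φ ψ : E d} {α β : ℝ}

theorem symm (hA : IsBiproximalWith C A a b φ ψ α β) :
    IsBiproximalWith C A⁻¹ b a ψ φ β⁻¹ α⁻¹ := by
  refine ⟨inv_mem hA.mem, hA.snd, ?_, add_comm a b ▸ hA.add_mem, ?_⟩
  · rw [inv_inv, inv_inv]
    exact hA.fst
  · have := hA.li
    rw [LinearIndependent.pair_iff] at this ⊢
    intro s t hst
    exact (this t s (by rw [add_comm]; exact hst)).symm

theorem mulVec_snd (hA : IsBiproximalWith C A a b φ ψ α β) : A.1 *ᵥ b = β • b := by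
  have := inv_mulVec_of_eigen hA.snd.1 hA.snd.mulVec
  rwa [inv_inv, inv_inv] at this

/-- If φ(b) ≠ 0, the eigenvalues agree and the constant normalised orbit of b converges to a
multiple of a, against independence. Once φ(b) = 0, that orbit tends to zero, which compares the
moduli. -/
theorem dot_snd (hA : IsBiproximalWith C A a b φ ψ α β) : φ ⬝ᵥ b = 0 ∧ |β| < |α| := by
  have h0 : φ ⬝ᵥ b = 0 := by
    by_contra hne
    have h1 := hA.fst.vecMul b
    rw [hA.mulVec_snd, dotProduct_smul, smul_eq_mul] at h1
    have hαβ : β = α := mul_right_cancel₀ hne h1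
    have h2 : b = (φ ⬝ᵥ b) • a := by
      refine tendsto_nhds_unique (tendsto_const_nhds.congr fun n => ?_) (hA.fst.tendsto b)
      rw [pow_mulVec_of_eigen hA.mulVec_snd, hαβ, smul_smul, inv_mul_cancel₀ (pow_ne_zero n hA.fst.1),
        one_smul]
    have := LinearIndependent.pair_iff.1 hA.li (φ ⬝ᵥ b) (-1) (by rw [← h2]; module)
    simp at this
  refine ⟨h0, ?_⟩
  have h1 := hA.fst.tendsto b
  rw [h0, zero_smul] at h1
  by_contra hcon
  rw [not_lt] at hcon
  have h2 := h1.norm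
  rw [norm_zero] at h2
  have hb : 0 < ‖b‖ := norm_pos_iff.2 hA.snd.ne_zero
  have h3 : ‖b‖ ≤ 0 := by
    refine ge_of_tendsto' h2 fun n => ?_
    rw [pow_mulVec_of_eigen hA.mulVec_snd, smul_smul, norm_smul, norm_mul, norm_inv, norm_pow,
      norm_pow, Real.norm_eq_abs, Real.norm_eq_abs]
    have hα := abs_pos.2 hA.fst.1
    have : 1 ≤ (|α| ^ n)⁻¹ * |β| ^ n := by
      rw [← div_eq_inv_mul, one_le_div (pow_pos hα n)]
      gcongr
    nlinarith
  linarith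

theorem fst_mem_closure (hA : IsBiproximalWith C A a b φ ψ α β) (h : IsConeOver Ω C f) :
    a ∈ closure C := by
  -- Even powers are used because the sign of α is not yet known.
  have h1 := (hA.fst.tendsto (a + b)).comp (tendsto_id.const_mul_atTop' (show 0 < 2 by norm_num))
  rw [dotProduct_add, hA.fst.2.1, hA.dot_snd.1, add_zero, one_smul] at h1
  refine mem_closure_of_tendsto h1 (Eventually.of_forall fun n => ?_)
  have : 0 < α ^ (2 * n) := by
    rw [pow_mul]
    exact pow_pos (by have := hA.fst.1; positivity) n
  exact h.smul_mem _ ((pow_mem_coneStabilizer_iff hA.mem _ _).2 hA.add_mem) _ (inv_pos.2 this)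

theorem fst_pos (hA : IsBiproximalWith C A a b φ ψ α β) (h : IsConeOver Ω C f) : 0 < α := by
  by_contra hcon
  have hneg : α < 0 := lt_of_le_of_ne (not_lt.1 hcon) hA.fst.1
  have haC := hA.fst_mem_closure h
  have h1 := (mulVec_mem_closure_iff hA.mem).2 haC
  rw [hA.fst.mulVec] at h1
  refine h.neg_notMem_closure haC hA.fst.ne_zero ?_
  convert h.closure_smul h1 (inv_pos.2 (neg_pos.2 hneg)) using 1
  rw [smul_smul, inv_neg, neg_mul, inv_mul_cancel₀ hA.fst.1, neg_one_smul]

end IsBiproximalWith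
theorem IsConeOver.exists_sub_smul_mem (h : IsConeOver Ω C f) {v : E d} (hv : v ∈ C) (e : E d) :
    ∃ ε > 0, v - (ε : ℝ) • e ∈ C := by
  have hev : ∀ᶠ r in 𝓝 (0 : ℝ), v - r • e ∈ C :=
    (h.isOpen.preimage (f := fun r : ℝ => v - r • e) (by fun_prop)).mem_nhds (by simpa using hv)
  obtain ⟨r, hr1, hr2⟩ := ((hev.filter_mono nhdsWithin_le_nhds).and
    (self_mem_nhdsWithin (s := Ioi 0))).exists
  exact ⟨r, hr2, hr1⟩
namespace IsBiproximalWith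

variable {A : GL (Fin (d + 1)) ℝ} {a b φ ψ : E d} {α β : ℝ}

theorem tendsto_mem_closure (hA : IsBiproximalWith C A a b φ ψ α β) (h : IsConeOver Ω C f)
    {v : E d} (hv : v ∈ C) : (φ ⬝ᵥ v) • a ∈ closure C :=
  mem_closure_of_tendsto (hA.fst.tendsto v) (Eventually.of_forall fun n =>
    h.smul_mem _ ((pow_mem_coneStabilizer_iff hA.mem _ _).2 hv) _
      (inv_pos.2 (pow_pos (hA.fst_pos h) n)))

/-- The limit φ(v)a of the normalised orbit lies in the closed cone, so φ(v) ≥ 0. Applying this to v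
− εa, still in C, makes the inequality strict. -/
theorem dot_pos (hA : IsBiproximalWith C A a b φ ψ α β) (h : IsConeOver Ω C f) {v : E d}
    (hv : v ∈ C) : 0 < φ ⬝ᵥ v := by
  have hnn : ∀ v ∈ C, 0 ≤ φ ⬝ᵥ v := by
    intro v hv
    have h1 := h.closure_nonneg (hA.tendsto_mem_closure h hv)
    rw [dotProduct_smul, smul_eq_mul] at h1
    exact nonneg_of_mul_nonneg_left h1 (h.closure_pos (hA.fst_mem_closure h) hA.fst.ne_zero)
  obtain ⟨ε, hε, h1⟩ := h.exists_sub_smul_mem hv a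
  have h2 := hnn _ h1
  rw [dotProduct_sub, dotProduct_smul, hA.fst.2.1, smul_eq_mul, mul_one] at h2
  linarith

theorem dot_nonneg (hA : IsBiproximalWith C A a b φ ψ α β) (h : IsConeOver Ω C f) {v : E d}
    (hv : v ∈ closure C) : 0 ≤ φ ⬝ᵥ v :=
  closure_minimal (t := {v | 0 ≤ φ ⬝ᵥ v}) (fun _ hv => (hA.dot_pos h hv).le)
    (isClosed_le continuous_const (continuous_const.dotProduct continuous_id)) hv

theorem fst_mem (hA : IsBiproximalWith C A a b φ ψ α β) (h : IsConeOver Ω C f) :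
    a ∈ closure C \ C := by
  refine ⟨hA.fst_mem_closure h, fun haC => ?_⟩
  have := hA.symm.dot_pos h haC
  rw [hA.symm.dot_snd.1] at this
  exact lt_irrefl _ this

theorem snd_mem (hA : IsBiproximalWith C A a b φ ψ α β) (h : IsConeOver Ω C f) :
    b ∈ closure C \ C := hA.symm.fst_mem h

theorem eigen_pos (hA : IsBiproximalWith C A a b φ ψ α β) (h : IsConeOver Ω C f) :
    0 < β ∧ β < α := by
  have h1 : 0 < β := inv_pos.1 (hA.symm.fst_pos h)
  have h2 := hA.dot_snd.2
  rw [abs_of_pos h1, abs_of_pos (hA.fst_pos h)] at h2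
  exact ⟨h1, h2⟩

theorem tendsto_inv (hA : IsBiproximalWith C A a b φ ψ α β) (z : E d) :
    Tendsto (fun n : ℕ => β ^ n • (A⁻¹.1 ^ n *ᵥ z)) atTop (𝓝 ((ψ ⬝ᵥ z) • b)) := by
  refine (hA.snd.tendsto z).congr fun n => ?_
  rw [inv_pow, inv_inv]

/-- For z in ker ψ and any real t, a + b + tβⁿA⁻ⁿz is in C for large n. Applying Aⁿ and evaluating a
supporting form χ leaves χ(b) + tχ(z) > 0 for all t, whence χ(z) = 0; so ker ψ ⊆ ker χ. -/
theorem isUniqueSupport (hA : IsBiproximalWith C A a b φ ψ α β) (h : IsConeOver Ω C f) :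
    IsUniqueSupport C a ψ := by
  refine ⟨fun v hv => hA.symm.dot_pos h hv, hA.symm.dot_snd.1, fun χ hχ hχa => ?_⟩
  have hker : ∀ z, ψ ⬝ᵥ z = 0 → χ ⬝ᵥ z = 0 := by
    intro z hz
    have key : ∀ t : ℝ, 0 < χ ⬝ᵥ b + t * χ ⬝ᵥ z := by
      intro t
      have h1 := ((hA.tendsto_inv z).const_smul t).const_add (a + b)
      rw [hz, zero_smul, smul_zero, add_zero] at h1
      obtain ⟨n, hn⟩ := (h1.eventually (h.isOpen.mem_nhds hA.add_mem)).exists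
      have h2 := hχ _ ((pow_mem_coneStabilizer_iff hA.mem n _).2 hn)
      rw [Matrix.mulVec_add, Matrix.mulVec_add, pow_mulVec_of_eigen hA.fst.mulVec,
        pow_mulVec_of_eigen hA.mulVec_snd, Matrix.mulVec_smul, Matrix.mulVec_smul,
        pow_inv_mulVec] at h2
      simp only [dotProduct_add, dotProduct_smul, smul_eq_mul, hχa] at h2
      have hβ := pow_pos (hA.eigen_pos h).1 n
      nlinarith
    by_contra hne
    have := key (-(χ ⬝ᵥ b) / χ ⬝ᵥ z)
    rw [div_mul_cancel₀ _ hne] at this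
    linarith
  refine ⟨χ ⬝ᵥ b, (dotProductEquiv ℝ (Fin (d + 1))).injective (LinearMap.ext fun v => ?_)⟩
  have h1 := hker (v - (ψ ⬝ᵥ v) • b) (by
    rw [dotProduct_sub, dotProduct_smul, hA.snd.2.1, smul_eq_mul, mul_one, sub_self])
  simp only [dotProductEquiv_apply_apply, dotProduct_sub, dotProduct_smul, smul_eq_mul,
    smul_dotProduct] at h1 ⊢
  linarith

end IsBiproximalWith

theorem IsConeOver.isCompact_slice (h : IsConeOver Ω C f) :
    IsCompact {z | z ∈ closure C ∧ f ⬝ᵥ z = 1} := by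
  obtain ⟨R, hR, hb⟩ := h.closure_bound
  refine (isCompact_closedBall (0 : E d) R).of_isClosed_subset (isClosed_closure.inter
    (isClosed_eq (continuous_const.dotProduct continuous_id) continuous_const)) ?_
  rintro z ⟨hz, hz1⟩
  have := hb z hz
  rw [hz1, mul_one] at this
  simpa using this

namespace IsBiproximalWith

variable {A : GL (Fin (d + 1)) ℝ} {a b φ ψ : E d} {α β : ℝ}

/-- If `[a]` is not strongly extremal, the closed cone contains a vector in the sum of the other
characteristic subspaces. -/
theorem exists_common_zero (hA : IsBiproximalWith C A a b φ ψ α β) (h : IsConeOver Ω C f)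
    {y : E d} (hy : y ∈ closure C) (hay : a + y ∉ C) (hya : ∀ t : ℝ, y ≠ t • a) :
    ∃ z ∈ closure C, f ⬝ᵥ z = 1 ∧ φ ⬝ᵥ z = 0 ∧ ψ ⬝ᵥ z = 0 := by
  obtain ⟨hβ, hβα⟩ := hA.eigen_pos h
  have hα := hβ.trans hβα
  have haC := hA.fst_mem h
  have hbC := hA.snd_mem h
  -- If ψ(y) > 0, βⁿA⁻ⁿy approaches a positive multiple of b, so a + βⁿA⁻ⁿy enters C. Applying Aⁿ
  -- puts a positive combination of a and y, hence a + y, in C.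
  have hψy : ψ ⬝ᵥ y = 0 := by
    refine le_antisymm (not_lt.1 fun hpos => hay ?_) (hA.symm.dot_nonneg h hy)
    have h1 := (hA.tendsto_inv y).const_add a
    have h2 := h.comb_mem haC.1 hbC.1 one_pos one_pos one_pos hpos (by simpa using hA.add_mem)
    rw [one_smul] at h2
    obtain ⟨n, hn⟩ := (h1.eventually (h.isOpen.mem_nhds h2)).exists
    have h3 := (pow_mem_coneStabilizer_iff hA.mem n _).2 hn
    rw [Matrix.mulVec_add, pow_mulVec_of_eigen hA.fst.mulVec, Matrix.mulVec_smul,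
      pow_inv_mulVec] at h3
    simpa using h.comb_mem haC.1 hy (pow_pos hα n) (pow_pos hβ n) one_pos one_pos h3
  have hy0 : y ≠ 0 := fun h0 => hya 0 (by rw [h0, zero_smul])
  have hyn : ∀ n : ℕ, A⁻¹.1 ^ n *ᵥ y ∈ closure C := by
    intro n
    rw [← Units.val_pow_eq_pow_val]
    exact (mulVec_mem_closure_iff (pow_mem (inv_mem hA.mem) n)).2 hy
  have hyn0 : ∀ n : ℕ, A⁻¹.1 ^ n *ᵥ y ≠ 0 := by
    intro n
    rw [← Units.val_pow_eq_pow_val]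
    exact (mulVec_ne_zero_iff _).2 hy0
  have hfy : ∀ n : ℕ, 0 < f ⬝ᵥ (A⁻¹.1 ^ n *ᵥ y) := fun n => h.closure_pos (hyn n) (hyn0 n)
  obtain ⟨u, hu⟩ : ∃ u : ℕ → E d, ∀ n, u n = (f ⬝ᵥ (A⁻¹.1 ^ n *ᵥ y))⁻¹ • (A⁻¹.1 ^ n *ᵥ y) :=
    ⟨_, fun _ => rfl⟩
  have hu1 : ∀ n, u n ∈ {z | z ∈ closure C ∧ f ⬝ᵥ z = 1} := fun n =>
    ⟨by rw [hu]; exact h.closure_smul (hyn n) (inv_pos.2 (hfy n)), by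
      rw [hu, dotProduct_smul, smul_eq_mul, inv_mul_cancel₀ (hfy n).ne']⟩
  have huψ : ∀ n, ψ ⬝ᵥ u n = 0 := by
    intro n
    have : ∀ n : ℕ, ψ ⬝ᵥ (A⁻¹.1 ^ n *ᵥ y) = 0 := by
      intro n
      induction n with
      | zero => simpa using hψy
      | succ n ih => rw [pow_succ', ← Matrix.mulVec_mulVec, hA.snd.vecMul, ih, mul_zero]
    rw [hu, dotProduct_smul, this, smul_zero]
  obtain ⟨z, hz, k, hk, hlim⟩ := h.isCompact_slice.tendsto_subseq hu1
  refine ⟨z, hz.1, hz.2, ?_, ?_⟩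
  -- The normalised powers of A bring the points u(k(n)) back to the line of y, while converging to
  -- φ(z)a. As y is not a multiple of a, φ(z) = 0.
  · have h1 := tendsto_mulVec (hA.fst.2.2.comp hk.tendsto_atTop) hlim
    rw [vecMulVec_mulVec'] at h1
    have hcl : IsClosed (Submodule.span ℝ {y} : Set (E d)) :=
      Submodule.closed_of_finiteDimensional _
    have h2 : (φ ⬝ᵥ z) • a ∈ Submodule.span ℝ {y} := by
      refine hcl.mem_of_tendsto h1 (Eventually.of_forall fun n => ?_)
      rw [SetLike.mem_coe, Function.comp_apply, Function.comp_apply, hu, Matrix.mulVec_smul, Matrix.smul_mulVec, pow_inv_mulVec]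
      exact Submodule.smul_mem _ _ (Submodule.smul_mem _ _ (Submodule.mem_span_singleton_self y))
    obtain ⟨c, hc⟩ := Submodule.mem_span_singleton.1 h2
    by_contra hne
    have hc0 : c ≠ 0 := by
      rintro rfl
      rw [zero_smul] at hc
      exact (smul_ne_zero hne hA.fst.ne_zero) hc.symm
    refine hya (c⁻¹ * (φ ⬝ᵥ z)) ?_
    rw [mul_smul, ← hc, smul_smul, inv_mul_cancel₀ hc0, one_smul]
  · have h1 : Tendsto (fun n => ψ ⬝ᵥ u (k n)) atTop (𝓝 (ψ ⬝ᵥ z)) :=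
      ((continuous_const.dotProduct continuous_id).tendsto z).comp hlim
    exact tendsto_nhds_unique h1 (tendsto_const_nhds.congr fun n => (huψ _).symm)

/-- A common zero z of φ and ψ has a + z ∈ ker ψ and b + z ∈ ker φ, so neither sum is in C,
contradicting `hloc`. -/
theorem coneExtremal (hA : IsBiproximalWith C A a b φ ψ α β) (h : IsConeOver Ω C f)
    (hloc : ∀ z ∈ closure C, f ⬝ᵥ z = 1 → a + z ∈ C ∨ b + z ∈ C) : ConeExtremal C a := by
  intro y hy hay
  by_contra hcon
  push Not at hcon
  obtain ⟨z, hz, hz1, hφ, hψ⟩ := hA.exists_common_zero h hy hay hcon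
  rcases hloc z hz hz1 with h1 | h1
  · have := hA.symm.dot_pos h h1
    rw [dotProduct_add, hψ, hA.symm.dot_snd.1, add_zero] at this
    exact lt_irrefl _ this
  · have := hA.dot_pos h h1
    rw [dotProduct_add, hφ, hA.dot_snd.1, add_zero] at this
    exact lt_irrefl _ this

end IsBiproximalWith

/-- Near a geodesic with a strongly extremal endpoint, no boundary point is joined to both endpoints
by segments of the boundary. -/
theorem IsConeOver.eventually_forall_mem (h : IsConeOver Ω C f) {a b : E d}
    (ha : a ∈ closure C \ C) (hb : b ∈ closure C \ C) (hab : a + b ∈ C)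
    (hext : ConeExtremal C a) :
    ∀ᶠ p : E d × E d in 𝓝 (a, b), (∀ z ∈ closure C, f ⬝ᵥ z = 1 → p.1 + z ∈ C ∨ p.2 + z ∈ C) ∧
      p.1 + p.2 ∈ C ∧ LinearIndependent ℝ ![p.1, p.2] := by
  refine Filter.Eventually.and ?_ (Filter.Eventually.and ?_ ?_)
  · have h1 : ∀ᶠ p : E d × E d in 𝓝 (a, b), ∀ z ∈ {z | z ∈ closure C ∧ f ⬝ᵥ z = 1},
        p.1 + z ∈ C ∨ p.2 + z ∈ C := by
      refine h.isCompact_slice.eventually_forall_of_forall_eventually fun z hz => ?_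
      have hor : a + z ∈ C ∨ b + z ∈ C := by
        by_contra hcon
        rw [not_or] at hcon
        -- Extremality leaves only z on the ray of a, and then b + z lies on the open geodesic.
        obtain ⟨t, rfl⟩ := hext z hz.1 hcon.1
        have ht : 0 < t := by
          have h2 := hz.2
          rw [dotProduct_smul, smul_eq_mul] at h2
          exact pos_of_mul_pos_left (by rw [h2]; exact one_pos) (h.closure_nonneg ha.1)
        exact hcon.2 (h.geodesic_mem ha hb hab ht)
      rcases hor with h2 | h2
      · have hc : Continuous fun q : (E d × E d) × E d => q.1.1 + q.2 := by fun_prop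
        exact ((hc.tendsto ((a, b), z)).eventually (h.isOpen.mem_nhds h2)).mono fun _ => Or.inl
      · have hc : Continuous fun q : (E d × E d) × E d => q.1.2 + q.2 := by fun_prop
        exact ((hc.tendsto ((a, b), z)).eventually (h.isOpen.mem_nhds h2)).mono fun _ => Or.inr
    exact h1.mono fun p hp z hz hz1 => hp z ⟨hz, hz1⟩
  · have hc : Continuous fun p : E d × E d => p.1 + p.2 := by fun_prop
    exact (hc.tendsto (a, b)).eventually (h.isOpen.mem_nhds hab)
  · have hc : Continuous fun p : E d × E d => ![p.1, p.2] := by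
      refine continuous_pi fun i => ?_
      fin_cases i
      · exact continuous_fst
      · exact continuous_snd
    exact (hc.tendsto (a, b)).eventually
      (isOpen_setOfPred_linearIndependent.mem_nhds (h.linearIndependent ha hb hab))

/-- Extremality of a alone suffices for both nearby endpoints, because the open condition derived
from it is symmetric in the two vectors. -/
theorem IsConeOver.eventually_biproximal (h : IsConeOver Ω C f) {a b : E d}
    (ha : a ∈ closure C \ C) (hb : b ∈ closure C \ C) (hab : a + b ∈ C)
    (hext : ConeExtremal C a) :
    ∃ ε > 0, ∀ a' b', ‖a' - a‖ < ε → ‖b' - b‖ < ε → ∀ A ∈ coneStabilizer C, ∀ φ ψ α β,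
      IsAttracting A.1 α a' φ → IsAttracting A⁻¹.1 β⁻¹ b' ψ →
        IsBiproximalWith C A a' b' φ ψ α β ∧ ConeExtremal C a' ∧ ConeExtremal C b' := by
  obtain ⟨ε, hε, hball⟩ := Metric.eventually_nhds_iff.1 (h.eventually_forall_mem ha hb hab hext)
  refine ⟨ε, hε, fun a' b' ha' hb' A hA φ ψ α β h1 h2 => ?_⟩
  obtain ⟨h3, h4, h5⟩ := hball (y := (a', b')) (by
    rw [Prod.dist_eq, dist_eq_norm, dist_eq_norm]; exact max_lt ha' hb')
  have h6 : IsBiproximalWith C A a' b' φ ψ α β := ⟨hA, h1, h2, h4, h5⟩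
  exact ⟨h6, h6.coneExtremal h h3, h6.symm.coneExtremal h fun z hz hz1 => (h3 z hz hz1).symm⟩

/-! ### Axes, translations and rank-one periodicity -/

theorem T1.IsGeodesic.mulVec {v v' : T1 Ω} {a b : E d} (hv : v.IsGeodesic C a b)
    {A : GL (Fin (d + 1)) ℝ} (hA : A ∈ coneStabilizer C)
    (hv' : ∀ t, Matrix.ProjGenLinGroup.mk A • v.curve t = v'.curve t) :
    v'.IsGeodesic C (A.1 *ᵥ a) (A.1 *ᵥ b) := by
  have hbd : ∀ x ∈ closure C \ C, A.1 *ᵥ x ∈ closure C \ C := fun x hx =>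
    ⟨(mulVec_mem_closure_iff hA).2 hx.1, fun h1 => hx.2 ((hA x).1 h1)⟩
  refine ⟨hbd a hv.fst_mem, hbd b hv.snd_mem, ?_, fun t => ?_⟩
  · rw [← Matrix.mulVec_add]
    exact (hA _).2 hv.add_mem
  · rw [← hv' t]
    convert (hv.represents t).mk_smul A using 1
    rw [Matrix.mulVec_add, Matrix.mulVec_smul]

/-- A multiplies the coordinate e^{2t} by α/β, which is a translation of length half of log(α/β). -/
theorem T1.IsGeodesic.smul_curve {v : T1 Ω} {a b : E d} (hv : v.IsGeodesic C a b)
    {A : GL (Fin (d + 1)) ℝ} {α β : ℝ} (hβ : 0 < β) (hβα : β < α) (ha : A.1 *ᵥ a = α • a)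
    (hb : A.1 *ᵥ b = β • b) (t : ℝ) :
    Matrix.ProjGenLinGroup.mk A • v.curve t = v.curve (t + Real.log (α / β) / 2) := by
  have hα := hβ.trans hβα
  refine ((hv.represents t).mk_smul A).unique ?_
  convert (hv.represents (t + Real.log (α / β) / 2)).smul hβ.ne' using 1
  rw [Matrix.mulVec_add, Matrix.mulVec_smul, ha, hb, mul_add, mul_div_cancel₀ _ two_ne_zero,
    Real.exp_add, Real.exp_log (by positivity), smul_add, smul_smul, smul_smul]
  congr 2
  field_simp

/-- The two endpoints are smooth and strongly extremal, in terms of the cone. -/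
structure HasRankOneEnds (C : Set (E d)) (a b : E d) : Prop where
  fst_support : ∃ ψ, IsUniqueSupport C a ψ
  snd_support : ∃ φ, IsUniqueSupport C b φ
  fst_extremal : ConeExtremal C a
  snd_extremal : ConeExtremal C b

theorem HasRankOneEnds.mulVec {a b : E d} (hab : HasRankOneEnds C a b)
    {A : GL (Fin (d + 1)) ℝ} (hA : A ∈ coneStabilizer C) :
    HasRankOneEnds C (A.1 *ᵥ a) (A.1 *ᵥ b) := by
  obtain ⟨⟨ψ, hψ⟩, ⟨φ, hφ⟩, ha, hb⟩ := hab
  exact ⟨⟨_, hψ.mulVec hA⟩, ⟨_, hφ.mulVec hA⟩, ha.mulVec hA, hb.mulVec hA⟩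

/-- The vectors tangent to the axis of an automorphism are rank-one periodic as soon as the endpoints
of the axis are smooth and strongly extremal. -/
theorem IsConeOver.isRankOnePeriodic (h : IsConeOver Ω C f) {Γ : Subgroup (PGLV d)}
    (hΓ : Γ ≤ Aut Ω) {A : GL (Fin (d + 1)) ℝ} (hAΓ : Matrix.ProjGenLinGroup.mk A ∈ Γ) {v : T1 Ω}
    {a b : E d} (hv : v.IsGeodesic C a b) {α β : ℝ} (hβ : 0 < β) (hβα : β < α)
    (ha : A.1 *ᵥ a = α • a) (hb : A.1 *ᵥ b = β • b) (hends : HasRankOneEnds C a b) :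
    (v.proj Γ).IsRankOnePeriodic := by
  refine ⟨⟨Real.log (α / β) / 2, ?_, ?_⟩, fun v' hv' => ?_⟩
  · have : 0 < Real.log (α / β) := Real.log_pos ((one_lt_div hβ).2 hβα)
    positivity
  · refine Quotient.sound ⟨(Matrix.ProjGenLinGroup.mk A)⁻¹, Γ.inv_mem hAΓ, fun t => ?_⟩
    rw [inv_smul_eq_iff, hv.smul_curve hβ hβα ha hb]
    rfl
  -- Any other lift is a translate by Γ, and automorphisms of the cone transport smoothness and
  -- extremality.
  · obtain ⟨γ, hγ, hγv⟩ : ∃ γ ∈ Γ, ∀ t, γ • v.curve t = v'.curve t := Quotient.exact hv'.symm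
    obtain ⟨B, hB, rfl⟩ := h.exists_lift (hΓ hγ)
    have hg := hv.mulVec hB hγv
    have he := hends.mulVec hB
    have h1 := represents_mk hg.fst_ne_zero
    have h2 := represents_mk hg.snd_ne_zero
    exact ⟨⟨_, hg.hasForwardEndpoint h1, (h.isSmoothPoint_iff h1 hg.fst_mem).2 he.fst_support,
        (h.isStronglyExtremal_iff h1 hg.fst_mem).2 he.fst_extremal⟩,
      ⟨_, hg.hasBackwardEndpoint h2, (h.isSmoothPoint_iff h2 hg.snd_mem).2 he.snd_support,
        (h.isStronglyExtremal_iff h2 hg.snd_mem).2 he.snd_extremal⟩⟩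

theorem not_isOfFinOrder_of_translates {g : PGLV d} {v : T1 Ω} {s : ℝ} (hs : s ≠ 0)
    (hg : ∀ t, g • v.curve t = v.curve (t + s)) : ¬ IsOfFinOrder g := by
  intro hfin
  obtain ⟨n, hn, hgn⟩ := isOfFinOrder_iff_pow_eq_one.1 hfin
  have key : ∀ m : ℕ, g ^ m • v.curve 0 = v.curve (m * s) := by
    intro m
    induction m with
    | zero => simp
    | succ m ih =>
      rw [pow_succ', mul_smul, ih, hg]
      congr 1
      push_cast
      ring
  have h1 := key n
  rw [hgn, one_smul] at h1
  have h2 := v.isometric 0 (n * s)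
  have h3 := v.isometric 0 0
  rw [← h1, h3, sub_self, abs_zero, eq_comm, abs_eq_zero, zero_sub, neg_eq_zero, mul_eq_zero] at h2
  rcases h2 with h2 | h2
  · exact hn.ne' (by exact_mod_cast h2)
  · exact hs h2

theorem IsBiproximalWith.hasRankOneEnds {A : GL (Fin (d + 1)) ℝ} {a b φ ψ : E d} {α β : ℝ}
    (hA : IsBiproximalWith C A a b φ ψ α β) (h : IsConeOver Ω C f) (ha : ConeExtremal C a)
    (hb : ConeExtremal C b) : HasRankOneEnds C a b :=
  ⟨⟨ψ, hA.isUniqueSupport h⟩, ⟨φ, hA.symm.isUniqueSupport h⟩, ha, hb⟩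

theorem IsConeOver.isRankOneAut (h : IsConeOver Ω C f) {A : GL (Fin (d + 1)) ℝ}
    {a b φ ψ : E d} {α β : ℝ} (hA : IsBiproximalWith C A a b φ ψ α β)
    (hAut : Matrix.ProjGenLinGroup.mk A ∈ Aut Ω) (ha : ConeExtremal C a)
    (hb : ConeExtremal C b) : IsRankOneAut Ω (Matrix.ProjGenLinGroup.mk A) := by
  obtain ⟨v, hv⟩ := h.exists_isGeodesic_of_boundary (hA.fst_mem h) (hA.snd_mem h) hA.add_mem
  obtain ⟨hβ, hβα⟩ := hA.eigen_pos h
  have htr := hv.smul_curve hβ hβα hA.fst.mulVec hA.mulVec_snd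
  have hlog : 0 < Real.log (α / β) := Real.log_pos ((one_lt_div hβ).2 hβα)
  exact ⟨Subgroup.mem_zpowers _, not_isOfFinOrder_of_translates (by positivity) htr, v,
    h.isRankOnePeriodic ((Subgroup.zpowers_le).2 hAut) (Subgroup.mem_zpowers _) hv hβ hβα
      hA.fst.mulVec hA.mulVec_snd (hA.hasRankOneEnds h ha hb), _, htr⟩

/-- The line contains some sa + tb in C. Both coefficients are positive, since otherwise a boundary
vector would lie in C, and all positive combinations are then in C. -/
theorem IsConeOver.add_mem_of_geod (h : IsConeOver Ω C f) {ξ η : P d} (hξη : (ξ, η) ∈ Geod Ω)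
    {a b : E d} (ha : a ∈ closure C \ C) (hb : b ∈ closure C \ C) (haξ : Represents a ξ)
    (hbη : Represents b η) : a + b ∈ C := by
  obtain ⟨-, -, -, x, hx, hle⟩ := hξη
  obtain ⟨v, hv, hvx⟩ := h.exists_represents_of_mem hx
  have h1 := hvx.submodule_le.1 hle
  rw [haξ.submodule_eq, hbη.submodule_eq, ← Submodule.span_insert, Submodule.mem_span_pair] at h1
  obtain ⟨s, t, rfl⟩ := h1
  have key : ∀ a b : E d, a ∈ closure C \ C → b ∈ closure C \ C → ∀ s t : ℝ,
      s • a + t • b ∈ C → 0 < s := by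
    intro a b ha hb s t hst
    by_contra hs
    have h1 : t • b ∈ C := by
      rcases (not_lt.1 hs).eq_or_lt with rfl | hs
      · simpa using hst
      · convert h.add_closure_mem hst (h.closure_smul ha.1 (neg_pos.2 hs)) using 1
        module
    have h2 := h.pos _ h1
    rw [dotProduct_smul, smul_eq_mul] at h2
    exact hb.2 ((h.smul_mem_iff (pos_of_mul_pos_left h2 (h.closure_nonneg hb.1))).1 h1)
  simpa using h.comb_mem ha.1 hb.1 (key a b ha hb s t hv)
    (key b a hb ha t s (by rwa [add_comm])) one_pos one_pos hv

theorem exists_isAttracting_of_represents {A : GL (Fin (d + 1)) ℝ} {x : P d} {w : E d}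
    (hx : IsAttractingFixedPoint (Matrix.ProjGenLinGroup.mk A) x) (hw : Represents w x) :
    ∃ μ φ, IsAttracting A.1 μ w φ := by
  obtain ⟨μ, v, φ, h1, h2⟩ := isAttractingFixedPoint_mk_iff.1 hx
  obtain ⟨c, hc, rfl⟩ := h2.exists_smul hw
  exact ⟨μ, _, h1.smul_vec hc⟩

theorem exists_nhds_isRankOneAut (hΩ : IsProperlyConvexOpen Ω) {ξ η : P d}
    (hξη : (ξ, η) ∈ Geod Ω) (hξ : IsStronglyExtremal Ω ξ) :
    ∃ U ∈ 𝓝 ξ, ∃ W ∈ 𝓝 η, ∀ g ∈ Aut Ω, ∀ x y : P d, IsAttractingFixedPoint g x →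
      IsRepellingFixedPoint g y → x ∈ U → y ∈ W → IsRankOneAut Ω g := by
  obtain ⟨C, f, h⟩ := exists_isConeOver hΩ
  obtain ⟨a, ha, haξ⟩ := h.exists_represents_of_mem_frontier hξη.1
  obtain ⟨b, hb, hbη⟩ := h.exists_represents_of_mem_frontier hξη.2.1
  have hab := h.add_mem_of_geod hξη ha hb haξ hbη
  obtain ⟨ε, hε, hloc⟩ := h.eventually_biproximal ha hb hab
    ((h.isStronglyExtremal_iff haξ ha).1 hξ)
  refine ⟨_, represents_near_mem_nhds haξ hε, _, represents_near_mem_nhds hbη hε, ?_⟩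
  rintro g hg x y hx hy ⟨a', ha', haε⟩ ⟨b', hb', hbε⟩
  obtain ⟨A, hA, rfl⟩ := h.exists_lift hg
  obtain ⟨α, φ, h1⟩ := exists_isAttracting_of_represents hx ha'
  rw [IsRepellingFixedPoint, ← map_inv] at hy
  obtain ⟨β, ψ, h2⟩ := exists_isAttracting_of_represents hy hb'
  obtain ⟨h3, h4, h5⟩ := hloc a' b' haε hbε A hA φ ψ α β⁻¹ h1 (by rwa [inv_inv])
  exact h.isRankOneAut h3 hg h4 h5

/-! ### Rank-one periodic vectors come from biproximal elements -/

/-- A linear map which translates a projective line with fixed points `[a]` and `[b]`. -/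
theorem eigen_of_translation {A : Mat d} {a b : E d} (hli : LinearIndependent ℝ ![a, b]) {k : ℝ}
    (hk : k ≠ 0) (h : ∀ x : ℝ, 0 < x → ∃ c : ℝ, A *ᵥ (b + x • a) = c • (b + (k * x) • a)) :
    ∃ c : ℝ, A *ᵥ a = (c * k) • a ∧ A *ᵥ b = c • b := by
  -- Two points determine A on the plane; the third forces the two scalars to agree.
  obtain ⟨c₁, h1⟩ := h 1 one_pos
  obtain ⟨c₂, h2⟩ := h 2 two_pos
  obtain ⟨c₃, h3⟩ := h 3 three_pos
  simp only [Matrix.mulVec_add, Matrix.mulVec_smul] at h1 h2 h3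
  have ha : A *ᵥ a = c₂ • (b + (k * 2) • a) - c₁ • (b + (k * 1) • a) := by
    rw [← h1, ← h2]; module
  have hb : A *ᵥ b = (2 * c₁) • (b + (k * 1) • a) - c₂ • (b + (k * 2) • a) := by
    rw [mul_smul, ← h1, ← h2]; module
  rw [ha, hb] at h3
  have h4 := LinearIndependent.pair_iff.1 hli (k * (4 * c₂ - c₁ - 3 * c₃)) (2 * c₂ - c₁ - c₃) (by
    have h5 := sub_eq_zero.2 h3
    rw [← h5]
    module)
  have h5 : 4 * c₂ - c₁ - 3 * c₃ = 0 := (mul_eq_zero.1 h4.1).resolve_left hk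
  have h6 : c₂ = c₁ := by linarith [h4.2]
  subst h6
  exact ⟨c₂, by rw [ha]; module, by rw [hb]; module⟩

/-- The pullback of ψ by A also supports C at a, so uniqueness makes it proportional to ψ; the
factor is read off at b, where ψ(b) = ψ(a + b) > 0. -/
theorem dotProduct_mulVec_eq_of_support {A : GL (Fin (d + 1)) ℝ} (hA : A ∈ coneStabilizer C)
    {a b ψ : E d} {α β : ℝ} (hψ : IsUniqueSupport C a ψ) (hab : a + b ∈ C)
    (ha : A.1 *ᵥ a = α • a) (hb : A.1 *ᵥ b = β • b) (z : E d) :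
    ψ ⬝ᵥ (A.1 *ᵥ z) = β * (ψ ⬝ᵥ z) := by
  obtain ⟨c, hc⟩ := hψ.2.2 (ψ ᵥ* A.1)
    (fun v hv => by rw [← Matrix.dotProduct_mulVec]; exact hψ.1 _ ((hA v).2 hv))
    (by rw [← Matrix.dotProduct_mulVec, ha, dotProduct_smul, hψ.2.1, smul_zero])
  have h1 : ∀ z, ψ ⬝ᵥ (A.1 *ᵥ z) = c * (ψ ⬝ᵥ z) := fun z => by
    rw [Matrix.dotProduct_mulVec, hc, smul_dotProduct, smul_eq_mul]
  have h2 : ψ ⬝ᵥ b ≠ 0 := by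
    have := hψ.1 _ hab
    rw [dotProduct_add, hψ.2.1, zero_add] at this
    exact this.ne'
  have h3 := h1 b
  rw [hb, dotProduct_smul, smul_eq_mul] at h3
  rw [h1, mul_right_cancel₀ h2 h3]

/-- Along the normalised orbit φ is constant and ψ tends to zero. A limit point z in the compact
slice has ψ(z) = 0, so a + z is not in C and extremality puts z on the ray of a; the constant value
of φ then fixes the scale. -/
theorem IsConeOver.tendsto_of_extremal (h : IsConeOver Ω C f) {A : GL (Fin (d + 1)) ℝ}
    (hA : A ∈ coneStabilizer C) {a φ ψ : E d} {α β : ℝ} (ha : a ∈ closure C \ C) (ha0 : a ≠ 0)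
    (hβ : 0 < β) (hβα : β < α) (hψ : ∀ v ∈ C, 0 < ψ ⬝ᵥ v) (hψa : ψ ⬝ᵥ a = 0)
    (hφ : ∀ v ∈ C, 0 < φ ⬝ᵥ v) (hφa : φ ⬝ᵥ a = 1)
    (hφA : ∀ z, φ ⬝ᵥ (A.1 *ᵥ z) = α * (φ ⬝ᵥ z)) (hψA : ∀ z, ψ ⬝ᵥ (A.1 *ᵥ z) = β * (ψ ⬝ᵥ z))
    (hext : ConeExtremal C a) {y : E d} (hy : y ∈ C) :
    Tendsto (fun n : ℕ => (α ^ n)⁻¹ • (A.1 ^ n *ᵥ y)) atTop (𝓝 ((φ ⬝ᵥ y) • a)) := by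
  have hα := hβ.trans hβα
  have hpow : ∀ (θ : E d) (μ : ℝ), (∀ z, θ ⬝ᵥ (A.1 *ᵥ z) = μ * (θ ⬝ᵥ z)) → ∀ n : ℕ,
      θ ⬝ᵥ (A.1 ^ n *ᵥ y) = μ ^ n * (θ ⬝ᵥ y) := by
    intro θ μ hθ n
    induction n with
    | zero => simp
    | succ n ih => rw [pow_succ', ← Matrix.mulVec_mulVec, hθ, ih, pow_succ']; ring
  obtain ⟨u, hu⟩ : ∃ u : ℕ → E d, ∀ n, u n = (α ^ n)⁻¹ • (A.1 ^ n *ᵥ y) := ⟨_, fun _ => rfl⟩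
  have huC : ∀ n, u n ∈ C := fun n => by
    rw [hu]
    exact h.smul_mem _ ((pow_mem_coneStabilizer_iff hA n y).2 hy) _ (inv_pos.2 (pow_pos hα n))
  have huφ : ∀ n, φ ⬝ᵥ u n = φ ⬝ᵥ y := fun n => by
    rw [hu, dotProduct_smul, hpow φ α hφA, smul_eq_mul, ← mul_assoc,
      inv_mul_cancel₀ (pow_ne_zero n hα.ne'), one_mul]
  have huψ : ∀ n, ψ ⬝ᵥ u n = (β / α) ^ n * (ψ ⬝ᵥ y) := fun n => by
    rw [hu, dotProduct_smul, hpow ψ β hψA, smul_eq_mul, ← mul_assoc, div_pow, div_eq_inv_mul]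
  have hfu : ∀ n, 0 < f ⬝ᵥ u n := fun n => h.pos _ (huC n)
  obtain ⟨p, hp⟩ : ∃ p : ℕ → E d, ∀ n, p n = (f ⬝ᵥ u n)⁻¹ • u n := ⟨_, fun _ => rfl⟩
  have hpK : ∀ n, p n ∈ {z | z ∈ closure C ∧ f ⬝ᵥ z = 1} := fun n => by
    rw [hp]
    refine ⟨subset_closure (h.smul_mem _ (huC n) _ (inv_pos.2 (hfu n))), ?_⟩
    rw [dotProduct_smul, smul_eq_mul, inv_mul_cancel₀ (hfu n).ne']
  -- As φ·u n is a positive constant, u n stays away from zero and so does f·u n; hence ψ still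
  -- tends to zero after rescaling to the slice.
  obtain ⟨m, hm, hmu⟩ : ∃ m > 0, ∀ n, m ≤ f ⬝ᵥ u n := by
    obtain ⟨R, hR, hb⟩ := h.bound
    refine ⟨φ ⬝ᵥ y / ((d + 1) * (‖φ‖ + 1) * R), ?_, fun n => ?_⟩
    · have := hφ y hy
      positivity
    · rw [div_le_iff₀ (by positivity), ← huφ n]
      calc φ ⬝ᵥ u n ≤ (d + 1) * (‖φ‖ * ‖u n‖) := (le_abs_self _).trans (abs_dotProduct_le _ _)
        _ ≤ (d + 1) * ((‖φ‖ + 1) * (R * (f ⬝ᵥ u n))) := by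
          gcongr
          · linarith
          · exact hb _ (huC n)
        _ = f ⬝ᵥ u n * ((d + 1) * (‖φ‖ + 1) * R) := by ring
  have hpψ : Tendsto (fun n => ψ ⬝ᵥ p n) atTop (𝓝 0) := by
    have h1 : Tendsto (fun n : ℕ => m⁻¹ * ((β / α) ^ n * (ψ ⬝ᵥ y))) atTop (𝓝 0) := by
      have := (tendsto_pow_atTop_nhds_zero_of_lt_one (r := β / α) (by positivity)
        ((div_lt_one hα).2 hβα)).mul_const (ψ ⬝ᵥ y)
      simpa using this.const_mul m⁻¹
    refine squeeze_zero (fun n => ?_) (fun n => ?_) h1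
    · rw [hp, dotProduct_smul, smul_eq_mul]
      have := hψ _ (huC n)
      have := hfu n
      positivity
    · rw [hp, dotProduct_smul, smul_eq_mul, huψ]
      have := hψ y hy
      gcongr
      exact hmu n
  have hfa := h.closure_pos ha.1 ha0
  have hpa : Tendsto p atTop (𝓝 ((f ⬝ᵥ a)⁻¹ • a)) := by
    refine h.isCompact_slice.tendsto_nhds_of_unique_mapClusterPt (Eventually.of_forall hpK) ?_
    intro z hz hcl
    have hψz : ψ ⬝ᵥ z = 0 := by
      have hc : Continuous fun z : E d => ψ ⬝ᵥ z := continuous_const.dotProduct continuous_id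
      have h1 : ClusterPt (ψ ⬝ᵥ z) (𝓝 0) :=
        (hcl.continuousAt_comp hc.continuousAt).clusterPt.mono hpψ
      exact eq_of_nhds_neBot h1
    obtain ⟨t, rfl⟩ := hext z hz.1 fun h1 => by
      have := hψ _ h1
      rw [dotProduct_add, hψa, hψz, add_zero] at this
      exact lt_irrefl _ this
    have h2 := hz.2
    rw [dotProduct_smul, smul_eq_mul] at h2
    rw [eq_inv_of_mul_eq_one_left h2]
  have hpφ : Tendsto (fun n => φ ⬝ᵥ p n) atTop (𝓝 (f ⬝ᵥ a)⁻¹) := by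
    have hc : Continuous fun z : E d => φ ⬝ᵥ z := continuous_const.dotProduct continuous_id
    have := (hc.tendsto _).comp hpa
    rwa [dotProduct_smul, hφa, smul_eq_mul, mul_one] at this
  have hlim := ((hpφ.inv₀ (inv_ne_zero hfa.ne')).const_mul (φ ⬝ᵥ y)).smul hpa
  rw [inv_inv, smul_smul, mul_assoc, mul_inv_cancel₀ hfa.ne', mul_one] at hlim
  refine hlim.congr fun n => ?_
  have hφy := hφ y hy
  have hfn := (hfu n).ne'
  rw [← hu, hp, dotProduct_smul, huφ, smul_eq_mul, smul_smul]
  rw [show φ ⬝ᵥ y * ((f ⬝ᵥ u n)⁻¹ * φ ⬝ᵥ y)⁻¹ * (f ⬝ᵥ u n)⁻¹ = 1 by field_simp, one_smul]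

/-- Convergence on C extends to all of V by writing εz as the difference of a + b and a + b − εz,
both in C for small ε. -/
theorem IsConeOver.isAttracting_of_extremal (h : IsConeOver Ω C f) {A : GL (Fin (d + 1)) ℝ}
    (hA : A ∈ coneStabilizer C) {a b : E d} {α β : ℝ} (hab : a + b ∈ C)
    (ha : a ∈ closure C \ C) (hb : b ∈ closure C \ C) (hβ : 0 < β) (hβα : β < α)
    (hAa : A.1 *ᵥ a = α • a) (hAb : A.1 *ᵥ b = β • b) (hends : HasRankOneEnds C a b) :
    ∃ φ, IsAttracting A.1 α a φ := by
  obtain ⟨⟨ψ, hψ⟩, ⟨φ₀, hφ₀⟩, hext, -⟩ := hends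
  have hφa : 0 < φ₀ ⬝ᵥ a := by
    have := hφ₀.1 _ hab
    rwa [dotProduct_add, hφ₀.2.1, add_zero] at this
  have hφA := dotProduct_mulVec_eq_of_support hA hφ₀ (add_comm a b ▸ hab) hAb hAa
  have hψA := dotProduct_mulVec_eq_of_support hA hψ hab hAa hAb
  set φ := (φ₀ ⬝ᵥ a)⁻¹ • φ₀ with hφ
  have hφ1 : φ ⬝ᵥ a = 1 := by rw [hφ, smul_dotProduct, smul_eq_mul, inv_mul_cancel₀ hφa.ne']
  have key : ∀ y ∈ C, Tendsto (fun n : ℕ => (α ^ n)⁻¹ • (A.1 ^ n *ᵥ y)) atTop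
      (𝓝 ((φ ⬝ᵥ y) • a)) := fun y hy =>
    h.tendsto_of_extremal hA ha (boundary_ne_zero hb hab) hβ hβα hψ.1 hψ.2.1
      (fun v hv => by
        rw [hφ, smul_dotProduct, smul_eq_mul]
        exact mul_pos (inv_pos.2 hφa) (hφ₀.1 v hv)) hφ1
      (fun z => by rw [hφ, smul_dotProduct, smul_dotProduct, hφA, smul_eq_mul, smul_eq_mul]; ring)
      hψA hext hy
  refine ⟨φ, (hβ.trans hβα).ne', hφ1, tendsto_matrix_iff.2 fun z => ?_⟩
  rw [vecMulVec_mulVec']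
  obtain ⟨ε, hε, hz⟩ := h.exists_sub_smul_mem hab z
  have h1 := ((key _ hab).sub (key _ hz)).const_smul ε⁻¹
  convert h1 using 2
  · rw [← smul_sub, ← Matrix.mulVec_sub, sub_sub_cancel, Matrix.mulVec_smul, smul_comm _ ε,
      smul_smul, inv_mul_cancel₀ hε.ne', one_smul, Matrix.smul_mulVec]
  · rw [← sub_smul, ← dotProduct_sub, sub_sub_cancel, dotProduct_smul, smul_smul, smul_eq_mul,
      ← mul_assoc, inv_mul_cancel₀ hε.ne', one_mul]

theorem T1.HasForwardEndpoint.unique {v : T1 Ω} {ξ ξ' : P d} (h : v.HasForwardEndpoint ξ)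
    (h' : v.HasForwardEndpoint ξ') : ξ = ξ' := tendsto_nhds_unique h h'

theorem T1.HasBackwardEndpoint.unique {v : T1 Ω} {ξ ξ' : P d} (h : v.HasBackwardEndpoint ξ)
    (h' : v.HasBackwardEndpoint ξ') : ξ = ξ' := tendsto_nhds_unique h h'

/-- A rank-one periodic vector is tangent to the axis of a biproximal element. -/
theorem IsConeOver.exists_isBiproximalWith (h : IsConeOver Ω C f) {Γ : Subgroup (PGLV d)}
    (hΓ : Γ ≤ Aut Ω) {v : T1 Ω} {a b : E d} (hv : v.IsGeodesic C a b)
    (hper : (v.proj Γ).IsRankOnePeriodic) :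
    HasRankOneEnds C a b ∧ ∃ A φ ψ α β, Matrix.ProjGenLinGroup.mk A ∈ Γ ∧
      IsBiproximalWith C A a b φ ψ α β := by
  obtain ⟨⟨s, hs, hflow⟩, hlift⟩ := hper
  obtain ⟨⟨ξ, hξ, hξs, hξe⟩, ⟨η, hη, hηs, hηe⟩⟩ := hlift v rfl
  have hra := represents_mk hv.fst_ne_zero
  have hrb := represents_mk hv.snd_ne_zero
  obtain rfl := hξ.unique (hv.hasForwardEndpoint hra)
  obtain rfl := hη.unique (hv.hasBackwardEndpoint hrb)
  have hends : HasRankOneEnds C a b :=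
    ⟨(h.isSmoothPoint_iff hra hv.fst_mem).1 hξs, (h.isSmoothPoint_iff hrb hv.snd_mem).1 hηs,
      (h.isStronglyExtremal_iff hra hv.fst_mem).1 hξe,
      (h.isStronglyExtremal_iff hrb hv.snd_mem).1 hηe⟩
  refine ⟨hends, ?_⟩
  obtain ⟨γ, hγ, hγv⟩ : ∃ γ ∈ Γ, ∀ t, γ • (v.flow s).curve t = v.curve t := Quotient.exact hflow
  -- The element γ brings the flowed vector back to v, so its inverse is the one translating
  -- forwards by s.
  obtain ⟨A, hA, hAγ⟩ := h.exists_lift (hΓ (Γ.inv_mem hγ))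
  have htr : ∀ t, Matrix.ProjGenLinGroup.mk A • v.curve t = v.curve (t + s) := by
    intro t
    rw [hAγ, inv_smul_eq_iff]
    exact (hγv t).symm
  set k := Real.exp (2 * s) with hk
  have hk1 : 1 < k := Real.one_lt_exp_iff.2 (by linarith)
  have hli := h.linearIndependent hv.fst_mem hv.snd_mem hv.add_mem
  obtain ⟨c, hAa, hAb⟩ := eigen_of_translation (A := A.1) hli (k := k) (by positivity) (by
    intro x hx
    have h1 := (hv.represents (Real.log x / 2)).mk_smul A
    have h2 := hv.represents (Real.log x / 2 + s)
    rw [htr] at h1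
    obtain ⟨c, -, hc⟩ := h2.exists_smul h1
    rw [mul_add, mul_div_cancel₀ _ two_ne_zero, Real.exp_add, Real.exp_log hx] at hc
    exact ⟨c, by rw [hc, mul_comm x]⟩)
  have hc : 0 < c := by
    have h1 := (hA _).2 hv.add_mem
    rw [Matrix.mulVec_add, hAa, hAb] at h1
    have h2 := h.pos _ h1
    rw [dotProduct_add, dotProduct_smul, dotProduct_smul, smul_eq_mul, smul_eq_mul] at h2
    have h3 := h.closure_pos hv.fst_mem.1 hv.fst_ne_zero
    have h4 := h.closure_pos hv.snd_mem.1 hv.snd_ne_zero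
    have h5 : 0 < c * (f ⬝ᵥ b + k * f ⬝ᵥ a) := by linarith
    exact pos_of_mul_pos_left h5 (by positivity)
  have hba : b + a ∈ C := add_comm a b ▸ hv.add_mem
  obtain ⟨φ, hφ⟩ := h.isAttracting_of_extremal hA hv.add_mem hv.fst_mem hv.snd_mem hc
    (by nlinarith : c < c * k) hAa hAb hends
  obtain ⟨ψ, hψ⟩ := h.isAttracting_of_extremal (inv_mem hA) hba hv.snd_mem hv.fst_mem
    (inv_pos.2 (by positivity : 0 < c * k))
    (inv_strictAnti₀ hc (by nlinarith : c < c * k)) (inv_mulVec_of_eigen hc.ne' hAb)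
    (inv_mulVec_of_eigen (by positivity) hAa)
    ⟨hends.snd_support, hends.fst_support, hends.snd_extremal, hends.fst_extremal⟩
  exact ⟨A, φ, ψ, c * k, c, by rw [hAγ]; exact Γ.inv_mem hγ, hA, hφ, hψ, hv.add_mem, hli⟩

/-! ### Density of the rank-one periodic vectors -/

/-- The linear automorphisms of the cone `C` that are lifts of elements of `Γ`. -/
def coneLifts (C : Set (E d)) (Γ : Subgroup (PGLV d)) : Subgroup (GL (Fin (d + 1)) ℝ) :=
  coneStabilizer C ⊓ Γ.comap Matrix.ProjGenLinGroup.mk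

theorem IsConeOver.exists_mem_coneLifts (h : IsConeOver Ω C f) {Γ : Subgroup (PGLV d)}
    (hΓ : Γ ≤ Aut Ω) {γ : PGLV d} (hγ : γ ∈ Γ) :
    ∃ A ∈ coneLifts C Γ, Matrix.ProjGenLinGroup.mk A = γ := by
  obtain ⟨A, hA, rfl⟩ := h.exists_lift (hΓ hγ)
  exact ⟨A, ⟨hA, hγ⟩, rfl⟩

/-- By irreducibility, no orbit lies in a hyperplane. -/
theorem IsConeOver.exists_dotProduct_ne_zero (h : IsConeOver Ω C f) {Γ : Subgroup (PGLV d)}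
    (hΓ : Γ ≤ Aut Ω) (hirr : IsStronglyIrreducible Γ) {a φ : E d} (ha : a ≠ 0) (hφ : φ ≠ 0) :
    ∃ B ∈ coneLifts C Γ, φ ⬝ᵥ (B.1 *ᵥ a) ≠ 0 := by
  by_contra hcon
  push Not at hcon
  -- The span of the orbit is invariant, nonzero and contained in ker φ, so this single subspace
  -- contradicts irreducibility.
  set W : Submodule ℝ (E d) := Submodule.span ℝ {w | ∃ B ∈ coneLifts C Γ, w = B.1 *ᵥ a} with hW
  have hWφ : ∀ w ∈ W, φ ⬝ᵥ w = 0 := by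
    intro w hw
    have hle : W ≤ LinearMap.ker (dotProductEquiv ℝ (Fin (d + 1)) φ) := by
      rw [hW, Submodule.span_le]
      rintro _ ⟨B, hB, rfl⟩
      simpa using hcon B hB
    simpa using hle hw
  have hWtop : W ≠ ⊤ := by
    intro htop
    have := hWφ φ (htop ▸ Submodule.mem_top)
    exact hφ (by simpa using this)
  have hWinv : ∀ B ∈ coneLifts C Γ, ∀ w ∈ W, B.1 *ᵥ w ∈ W := by
    intro B hB w hw
    have hle : W ≤ W.comap (Matrix.mulVecLin B.1) := by
      conv_lhs => rw [hW]
      rw [Submodule.span_le]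
      rintro _ ⟨B', hB', rfl⟩
      refine Submodule.subset_span ⟨B * B', mul_mem hB hB', ?_⟩
      rw [Matrix.mulVecLin_apply, Matrix.mulVec_mulVec, Units.val_mul]
    exact hle hw
  have hsub : ∀ γ ∈ Γ, γ • {x : P d | ∃ W' ∈ ({W} : Set (Submodule ℝ (E d))), x.submodule ≤ W'} ⊆
      {x : P d | ∃ W' ∈ ({W} : Set (Submodule ℝ (E d))), x.submodule ≤ W'} := by
    rintro γ hγ _ ⟨x, ⟨_, rfl, hx⟩, rfl⟩
    obtain ⟨B, hB, rfl⟩ := h.exists_mem_coneLifts hΓ hγ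
    refine ⟨_, rfl, ?_⟩
    exact ((represents_rep x).mk_smul B).submodule_le.2
      (hWinv B hB _ ((represents_rep x).submodule_le.1 hx))
  have hempty := hirr {W} (finite_singleton W) (by rintro _ rfl; exact hWtop) fun γ hγ => by
    refine Subset.antisymm (hsub γ hγ) ?_
    rw [subset_smul_set_iff]
    exact hsub _ (Γ.inv_mem hγ)
  have hmem : Projectivization.mk ℝ a ha ∈
      {x : P d | ∃ W' ∈ ({W} : Set (Submodule ℝ (E d))), x.submodule ≤ W'} :=
    ⟨W, rfl, (represents_mk ha).submodule_le.2
      (Submodule.subset_span ⟨1, one_mem _, by simp⟩)⟩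
  rw [hempty] at hmem
  exact hmem

/-- The proximal limit set lies in the closure of each orbit. -/
theorem IsConeOver.exists_orbit_near (h : IsConeOver Ω C f) {Γ : Subgroup (PGLV d)}
    (hΓ : Γ ≤ Aut Ω) (hirr : IsStronglyIrreducible Γ) {a₀ : E d} (ha₀ : a₀ ∈ closure C)
    (ha₀0 : a₀ ≠ 0) {a : E d} {x : P d} (hax : Represents a x) (ha : a ∈ closure C)
    (hx : x ∈ proximalLimitSet Γ) {ε : ℝ} (hε : 0 < ε) :
    ∃ B ∈ coneLifts C Γ, ∃ c : ℝ, 0 < c ∧ ‖c • (B.1 *ᵥ a₀) - a‖ < ε := by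
  -- Positivity of f near a is what makes the final scalar c positive.
  have hfa : ∀ᶠ w in 𝓝 a, ‖w - a‖ < ε ∧ 0 < f ⬝ᵥ w := by
    have hc : Continuous fun w : E d => f ⬝ᵥ w := continuous_const.dotProduct continuous_id
    refine Filter.Eventually.and ?_
      ((hc.tendsto a).eventually_const_lt (h.closure_pos ha hax.ne_zero))
    filter_upwards [Metric.ball_mem_nhds a hε] with w hw
    rwa [← mem_ball_iff_norm]
  obtain ⟨δ, hδ, hball⟩ := Metric.eventually_nhds_iff_ball.1 hfa
  obtain ⟨y, ⟨w, hw, hwδ⟩, γ, hγ, hy⟩ :=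
    mem_closure_iff_nhds.1 hx _ (represents_near_mem_nhds hax hδ)
  obtain ⟨A, hA, rfl⟩ := h.exists_mem_coneLifts hΓ hγ
  obtain ⟨μ, φ, hφ⟩ := exists_isAttracting_of_represents hy hw
  have hφ0 : φ ≠ 0 := by
    rintro rfl
    simpa using hφ.2.1
  -- Once B moves a₀ off the repelling hyperplane ker φ, the powers of A carry it towards the
  -- attracting line.
  obtain ⟨B, hB, hBφ⟩ := h.exists_dotProduct_ne_zero hΓ hirr ha₀0 hφ0
  have hlim := (hφ.tendsto (B.1 *ᵥ a₀)).const_smul (φ ⬝ᵥ (B.1 *ᵥ a₀))⁻¹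
  rw [smul_smul, inv_mul_cancel₀ hBφ, one_smul] at hlim
  obtain ⟨n, hn⟩ := (hlim.eventually
    (Metric.isOpen_ball.mem_nhds (show w ∈ Metric.ball a δ by rwa [mem_ball_iff_norm]))).exists
  obtain ⟨hn1, hn2⟩ := hball _ hn
  have hmem : A ^ n * B ∈ coneLifts C Γ := mul_mem (pow_mem hA n) hB
  have heq : A.1 ^ n *ᵥ (B.1 *ᵥ a₀) = (A ^ n * B).1 *ᵥ a₀ := by
    rw [Matrix.mulVec_mulVec, Units.val_mul, Units.val_pow_eq_pow_val]
  rw [heq, smul_smul] at hn1 hn2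
  refine ⟨_, hmem, _, ?_, hn1⟩
  rw [dotProduct_smul, smul_eq_mul] at hn2
  exact pos_of_mul_pos_left hn2 (h.closure_nonneg ((mulVec_mem_closure_iff hmem.1).2 ha₀))

/-! ### Conjugates and products of proximal elements -/

theorem IsAttracting.conj {A B : GL (Fin (d + 1)) ℝ} {μ : ℝ} {v φ : E d}
    (h : IsAttracting A.1 μ v φ) :
    IsAttracting (B * A * B⁻¹).1 μ (B.1 *ᵥ v) (φ ᵥ* B⁻¹.1) := by
  refine ⟨h.1, by rw [← Matrix.dotProduct_mulVec, inv_mulVec_mulVec, h.2.1], ?_⟩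
  rw [tendsto_matrix_iff]
  intro z
  have h1 := tendsto_mulVec (tendsto_const_nhds (x := B.1)) (h.tendsto (B⁻¹.1 *ᵥ z))
  rw [vecMulVec_mulVec', ← Matrix.dotProduct_mulVec, ← Matrix.mulVec_smul]
  refine h1.congr fun n => ?_
  rw [← Units.val_pow_eq_pow_val (B * A * B⁻¹), conj_pow, Units.val_mul, Units.val_mul,
    Units.val_pow_eq_pow_val, Matrix.smul_mulVec, ← Matrix.mulVec_mulVec, ← Matrix.mulVec_mulVec,
    Matrix.mulVec_smul]

theorem IsBiproximalWith.conj {A B : GL (Fin (d + 1)) ℝ} {a b φ ψ : E d} {α β : ℝ}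
    (h : IsConeOver Ω C f) (hA : IsBiproximalWith C A a b φ ψ α β) (hB : B ∈ coneStabilizer C) :
    IsBiproximalWith C (B * A * B⁻¹) (B.1 *ᵥ a) (B.1 *ᵥ b) (φ ᵥ* B⁻¹.1) (ψ ᵥ* B⁻¹.1) α β := by
  have hbd : ∀ x ∈ closure C \ C, B.1 *ᵥ x ∈ closure C \ C := fun x hx =>
    ⟨(mulVec_mem_closure_iff hB).2 hx.1, fun h1 => hx.2 ((hB x).1 h1)⟩
  have hadd : B.1 *ᵥ a + B.1 *ᵥ b ∈ C := by
    rw [← Matrix.mulVec_add]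
    exact (hB _).2 hA.add_mem
  refine ⟨mul_mem (mul_mem hB hA.mem) (inv_mem hB), hA.fst.conj, ?_, hadd,
    h.linearIndependent (hbd a (hA.fst_mem h)) (hbd b (hA.snd_mem h)) hadd⟩
  have : (B * A * B⁻¹)⁻¹ = B * A⁻¹ * B⁻¹ := by group
  rw [this]
  exact hA.snd.conj

/-- The elements `A₁ⁿ K A₂ⁿ` are proximal for large `n`, and their attracting lines converge to the
one of `A₁`. -/
theorem eventually_isAttracting_mul {A₁ A₂ K : GL (Fin (d + 1)) ℝ} {μ₁ μ₂ : ℝ} {p q φ ψ : E d}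
    (h1 : IsAttracting A₁.1 μ₁ p φ) (h2 : IsAttracting A₂.1 μ₂ q ψ)
    (hφ : φ ⬝ᵥ (K.1 *ᵥ q) ≠ 0) (hψ : ψ ⬝ᵥ p ≠ 0) {c ε : ℝ} (hc : c ≠ 0) (hε : 0 < ε) :
    ∀ᶠ n in atTop, ∃ μ w θ, IsAttracting (A₁ ^ n * K * A₂ ^ n).1 μ w θ ∧ ‖w - c • p‖ < ε := by
  set κ := φ ⬝ᵥ (K.1 *ᵥ q) with hκ
  -- Normalised, A₂ⁿ sends z to ψ(z)q, K moves q off ker φ, and A₁ⁿ sends Kq to κp. Dividing by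
  -- κψ(p) makes the limit a projection onto the line of p, written with the vector cp to be
  -- approximated.
  have hlim : Tendsto (fun n : ℕ => ((κ * ψ ⬝ᵥ p)⁻¹ * ((μ₁ ^ n)⁻¹ * (μ₂ ^ n)⁻¹)) •
      (A₁ ^ n * K * A₂ ^ n).1) atTop
      (𝓝 (Matrix.vecMulVec (c • p) ((c * ψ ⬝ᵥ p)⁻¹ • ψ))) := by
    rw [tendsto_matrix_iff]
    intro z
    have e1 := (tendsto_mulVec h1.2.2 (tendsto_mulVec (tendsto_const_nhds (x := K.1))
      (h2.tendsto z))).const_smul (κ * ψ ⬝ᵥ p)⁻¹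
    rw [Matrix.mulVec_smul, Matrix.mulVec_smul, vecMulVec_mulVec', ← hκ] at e1
    convert e1 using 2
    · rw [Units.val_mul, Units.val_mul, Units.val_pow_eq_pow_val, Units.val_pow_eq_pow_val,
        Matrix.smul_mulVec, Matrix.smul_mulVec, Matrix.mulVec_smul, Matrix.mulVec_smul,
        ← Matrix.mulVec_mulVec, ← Matrix.mulVec_mulVec, smul_smul, smul_smul, mul_assoc]
    · rw [vecMulVec_mulVec', smul_dotProduct, smul_smul, smul_smul, smul_smul, smul_eq_mul]
      congr 1
      field_simp
  have hone : ((c * ψ ⬝ᵥ p)⁻¹ • ψ) ⬝ᵥ (c • p) = 1 := by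
    rw [smul_dotProduct, dotProduct_smul, smul_eq_mul, smul_eq_mul, inv_mul_cancel₀
      (mul_ne_zero hc hψ)]
  filter_upwards [hlim.eventually (eventually_isAttracting hone hε)] with n hn
  obtain ⟨μ, w, θ, h3, h4⟩ := hn
  have hs : (κ * ψ ⬝ᵥ p)⁻¹ * ((μ₁ ^ n)⁻¹ * (μ₂ ^ n)⁻¹) ≠ 0 :=
    mul_ne_zero (inv_ne_zero (mul_ne_zero hφ hψ)) (mul_ne_zero
      (inv_ne_zero (pow_ne_zero n h1.1)) (inv_ne_zero (pow_ne_zero n h2.1)))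
  have h5 := h3.smul (inv_ne_zero hs)
  rw [smul_smul, inv_mul_cancel₀ hs, one_smul] at h5
  exact ⟨_, w, θ, h5, h4⟩

theorem ConeExtremal.smul (h : IsConeOver Ω C f) {a : E d} (ha : ConeExtremal C a)
    (haC : a ∈ closure C) {c : ℝ} (hc : 0 < c) : ConeExtremal C (c • a) := by
  intro z hz haz
  obtain ⟨t, ht⟩ := ha z hz fun h1 => haz (by
    simpa using h.comb_mem haC hz one_pos one_pos hc one_pos (by simpa using h1))
  exact ⟨t / c, by rw [ht, smul_smul, div_mul_cancel₀ _ hc.ne']⟩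

/-- The element is A₁ⁿ K A₂⁻ⁿ, where A₁ and A₂ are conjugates of A₀ with attracting points p₁, p₂
near the prescribed endpoints. Its inverse A₂ⁿ K⁻¹ A₁⁻ⁿ has the same shape, so one product lemma
controls both fixed points. -/
theorem IsConeOver.exists_biproximal_near (h : IsConeOver Ω C f) {Γ : Subgroup (PGLV d)}
    (hΓ : Γ ≤ Aut Ω) (hirr : IsStronglyIrreducible Γ) {A₀ : GL (Fin (d + 1)) ℝ}
    {a₀ b₀ φ₀ ψ₀ : E d} {α₀ β₀ : ℝ} (hA₀Γ : A₀ ∈ coneLifts C Γ)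
    (hA₀ : IsBiproximalWith C A₀ a₀ b₀ φ₀ ψ₀ α₀ β₀) (hends : HasRankOneEnds C a₀ b₀)
    {a b : E d} {x y : P d} (hax : Represents a x) (hby : Represents b y) (ha : a ∈ closure C)
    (hb : b ∈ closure C) (hab : a + b ∈ C) (hx : x ∈ proximalLimitSet Γ)
    (hy : y ∈ proximalLimitSet Γ) {ε : ℝ} (hε : 0 < ε) :
    ∃ A ∈ coneLifts C Γ, ∃ a' b' φ ψ α β, IsBiproximalWith C A a' b' φ ψ α β ∧
      ConeExtremal C a' ∧ ConeExtremal C b' ∧ ‖a' - a‖ < ε ∧ ‖b' - b‖ < ε := by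
  have ha₀ := hA₀.fst_mem h
  obtain ⟨δ, hδ, hball⟩ := Metric.isOpen_iff.1 h.isOpen _ hab
  have hρ : 0 < min (ε / 2) (δ / 2) := by positivity
  obtain ⟨B₁, hB₁, c₁, hc₁, hn₁⟩ :=
    h.exists_orbit_near hΓ hirr ha₀.1 hA₀.fst.ne_zero hax ha hx hρ
  obtain ⟨B₂, hB₂, c₂, hc₂, hn₂⟩ :=
    h.exists_orbit_near hΓ hirr ha₀.1 hA₀.fst.ne_zero hby hb hy hρ
  rw [lt_min_iff] at hn₁ hn₂
  have h₁ := hA₀.conj h hB₁.1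
  have h₂ := hA₀.conj h hB₂.1
  have e₁ := hends.mulVec hB₁.1
  have e₂ := hends.mulVec hB₂.1
  set A₁ := B₁ * A₀ * B₁⁻¹ with hA₁
  set A₂ := B₂ * A₀ * B₂⁻¹ with hA₂
  have hA₁Γ : A₁ ∈ coneLifts C Γ := mul_mem (mul_mem hB₁ hA₀Γ) (inv_mem hB₁)
  have hA₂Γ : A₂ ∈ coneLifts C Γ := mul_mem (mul_mem hB₂ hA₀Γ) (inv_mem hB₂)
  set p₁ := B₁.1 *ᵥ a₀
  set p₂ := B₂.1 *ᵥ a₀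
  set q₁ := B₁.1 *ᵥ b₀
  set q₂ := B₂.1 *ᵥ b₀
  have hp₁ := h₁.fst_mem h
  have hp₂ := h₂.fst_mem h
  have hcadd : c₁ • p₁ + c₂ • p₂ ∈ C := by
    refine hball ?_
    rw [mem_ball_iff_norm, show c₁ • p₁ + c₂ • p₂ - (a + b) = (c₁ • p₁ - a) + (c₂ • p₂ - b) by
      abel]
    refine (norm_add_le _ _).trans_lt ?_
    linarith [hn₁.2, hn₂.2]
  have hpadd : p₁ + p₂ ∈ C := by
    simpa using h.comb_mem hp₁.1 hp₂.1 hc₁ hc₂ one_pos one_pos hcadd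
  -- The form is positive on p₁ + p₂ and vanishes at p₂.
  have hψ₂ : 0 < (ψ₀ ᵥ* B₂⁻¹.1) ⬝ᵥ p₁ := by
    have := h₂.symm.dot_pos h hpadd
    rwa [dotProduct_add, h₂.symm.dot_snd.1, add_zero] at this
  have hψ₁ : 0 < (ψ₀ ᵥ* B₁⁻¹.1) ⬝ᵥ p₂ := by
    have := h₁.symm.dot_pos h hpadd
    rwa [dotProduct_add, h₁.symm.dot_snd.1, zero_add] at this
  have hφ₁0 : φ₀ ᵥ* B₁⁻¹.1 ≠ 0 := by
    intro h0
    have := h₁.fst.2.1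
    rw [h0] at this
    simp at this
  obtain ⟨K, hK, hKφ⟩ := h.exists_dotProduct_ne_zero hΓ hirr h₂.snd.ne_zero hφ₁0
  -- The transversality needed for the inverse is automatic: if it failed, q₂ + K⁻¹q₁ would lie in
  -- the kernel of a form positive on C, so extremality of q₂ would make q₁ a multiple tKq₂. Since
  -- the form dual to p₁ kills q₁ but not Kq₂, t = 0 and q₁ = 0.
  have hKφ' : (φ₀ ᵥ* B₂⁻¹.1) ⬝ᵥ (K⁻¹.1 *ᵥ q₁) ≠ 0 := by
    intro h0
    obtain ⟨t, ht⟩ := e₂.snd_extremal (K⁻¹.1 *ᵥ q₁)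
      ((mulVec_mem_closure_iff (inv_mem hK.1)).2 (h₁.snd_mem h).1) fun h1 => by
        have := h₂.dot_pos h h1
        rw [dotProduct_add, h0, h₂.dot_snd.1, add_zero] at this
        exact lt_irrefl _ this
    have h3 : q₁ = t • (K.1 *ᵥ q₂) := by
      rw [← Matrix.mulVec_smul, ← ht, mulVec_inv_mulVec]
    have h4 := h₁.dot_snd.1
    rw [h3, dotProduct_smul, smul_eq_mul] at h4
    refine h₁.snd.ne_zero ?_
    rw [h3, (mul_eq_zero.1 h4).resolve_right hKφ, zero_smul]
  -- The local result is used at (c₁p₁, c₂p₂), where p₁ is known to be extremal, and not at (a, b),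
  -- where extremality is not assumed.
  obtain ⟨η, hη, hloc⟩ := h.eventually_biproximal (a := c₁ • p₁) (b := c₂ • p₂)
    ⟨h.closure_smul hp₁.1 hc₁, fun h1 => hp₁.2 ((h.smul_mem_iff hc₁).1 h1)⟩
    ⟨h.closure_smul hp₂.1 hc₂, fun h1 => hp₂.2 ((h.smul_mem_iff hc₂).1 h1)⟩ hcadd
    (e₁.fst_extremal.smul h hp₁.1 hc₁)
  have hτ : 0 < min η (ε / 2) := by positivity
  obtain ⟨n, ⟨μ, w, θ, hw, hwn⟩, ⟨μ', w', θ', hw', hwn'⟩⟩ :=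
    ((eventually_isAttracting_mul h₁.fst h₂.snd hKφ hψ₂.ne' hc₁.ne' hτ).and
      (eventually_isAttracting_mul h₂.fst h₁.snd hKφ' hψ₁.ne' hc₂.ne' hτ)).exists
  rw [lt_min_iff] at hwn hwn'
  have hmem : A₁ ^ n * K * A₂⁻¹ ^ n ∈ coneLifts C Γ :=
    mul_mem (mul_mem (pow_mem hA₁Γ n) hK) (pow_mem (inv_mem hA₂Γ) n)
  have hinv : (A₁ ^ n * K * A₂⁻¹ ^ n)⁻¹ = A₂ ^ n * K⁻¹ * A₁⁻¹ ^ n := by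
    clear_value A₁ A₂
    group
  obtain ⟨r1, r2, r3⟩ := hloc w w' hwn.1 hwn'.1 _ hmem.1 θ θ' μ μ'⁻¹ hw
    (by rw [inv_inv, hinv]; exact hw')
  refine ⟨_, hmem, w, w', θ, θ', μ, μ'⁻¹, r1, r2, r3, ?_, ?_⟩
  · rw [show w - a = (w - c₁ • p₁) + (c₁ • p₁ - a) by abel]
    exact (norm_add_le _ _).trans_lt (by linarith [hwn.2, hn₁.1])
  · rw [show w' - b = (w' - c₂ • p₂) + (c₂ • p₂ - b) by abel]
    exact (norm_add_le _ _).trans_lt (by linarith [hwn'.2, hn₂.1])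

/-! ### Inclusion in the biproximal unit tangent bundle, and density -/

theorem IsConeOver.mem_T1Mbip (h : IsConeOver Ω C f) {Γ : Subgroup (PGLV d)} (hΓ : Γ ≤ Aut Ω)
    {v : T1M Ω Γ} (hv : v.IsRankOnePeriodic) : v ∈ T1Mbip Ω Γ := by
  obtain ⟨v, rfl⟩ := Quotient.exists_rep v
  obtain ⟨a, b, hab⟩ := h.exists_isGeodesic v
  obtain ⟨-, A, φ, ψ, α, β, hAΓ, hA⟩ := h.exists_isBiproximalWith hΓ hab hv
  have h1 := represents_mk hab.fst_ne_zero
  have h2 := represents_mk hab.snd_ne_zero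
  refine ⟨v, ⟨⟨_, subset_closure ⟨_, hAΓ, ?_⟩, hab.hasForwardEndpoint h1⟩,
    ⟨_, subset_closure ⟨_, Γ.inv_mem hAΓ, ?_⟩, hab.hasBackwardEndpoint h2⟩⟩, rfl⟩
  · exact isAttractingFixedPoint_mk_iff.2 ⟨α, a, φ, hA.fst, h1⟩
  · rw [← map_inv]
    exact isAttractingFixedPoint_mk_iff.2 ⟨β⁻¹, b, ψ, hA.snd, h2⟩

theorem IsConeOver.T1Mbip_subset_closure (h : IsConeOver Ω C f) {Γ : Subgroup (PGLV d)}
    (hΓ : Γ ≤ Aut Ω) (hirr : IsStronglyIrreducible Γ) (hrank : IsRankOneQuotient Ω Γ) :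
    T1Mbip Ω Γ ⊆ closure {v : T1M Ω Γ | v.IsRankOnePeriodic} := by
  rintro _ ⟨v, ⟨⟨ξ, hξΛ, hξ⟩, ⟨η, hηΛ, hη⟩⟩, rfl⟩
  obtain ⟨v₀, hv₀⟩ := hrank
  obtain ⟨v₀, rfl⟩ := Quotient.exists_rep v₀
  obtain ⟨a₀, b₀, hab₀⟩ := h.exists_isGeodesic v₀
  obtain ⟨hends, A₀, φ₀, ψ₀, α₀, β₀, hA₀Γ, hA₀⟩ := h.exists_isBiproximalWith hΓ hab₀ hv₀
  obtain ⟨a, b, hab⟩ := h.exists_isGeodesic v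
  have h1 := represents_mk hab.fst_ne_zero
  have h2 := represents_mk hab.snd_ne_zero
  obtain rfl := hξ.unique (hab.hasForwardEndpoint h1)
  obtain rfl := hη.unique (hab.hasBackwardEndpoint h2)
  refine _root_.mem_closure_iff.2 fun O hO hvO => ?_
  have hO' : IsOpen (T1.proj Γ ⁻¹' O) := isOpen_coinduced.1 hO
  obtain ⟨r, hr, hrO⟩ : ∃ r > 0, ∀ w : T1 Ω, T1.dist v w < r → w ∈ T1.proj Γ ⁻¹' O := hO' v hvO
  obtain ⟨ε, hε, hnear⟩ := h.exists_near hab hr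
  obtain ⟨A, hAΓ, a', b', φ, ψ, α, β, hA, hea, heb, hna, hnb⟩ :=
    h.exists_biproximal_near hΓ hirr (A₀ := A₀) ⟨hA₀.mem, hA₀Γ⟩ hA₀ hends h1 h2 hab.fst_mem.1
      hab.snd_mem.1 hab.add_mem hξΛ hηΛ hε
  obtain ⟨w, hw⟩ := h.exists_isGeodesic_of_boundary (hA.fst_mem h) (hA.snd_mem h) hA.add_mem
  obtain ⟨hβ, hβα⟩ := hA.eigen_pos h
  exact ⟨w.proj Γ, hrO w (hnear a' b' hna hnb w hw),
    h.isRankOnePeriodic hΓ hAΓ.2 hw hβ hβα hA.fst.mulVec hA.mulVec_snd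
      (hA.hasRankOneEnds h hea heb)⟩

end ConvexProjective

theorem proposition3p3 (d : ℕ) (Ω : Set (P d)) (hΩ : IsProperlyConvexOpen Ω) :
    (∀ ξ η : P d, (ξ, η) ∈ Geod Ω → IsStronglyExtremal Ω ξ →
      ∃ U ∈ 𝓝 ξ, ∃ W ∈ 𝓝 η, ∀ g ∈ Aut Ω, IsBiproximal g →
        ∀ x y : P d, IsAttractingFixedPoint g x → IsRepellingFixedPoint g y →
          x ∈ U → y ∈ W → IsRankOneAut Ω g) ∧
    (∀ Γ : Subgroup (PGLV d), Γ ≤ Aut Ω → DiscreteTopology Γ → IsStronglyIrreducible Γ →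
      IsRankOneQuotient Ω Γ →
        {v : T1M Ω Γ | v.IsRankOnePeriodic} ⊆ T1Mbip Ω Γ ∧
        T1Mbip Ω Γ ⊆ closure {v : T1M Ω Γ | v.IsRankOnePeriodic} ∧
        (T1Mbip Ω Γ).Nonempty) := by
  refine ⟨fun ξ η hξη hξ => ?_, fun Γ hΓ _ hirr hrank => ?_⟩
  · obtain ⟨U, hU, W, hW, hUW⟩ := exists_nhds_isRankOneAut hΩ hξη hξ
    exact ⟨U, hU, W, hW, fun g hg _ x y hx hy => hUW g hg x y hx hy⟩
  · obtain ⟨C, f, h⟩ := exists_isConeOver hΩ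
    refine ⟨fun v hv => h.mem_T1Mbip hΓ hv, h.T1Mbip_subset_closure hΓ hirr hrank, ?_⟩
    obtain ⟨v, hv⟩ := hrank
    exact ⟨v, h.mem_T1Mbip hΓ hv⟩
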